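/- Let $\Lambda=\{\lambda_k\}_{k\ge 0}$ be a strictly increasing sequence of positive real numbers, and let $0=n_0<n_1<n_2<\cdots$ be integers such that $\Lambda$ is quasi-lacunary and subgeometric with respect to the blocks $E_k=\{\lambda_{n_k+1},\dots,\lambda_{n_{k+1}}\}$, $k\ge 0$ (so that $\Lambda$ is the disjoint union of $\{\lambda_0\}$ and of the $E_k$); that is, there are an integer $N\ge 1$ and real numbers $q,q'>1$ such that $\#E_k\le N$ for all $k$, and $q<\lambda_{n_{k+1}}/\lambda_{n_k}\le q'$ for all sufficiently large $k$. Let $M_\Lambda$ be the space of functions $f(t)=\sum_{k=0}^K a_k t^{\lambda_k}$ on $[0,1]$ with $K\ge 0$ and $a_k\in\mathbb C$. For $\alpha>0$ and $1\le s<\infty$, let $M^{s}_{\Lambda,\alpha}$ be the closure of $M_\Lambda$ in $L^{s}([0,1],(1-x)^{\alpha-1}\,\mathrm dx)$. For a positive Borel measure $\mu$ on $[0,1]$ and $1\le r<\infty$, the embedding $M^s_{\Lambda,\alpha}\hookrightarrow L^r(\mu)$ is said to hold if $M_\Lambda\subset L^r(\mu)$ and the map sending $f\in M_\Lambda$ to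 its class in $L^r(\mu)$ extends to a continuous linear operator $M^s_{\Lambda,\alpha}\to L^r(\mu)$ (necessarily unique, and not required to be injective); the embedding is compact if this operator is compact. Let $\mu$ be a positive Borel measure on $[0,1]$, $\alpha>0$, $0<\beta<1$ and $p\ge 1$. Then the following are equivalent: (i) the embedding $M^{p/\beta}_{\Lambda,\alpha}\hookrightarrow L^p(\mu)$ holds; (ii) $\displaystyle\sum_{k\ge 0}\lambda_{n_k}^{\frac{\alpha\beta}{1-\beta}}\Big(\int_{[0,1]}t^{p\lambda_{n_k}}\,\mathrm d\mu(t)\Big)^{\frac{1}{1-\beta}}<+\infty$. Moreover, whenever these conditions hold, the embedding is compact. -/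

import Mathlib

open MeasureTheory Filter
open scoped ENNReal unitInterval

noncomputable section

namespace Muntz

/-- The block `E_k = {λ_{n_k + 1}, …, λ_{n_{k+1}}}`. -/
def block (lam : ℕ → ℝ) (n : ℕ → ℕ) (k : ℕ) : Finset ℝ :=
  (Finset.Ioc (n k) (n (k + 1))).image lam

/-- `Λ = {λ_0 < λ_1 < …} ⊂ (0, ∞)` is quasi-lacunary, and `n` is the sequence of indices of a
corresponding decomposition into blocks. As `n 0 = 0` and `n` is strictly increasing, `Λ` is the
disjoint union of `{λ_0}` and of the (nonempty) blocks `E_k`, `k ≥ 0`. -/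
structure IsQuasiLacunary (lam : ℕ → ℝ) (n : ℕ → ℕ) : Prop where
  pos : ∀ k, 0 < lam k
  strictMono : StrictMono lam
  index_zero : n 0 = 0
  index_strictMono : StrictMono n
  card_block_le : ∃ N : ℕ, 1 ≤ N ∧ ∀ k, (block lam n k).card ≤ N
  ratio_gt : ∃ q : ℝ, 1 < q ∧ ∀ᶠ k in atTop, q < lam (n (k + 1)) / lam (n k)

/-- The subgeometric condition, for the same decomposition into blocks. -/
def IsSubgeometric (lam : ℕ → ℝ) (n : ℕ → ℕ) : Prop :=
  ∃ q' : ℝ, 1 < q' ∧ ∀ᶠ k in atTop, lam (n (k + 1)) / lam (n k) ≤ q'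

/-- The space `M_Λ` of Müntz polynomials `t ↦ ∑_{k ≤ K} a_k t ^ λ_k` on `[0,1]`, with complex
coefficients. -/
def polynomials (lam : ℕ → ℝ) : Submodule ℂ (I → ℂ) :=
  Submodule.span ℂ (Set.range fun (k : ℕ) (t : I) => (((t : ℝ) ^ lam k : ℝ) : ℂ))

/-- The measure `dν_{α-1} = (1 - x) ^ (α - 1) dx` on `[0,1]`. -/
def nu (α : ℝ) : Measure I :=
  (volume : Measure I).withDensity fun x => ENNReal.ofReal ((1 - (x : ℝ)) ^ (α - 1))

/-- The classes in `L^s(ν)` of the Müntz polynomials. -/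
def polynomialsLp (lam : ℕ → ℝ) (s : ℝ≥0∞) (ν : Measure I) : Submodule ℂ (Lp ℂ s ν) where
  carrier := {g | ∃ f ∈ polynomials lam, g =ᵐ[ν] f}
  zero_mem' := ⟨0, Submodule.zero_mem _, Lp.coeFn_zero ℂ s ν⟩
  add_mem' := by
    rintro g₁ g₂ ⟨f₁, hf₁, h₁⟩ ⟨f₂, hf₂, h₂⟩
    exact ⟨f₁ + f₂, Submodule.add_mem _ hf₁ hf₂, (Lp.coeFn_add g₁ g₂).trans (h₁.add h₂)⟩
  smul_mem' := by
    rintro c g ⟨f, hf, h⟩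
    exact ⟨c • f, Submodule.smul_mem _ c hf, (Lp.coeFn_smul c g).trans (h.const_smul c)⟩

/-- The weighted Müntz space `M_{Λ,α}^s`: the closure of `M_Λ` in `L^s(ν_{α-1})`. -/
def space (lam : ℕ → ℝ) (α : ℝ) (s : ℝ≥0∞) [Fact (1 ≤ s)] : Submodule ℂ (Lp ℂ s (nu α)) :=
  (polynomialsLp lam s (nu α)).topologicalClosure

/-- The continuous linear operator `ι : M_{Λ,α}^s → L^r(μ)` is the inclusion, i.e. the (unique)
continuous operator with `ι f = f` for every Müntz polynomial `f`. In particular every Müntz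
polynomial then belongs to `L^r(μ)`. -/
def IsInclusion (lam : ℕ → ℝ) (α : ℝ) (s r : ℝ≥0∞) [Fact (1 ≤ s)] [Fact (1 ≤ r)]
    (μ : Measure I) (ι : space lam α s →L[ℂ] Lp ℂ r μ) : Prop :=
  ∀ f ∈ polynomials lam, ∀ g : space lam α s, (g : Lp ℂ s (nu α)) =ᵐ[nu α] f → ι g =ᵐ[μ] f

/-- A real exponent that is at least `1`, as an exponent of a Lebesgue space. -/
theorem fact_one_le {s : ℝ} (hs : 1 ≤ s) : Fact (1 ≤ ENNReal.ofReal s) :=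
  ⟨ENNReal.one_le_ofReal.2 hs⟩

/-- The embedding `M_{Λ,α}^s ↪ L^r(μ)` holds. -/
def Embeds (lam : ℕ → ℝ) (α s r : ℝ) (hs : 1 ≤ s) (hr : 1 ≤ r) (μ : Measure I) : Prop :=
  haveI := fact_one_le hs
  haveI := fact_one_le hr
  ∃ ι : space lam α (ENNReal.ofReal s) →L[ℂ] Lp ℂ (ENNReal.ofReal r) μ,
    IsInclusion lam α (ENNReal.ofReal s) (ENNReal.ofReal r) μ ι

/-- The embedding `M_{Λ,α}^s ↪ L^r(μ)` holds and is compact. -/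
def EmbedsCompactly (lam : ℕ → ℝ) (α s r : ℝ) (hs : 1 ≤ s) (hr : 1 ≤ r) (μ : Measure I) : Prop :=
  haveI := fact_one_le hs
  haveI := fact_one_le hr
  ∃ ι : space lam α (ENNReal.ofReal s) →L[ℂ] Lp ℂ (ENNReal.ofReal r) μ,
    IsInclusion lam α (ENNReal.ofReal s) (ENNReal.ofReal r) μ ι ∧ IsCompactOperator ι

end Muntz

end

/-! Put s = p/β and L_k = λ_{n_k}.

Necessity is a test on f = ∑ c_k t^{L_k} with c_k ≥ 0. Since L grows geometrically, ‖f‖_s^s ≤ C ∑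
c_k^s L_k^{-α} (`exists_lintegral_sum_rpow_le`), while p ≥ 1 gives ∫ f^p dμ ≥ ∑ c_k^p ∫ t^{p L_k}
dμ. The c_k can be chosen so that the k-th terms of both sums equal the k-th term of the series in
(ii). Each partial sum X of that series then satisfies X ≤ C' X^β, hence is bounded
(`tsum_weightedMoment_lt_top`).

Sufficiency rests on a pointwise bound for the tails of a Müntz polynomial f = ∑ a_j t^{λ_j}
(`exists_tail_bound`). Put z_j = λ_j + 1 and τ = (1 + t)/2. The part of t f(t) with exponents z_j in
(u_k, u_{k+1}) is a contour integral of R(w) (t/τ)^w, where R(w) = ∑ a_j τ^{z_j} / (w - z_j). As R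
has simple poles and vanishes at infinity, it is recovered by Lagrange interpolation from its values
at points -W_i, and these values are moments of f on [0, τ]. The interpolation coefficients stay
bounded uniformly in the number of terms (`norm_interpolationFactor_le`) when W is separated,
comparable to z, and balanced so that the partial products of z_j / W_j are bounded, and when the
contour stays proportionally far from every z_j (`GeometricGrowth.exists_separated`,
`GeometricGrowth.exists_gap_points`). Summing over blocks bounds the tail beyond u_m at t by exp(-c
u_m (1 - t)) t^{λ_0} times an integral of |f| over [0, τ] against an explicit kernel.

Hölder's inequality, a decomposition of (0, 1) into annuli where 1 - t is comparable to 1/L_k, and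
Hölder for series with exponents 1/(1 - β) and 1/β then bound the L^p(μ) norm of the tail by A_m
‖f‖_s (`exists_tail_lintegral_bound`). The tail for m = 0 is f itself, which gives the embedding;
A_m → 0 exhibits it as a norm limit of finite rank operators, which gives compactness. -/

namespace Muntz

/-! ### Sequences of geometric growth -/

/-- A sequence of positive reals that grows at least geometrically, up to a constant. -/
def GeometricGrowth (z : ℕ → ℝ) : Prop :=
  (∀ k, 0 < z k) ∧ ∃ c γ : ℝ, 0 < c ∧ 1 < γ ∧ ∀ i j, c * γ ^ j * z i ≤ z (i + j)

theorem GeometricGrowth.tendsto_atTop {z : ℕ → ℝ} (hz : GeometricGrowth z) :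
    Tendsto z atTop atTop := by
  obtain ⟨hpos, c, γ, hc, hγ, h⟩ := hz
  have h1 : Tendsto (fun j : ℕ => γ ^ j * (c * z 0)) atTop atTop :=
    (tendsto_pow_atTop_atTop_of_one_lt hγ).atTop_mul_const (mul_pos hc (hpos 0))
  refine tendsto_atTop_mono (fun j => ?_) h1
  have := h 0 j
  rw [zero_add] at this
  linarith

theorem GeometricGrowth.of_comparable {z w : ℕ → ℝ} (hz : GeometricGrowth z) {C : ℝ} (hC : 0 < C)
    (h1 : ∀ k, z k ≤ C * w k) (h2 : ∀ k, w k ≤ C * z k) : GeometricGrowth w := by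
  obtain ⟨hpos, c, γ, hc, hγ, h⟩ := hz
  have hw : ∀ k, 0 < w k := fun k => by
    have := (hpos k).trans_le (h1 k)
    exact pos_of_mul_pos_right this hC.le
  refine ⟨hw, c / C ^ 2, γ, by positivity, hγ, fun i j => ?_⟩
  have hg : 0 < γ ^ j := by positivity
  have h3 : c * γ ^ j * w i ≤ C ^ 2 * w (i + j) := by
    calc c * γ ^ j * w i ≤ c * γ ^ j * (C * z i) := by gcongr; exact h2 i
      _ = C * (c * γ ^ j * z i) := by ring
      _ ≤ C * (C * w (i + j)) := mul_le_mul_of_nonneg_left ((h i j).trans (h1 _)) hC.le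
      _ = _ := by ring
  rw [div_mul_eq_mul_div, div_mul_eq_mul_div, div_le_iff₀ (by positivity)]
  linarith

theorem sum_two_sided_geometric_le {r : ℝ} (hr0 : 0 ≤ r) (hr1 : r < 1) (k₀ : ℕ) (S : Finset ℕ) :
    ∑ k ∈ S, (if k₀ ≤ k then r ^ (k - k₀) else r ^ (k₀ - 1 - k)) ≤ 2 / (1 - r) := by
  have key : ∀ (T : Finset ℕ) (g : ℕ → ℕ), Set.InjOn g T → ∑ k ∈ T, r ^ g k ≤ 1 / (1 - r) := by
    intro T g hg
    rw [← Finset.sum_image (f := fun m => r ^ m) hg, one_div, ← tsum_geometric_of_lt_one hr0 hr1]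
    exact (summable_geometric_of_lt_one hr0 hr1).sum_le_tsum _ fun i _ => pow_nonneg hr0 i
  rw [Finset.sum_ite]
  have h1 := key (S.filter fun k => k₀ ≤ k) (fun k => k - k₀) (by
    intro a ha b hb hab
    simp only [Finset.coe_filter, Set.mem_ofPred_eq] at ha hb hab
    omega)
  have h2 := key (S.filter fun k => ¬ k₀ ≤ k) (fun k => k₀ - 1 - k) (by
    intro a ha b hb hab
    simp only [Finset.coe_filter, Set.mem_ofPred_eq] at ha hb hab
    omega)
  calc _ ≤ 1 / (1 - r) + 1 / (1 - r) := add_le_add h1 h2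
    _ = 2 / (1 - r) := by ring

/-- Away from the first index k₀ with a ≤ z k₀ the terms decay geometrically in both directions, at
a rate that does not depend on a. Most sums over the sequences below are controlled through this
bound. -/
theorem GeometricGrowth.sum_min_rpow_le {z : ℕ → ℝ} (hz : GeometricGrowth z) {e : ℝ} (he : 0 < e) :
    ∃ C : ℝ, 0 < C ∧ ∀ a : ℝ, 0 < a → ∀ S : Finset ℕ,
      ∑ k ∈ S, (min (z k / a) (a / z k)) ^ e ≤ C := by
  have htop := hz.tendsto_atTop
  obtain ⟨hpos, c, γ, hc, hγ, h⟩ := hz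
  have hγ0 : 0 < γ := by linarith
  set r : ℝ := (γ⁻¹) ^ e with hr
  have hr0 : 0 ≤ r := by positivity
  have hr1 : r < 1 := Real.rpow_lt_one (by positivity) (inv_lt_one_of_one_lt₀ hγ) he
  have h1r : 0 < 1 - r := by linarith
  refine ⟨(c⁻¹) ^ e * (2 / (1 - r)), by positivity, fun a ha S => ?_⟩
  have hex : ∃ k, a ≤ z k := (htop.eventually_ge_atTop a).exists
  set k₀ := Nat.find hex with hk₀
  have hk₀a : a ≤ z k₀ := Nat.find_spec hex
  have hlt : ∀ k, k < k₀ → z k < a := fun k hk => not_le.1 (Nat.find_min hex hk)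
  have hrp : ∀ m : ℕ, (c⁻¹ * (γ⁻¹) ^ m) ^ e = (c⁻¹) ^ e * r ^ m := by
    intro m
    rw [Real.mul_rpow (by positivity) (by positivity), hr, ← Real.rpow_natCast, ← Real.rpow_natCast,
      ← Real.rpow_mul (by positivity), ← Real.rpow_mul (by positivity), mul_comm e]
  have hterm : ∀ k, (min (z k / a) (a / z k)) ^ e ≤
      (c⁻¹) ^ e * (if k₀ ≤ k then r ^ (k - k₀) else r ^ (k₀ - 1 - k)) := by
    intro k
    have hzk := hpos k
    have hmin : 0 ≤ min (z k / a) (a / z k) := by positivity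
    split_ifs with hk
    · rw [← hrp]
      refine Real.rpow_le_rpow hmin ((min_le_right _ _).trans ?_) he.le
      have := h k₀ (k - k₀)
      rw [Nat.add_sub_cancel' hk] at this
      rw [div_le_iff₀ hzk, inv_pow, mul_assoc, ← div_eq_inv_mul, le_div_iff₀ hc,
        ← div_eq_inv_mul, le_div_iff₀ (by positivity)]
      nlinarith [mul_le_mul_of_nonneg_left hk₀a (by positivity : 0 ≤ c * γ ^ (k - k₀))]
    · rw [← hrp]
      refine Real.rpow_le_rpow hmin ((min_le_left _ _).trans ?_) he.le
      -- Below k₀ the comparison is with k₀ - 1, the last index where z < a, because z k₀ may lie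
      -- far above a.
      have := h k (k₀ - 1 - k)
      rw [show k + (k₀ - 1 - k) = k₀ - 1 by omega] at this
      have h2 := hlt (k₀ - 1) (by omega)
      rw [div_le_iff₀ ha, inv_pow, mul_assoc, ← div_eq_inv_mul, le_div_iff₀ hc,
        ← div_eq_inv_mul, le_div_iff₀ (by positivity)]
      nlinarith
  calc _ ≤ ∑ k ∈ S, (c⁻¹) ^ e * (if k₀ ≤ k then r ^ (k - k₀) else r ^ (k₀ - 1 - k)) :=
        Finset.sum_le_sum fun k _ => hterm k
    _ ≤ _ := by
        rw [← Finset.mul_sum]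
        gcongr
        exact sum_two_sided_geometric_le hr0 hr1 k₀ S

theorem exists_rpow_mul_exp_neg_le {e : ℝ} (he : 0 < e) :
    ∃ C : ℝ, 0 < C ∧ ∀ x : ℝ, 0 < x → x ^ e * Real.exp (-x) ≤ C * (min x (1 / x)) ^ e := by
  refine ⟨max 1 ((2 * e) ^ (2 * e)), by positivity, fun x hx => ?_⟩
  rcases le_total x 1 with h | h
  · rw [min_eq_left (h.trans ((one_le_div hx).2 h)), mul_comm]
    have : Real.exp (-x) ≤ 1 := Real.exp_le_one_iff.2 (by linarith)
    gcongr
    exact this.trans (le_max_left _ _)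
  · rw [min_eq_right (((div_le_one hx).2 h).trans h), one_div, Real.inv_rpow hx.le,
      ← div_eq_mul_inv, le_div_iff₀ (by positivity), Real.exp_neg, mul_assoc, ← div_eq_inv_mul,
      mul_div_assoc', div_le_iff₀ (Real.exp_pos x), ← Real.rpow_add hx, ← two_mul]
    -- For x ≥ 1 the claim amounts to x^{2e} ≤ C exp x, which is this inequality raised to the power
    -- 2e.
    have h1 : x / (2 * e) ≤ Real.exp (x / (2 * e)) := by
      linarith [Real.add_one_le_exp (x / (2 * e))]
    have h2 := Real.rpow_le_rpow (by positivity) h1 (by positivity : 0 ≤ 2 * e)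
    rw [← Real.exp_mul, div_mul_cancel₀ _ (by positivity), Real.div_rpow hx.le (by positivity),
      div_le_iff₀ (by positivity)] at h2
    refine h2.trans ?_
    rw [mul_comm]
    gcongr
    exact le_max_right _ _

/-- Only the terms with z k of order 1/D matter: each summand is at most a constant times D^{-e}
min(z k D, 1/(z k D))^e. -/
theorem GeometricGrowth.sum_rpow_mul_exp_le {z : ℕ → ℝ} (hz : GeometricGrowth z) {e : ℝ}
    (he : 0 < e) :
    ∃ C : ℝ, 0 < C ∧ ∀ D : ℝ, 0 < D → ∀ S : Finset ℕ,
      ∑ k ∈ S, z k ^ e * Real.exp (-(z k * D)) ≤ C * D ^ (-e) := by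
  obtain ⟨C₁, hC₁, h₁⟩ := hz.sum_min_rpow_le he
  obtain ⟨C₂, hC₂, h₂⟩ := exists_rpow_mul_exp_neg_le he
  refine ⟨C₂ * C₁, by positivity, fun D hD S => ?_⟩
  have hterm : ∀ k, z k ^ e * Real.exp (-(z k * D)) ≤
      C₂ * D ^ (-e) * (min (z k / D⁻¹) (D⁻¹ / z k)) ^ e := by
    intro k
    have hzk := hz.1 k
    have := h₂ (z k * D) (by positivity)
    rw [Real.mul_rpow hzk.le hD.le] at this
    rw [Real.rpow_neg hD.le, show z k / D⁻¹ = z k * D by field_simp,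
      show D⁻¹ / z k = 1 / (z k * D) by field_simp, mul_right_comm, ← div_eq_mul_inv,
      le_div_iff₀ (by positivity)]
    linarith
  calc _ ≤ ∑ k ∈ S, C₂ * D ^ (-e) * (min (z k / D⁻¹) (D⁻¹ / z k)) ^ e :=
        Finset.sum_le_sum fun k _ => hterm k
    _ ≤ C₂ * D ^ (-e) * C₁ := by
        rw [← Finset.mul_sum]
        gcongr
        exact h₁ _ (by positivity) S
    _ = _ := by ring

/-- Powers `t ^ z k` are at most `exp (-(z k * (1 - t)))`. -/
theorem rpow_le_exp_neg_mul_one_sub {t u : ℝ} (ht : 0 ≤ t) (hu : 0 < u) :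
    t ^ u ≤ Real.exp (-(u * (1 - t))) := by
  have h1 : t ≤ Real.exp (t - 1) := by linarith [Real.add_one_le_exp (t - 1)]
  calc t ^ u ≤ (Real.exp (t - 1)) ^ u := Real.rpow_le_rpow ht h1 hu.le
    _ = _ := by rw [← Real.exp_mul]; ring_nf

/-! ### Interpolation nodes and gap points -/

/-- Cut the sequence into groups of G consecutive terms and replace each group by an arithmetic
progression of step d with the same mean. Complete groups then contribute nothing to the sum of m -
l, and an incomplete one contributes a bounded amount. Successive means differ by at least 2dG - K ≥
dG once K ≤ dG, so the spacing d persists across the boundary between groups. -/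
theorem exists_separated_of_almost_increasing {m : ℕ → ℝ} {d K A : ℝ} (hd : 0 < d) (hK : 0 ≤ K)
    (hA : 0 ≤ A) (hlow : ∀ i j : ℕ, m i + 2 * d * j - K ≤ m (i + j))
    (hup : ∀ j, m (j + 1) ≤ m j + A) :
    ∃ (l : ℕ → ℝ) (B : ℝ), 0 ≤ B ∧ (∀ j, |m j - l j| ≤ B) ∧ (∀ j, l j + d ≤ l (j + 1)) ∧
      ∀ n, |∑ j ∈ Finset.range n, (m j - l j)| ≤ B := by
  obtain ⟨G, hG⟩ := exists_nat_ge (max 1 (K / d))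
  have hG1 : (1 : ℝ) ≤ G := (le_max_left _ _).trans hG
  have hGK : K ≤ G * d := (div_le_iff₀ hd).1 ((le_max_right _ _).trans hG)
  have hGpos : 0 < G := by exact_mod_cast (zero_lt_one.trans_le hG1)
  have hG0 : (G : ℝ) ≠ 0 := by positivity
  set avg : ℕ → ℝ := fun g => (∑ s ∈ Finset.range G, m (G * g + s)) / G with havg
  set l : ℕ → ℝ := fun j => avg (j / G) + d * (((j % G : ℕ) : ℝ) - (G - 1) / 2) with hl
  have hlg : ∀ g s, s < G → l (G * g + s) = avg g + d * ((s : ℝ) - (G - 1) / 2) := by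
    intro g s hs
    have h1 : (G * g + s) / G = g := by
      rw [Nat.mul_add_div hGpos, Nat.div_eq_of_lt hs, add_zero]
    have h2 : (G * g + s) % G = s := by rw [Nat.mul_add_mod, Nat.mod_eq_of_lt hs]
    simp only [hl, h1, h2]
  have hupj : ∀ i j : ℕ, m (i + j) ≤ m i + A * j := by
    intro i j
    induction j with
    | zero => simp
    | succ j ih =>
      have := hup (i + j)
      push_cast
      rw [← add_assoc]
      linarith
  have hclose : ∀ g s s', s < G → s' < G → |m (G * g + s) - m (G * g + s')| ≤ A * G + K := by
    have aux : ∀ g s s', s < G → s' < G → s ≤ s' →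
        |m (G * g + s) - m (G * g + s')| ≤ A * G + K := by
      intro g s s' _ h2 h3
      obtain ⟨j, rfl⟩ := Nat.exists_eq_add_of_le h3
      have hj : (j : ℝ) ≤ G := by exact_mod_cast (by omega : j ≤ G)
      have e1 := hlow (G * g + s) j
      have e2 := hupj (G * g + s) j
      rw [add_assoc] at e1 e2
      rw [abs_le]
      have : A * j ≤ A * G := by gcongr
      have : 0 ≤ 2 * d * j := by positivity
      have : 0 ≤ A * G := by positivity
      constructor <;> linarith
    intro g s s' h1 h2
    rcases le_total s s' with h | h
    · exact aux g s s' h1 h2 h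
    · rw [abs_sub_comm]; exact aux g s' s h2 h1 h
  have hB0 : ∀ g s, s < G → |m (G * g + s) - l (G * g + s)| ≤ A * G + K + d * G := by
    intro g s hs
    rw [hlg g s hs]
    have h1 : |m (G * g + s) - avg g| ≤ A * G + K := by
      have : m (G * g + s) - avg g =
          (∑ s' ∈ Finset.range G, (m (G * g + s) - m (G * g + s'))) / G := by
        rw [Finset.sum_sub_distrib, Finset.sum_const, Finset.card_range, nsmul_eq_mul, havg]
        field_simp
      rw [this, abs_div, abs_of_pos (by positivity : (0 : ℝ) < G), div_le_iff₀ (by positivity)]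
      refine (Finset.abs_sum_le_sum_abs _ _).trans ?_
      refine (Finset.sum_le_card_nsmul _ _ (A * G + K) fun s' hs' =>
        hclose g s s' hs (Finset.mem_range.1 hs')).trans ?_
      rw [Finset.card_range, nsmul_eq_mul, mul_comm]
    have h2 : |d * ((s : ℝ) - (G - 1) / 2)| ≤ d * G := by
      rw [abs_mul, abs_of_pos hd]
      gcongr
      have : (s : ℝ) ≤ G := by exact_mod_cast hs.le
      have : (0 : ℝ) ≤ s := by positivity
      rw [abs_le]
      constructor <;> linarith
    calc |m (G * g + s) - (avg g + d * ((s : ℝ) - (G - 1) / 2))|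
        = |(m (G * g + s) - avg g) - d * ((s : ℝ) - (G - 1) / 2)| := by ring_nf
      _ ≤ _ := (abs_sub _ _).trans (add_le_add h1 h2)
  have hsum0 : ∀ g, ∑ j ∈ Finset.range (G * g), (m j - l j) = 0 := by
    intro g
    induction g with
    | zero => simp
    | succ g ih =>
      rw [Nat.mul_succ, Finset.sum_range_add, ih, zero_add]
      have : ∀ s ∈ Finset.range G, m (G * g + s) - l (G * g + s) =
          m (G * g + s) - (avg g + d * ((s : ℝ) - (G - 1) / 2)) := fun s hs => by
        rw [hlg g s (Finset.mem_range.1 hs)]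
      rw [Finset.sum_congr rfl this, Finset.sum_sub_distrib, Finset.sum_add_distrib,
        Finset.sum_const, Finset.card_range, nsmul_eq_mul, ← Finset.mul_sum,
        Finset.sum_sub_distrib, Finset.sum_const, Finset.card_range, nsmul_eq_mul]
      have hgauss : ∑ s ∈ Finset.range G, (s : ℝ) = G * (G - 1) / 2 := by
        have := Finset.sum_range_id_mul_two G
        have h2 : ((∑ s ∈ Finset.range G, s : ℕ) : ℝ) * 2 = G * (G - 1) := by
          rw [← Nat.cast_ofNat, ← Nat.cast_mul, this, Nat.cast_mul, Nat.cast_sub hGpos]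
          simp
        push_cast at h2
        linarith
      rw [hgauss, havg]
      field_simp
      ring
  set B₀ := A * G + K + d * G with hB₀
  have hB₀0 : 0 ≤ B₀ := by positivity
  have hdm : ∀ j, G * (j / G) + j % G = j := fun j => Nat.div_add_mod j G
  have hml : ∀ j, |m j - l j| ≤ B₀ := fun j => by
    have := hB0 (j / G) (j % G) (Nat.mod_lt _ hGpos)
    rwa [hdm] at this
  refine ⟨l, G * B₀, by positivity, fun j => (hml j).trans ?_, fun j => ?_, fun n => ?_⟩
  · nlinarith
  · have hj := hdm j
    have hjm := Nat.mod_lt j hGpos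
    by_cases hlast : j % G + 1 < G
    · have h1 : l (j + 1) = avg (j / G) + d * (((j % G + 1 : ℕ) : ℝ) - (G - 1) / 2) := by
        rw [← hlg _ _ hlast, ← add_assoc, hj]
      rw [h1]
      simp only [hl]
      push_cast
      linarith
    · have hjG : j % G + 1 = G := by omega
      have h1 : l (j + 1) = avg (j / G + 1) + d * (((0 : ℕ) : ℝ) - (G - 1) / 2) := by
        rw [← hlg _ _ hGpos, Nat.mul_succ, add_zero]
        congr 1
        omega
      have h2 : ((j % G : ℕ) : ℝ) = G - 1 := by
        have : ((j % G + 1 : ℕ) : ℝ) = G := by rw [hjG]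
        push_cast at this
        linarith
      have h3 : avg (j / G) + (2 * d * G - K) ≤ avg (j / G + 1) := by
        rw [havg]
        simp only
        rw [← sub_nonneg, ← sub_sub, ← sub_div, ← Finset.sum_sub_distrib, sub_nonneg,
          le_div_iff₀ (by positivity)]
        have := Finset.card_nsmul_le_sum (Finset.range G)
          (fun s => m (G * (j / G + 1) + s) - m (G * (j / G) + s)) (2 * d * G - K)
          (fun s _ => by
            have := hlow (G * (j / G) + s) G
            rw [show G * (j / G) + s + G = G * (j / G + 1) + s by ring] at this
            linarith)
        rw [Finset.card_range, nsmul_eq_mul] at this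
        linarith
      rw [h1]
      simp only [hl]
      rw [h2]
      push_cast
      nlinarith
  · rw [← hdm n, Finset.sum_range_add, hsum0, zero_add]
    refine (Finset.abs_sum_le_sum_abs _ _).trans ?_
    refine (Finset.sum_le_card_nsmul _ _ B₀ fun s _ => hml _).trans ?_
    rw [Finset.card_range, nsmul_eq_mul]
    gcongr
    exact (Nat.mod_lt _ hGpos).le

/-- A geometrically growing sequence `z` with bounded ratios can be replaced by a separated
sequence `W`, so that the partial products of `z / W` stay bounded above and below. -/
theorem GeometricGrowth.exists_separated {z : ℕ → ℝ} (hz : GeometricGrowth z) {Q : ℝ}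
    (hQ : ∀ k, z (k + 1) ≤ Q * z k) :
    ∃ (W : ℕ → ℝ) (C ρ : ℝ), 0 < C ∧ 0 < ρ ∧ (∀ k, z k ≤ C * W k) ∧ (∀ k, W k ≤ C * z k) ∧
      (∀ i j, i ≠ j → ρ * max (W i) (W j) ≤ |W i - W j|) ∧
      ∀ n, |∑ j ∈ Finset.range n, Real.log (z j / W j)| ≤ C := by
  obtain ⟨hpos, c, γ, hc, hγ, h⟩ := hz
  have hQ0 : 0 < Q := pos_of_mul_pos_left ((hpos 1).trans_le (hQ 0)) (hpos 0).le
  have hd : 0 < Real.log γ / 2 := half_pos (Real.log_pos hγ)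
  -- On the logarithmic scale, geometric growth is a drift log γ = 2d up to an error |log c|; half
  -- of it is kept as the spacing. The separated sequence is W = exp l.
  obtain ⟨l, B, hB, h1, h2, h3⟩ := exists_separated_of_almost_increasing
    (m := fun k => Real.log (z k)) (K := |Real.log c|) (A := |Real.log Q|) hd (abs_nonneg _)
    (abs_nonneg _) (fun i j => by
      have h4 := Real.log_le_log (by have := hpos i; positivity) (h i j)
      rw [Real.log_mul (by positivity) (hpos i).ne', Real.log_mul hc.ne' (by positivity),
        Real.log_pow] at h4
      have := neg_abs_le (Real.log c)
      linarith) (fun j => by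
      have h4 := Real.log_le_log (hpos _) (hQ j)
      rw [Real.log_mul hQ0.ne' (hpos j).ne'] at h4
      have := le_abs_self (Real.log Q)
      linarith)
  set d := Real.log γ / 2
  have hlmono : ∀ i j, i < j → l i + d ≤ l j := by
    intro i j hij
    induction j, hij using Nat.le_induction with
    | base => exact h2 i
    | succ j _ ih => linarith [h2 j]
  have hlog : ∀ j, Real.log (z j / Real.exp (l j)) = Real.log (z j) - l j := fun j => by
    rw [Real.log_div (hpos j).ne' (Real.exp_ne_zero _), Real.log_exp]
  have hsep : ∀ i j, i < j → (1 - Real.exp (-d)) * max (Real.exp (l i)) (Real.exp (l j)) ≤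
      |Real.exp (l i) - Real.exp (l j)| := by
    intro i j hij
    have h4 := hlmono i j hij
    have h5 : Real.exp (l i) ≤ Real.exp (l j) := Real.exp_le_exp.2 (by linarith)
    have h6 : Real.exp (l i) ≤ Real.exp (-d) * Real.exp (l j) := by
      rw [← Real.exp_add]
      exact Real.exp_le_exp.2 (by linarith)
    rw [max_eq_right h5, abs_sub_comm, abs_of_nonneg (by linarith)]
    linarith
  refine ⟨fun j => Real.exp (l j), Real.exp B, 1 - Real.exp (-d), Real.exp_pos _,
    by rw [sub_pos, Real.exp_lt_one_iff]; linarith, fun k => ?_, fun k => ?_, ?_, fun n => ?_⟩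
  · rw [← Real.exp_add, ← Real.log_le_iff_le_exp (hpos k)]
    have := (abs_le.1 (h1 k)).2
    linarith
  · rw [← Real.exp_log (hpos k), ← Real.exp_add, Real.exp_le_exp]
    have := (abs_le.1 (h1 k)).1
    linarith
  · intro i j hij
    rcases lt_or_gt_of_ne hij with h4 | h4
    · exact hsep i j h4
    · rw [max_comm, abs_sub_comm]; exact hsep j i h4
  · simp only [hlog]
    refine (h3 n).trans ?_
    linarith [Real.add_one_le_exp B]

/-- Pigeonhole: the number of z j in [R/2, 4R] is less than some G independent of R, since each of
them contributes at least 1/4 to the bounded sum of min(z j / R, R / z j). Of the G + 1 points R(1 +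
2ηi), with spacing 2ηR, at least one is therefore at distance ≥ ηR from the whole sequence. -/
theorem GeometricGrowth.exists_gap {z : ℕ → ℝ} (hz : GeometricGrowth z) :
    ∃ η : ℝ, 0 < η ∧ ∀ R : ℝ, 0 < R → ∃ u, R ≤ u ∧ u ≤ 2 * R ∧ ∀ j, η * R ≤ |u - z j| := by
  obtain ⟨C, hC, hsum⟩ := hz.sum_min_rpow_le zero_lt_one
  obtain ⟨G, hG⟩ := exists_nat_gt (4 * C)
  have hcard : ∀ R : ℝ, 0 < R → ∀ S : Finset ℕ, (∀ j ∈ S, R / 2 ≤ z j ∧ z j ≤ 4 * R) →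
      S.card < G := by
    intro R hR S hS
    have h1 := Finset.card_nsmul_le_sum S (fun k => (min (z k / R) (R / z k)) ^ (1 : ℝ)) (1 / 4)
      (fun j hj => by
        obtain ⟨h2, h3⟩ := hS j hj
        have := hz.1 j
        rw [Real.rpow_one, le_min_iff, le_div_iff₀ hR, le_div_iff₀ this]
        constructor <;> linarith)
    have h2 := h1.trans (hsum R hR S)
    rw [nsmul_eq_mul] at h2
    have : (S.card : ℝ) < G := by linarith
    exact_mod_cast this
  set η : ℝ := 1 / (2 * (G + 1)) with hη
  have hη0 : 0 < η := by positivity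
  have hη1 : η ≤ 1 / 2 := by
    rw [hη]
    apply one_div_le_one_div_of_le <;> linarith [(Nat.cast_nonneg G : (0 : ℝ) ≤ G)]
  refine ⟨η, hη0, fun R hR => ?_⟩
  by_contra! hcon
  have hp : ∀ i : Fin (G + 1), ∃ j, |R * (1 + 2 * η * i) - z j| < η * R := by
    intro i
    apply hcon
    · nlinarith [(by positivity : 0 ≤ R * (2 * η * i))]
    · have : (i : ℝ) ≤ G + 1 := by exact_mod_cast i.2.le
      have : 2 * η * i ≤ 1 := by
        rw [hη]
        rw [show 2 * (1 / (2 * ((G : ℝ) + 1))) * i = i / (G + 1) by field_simp]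
        exact (div_le_one (by positivity)).2 this
      nlinarith
  choose f hf using hp
  have hinj : Function.Injective f := by
    intro a b hab
    have h1 := hf a
    have h2 := hf b
    rw [← hab, abs_sub_comm] at h2
    have h3 : |R * (1 + 2 * η * a) - R * (1 + 2 * η * b)| < 2 * (η * R) := by
      calc _ = |(R * (1 + 2 * η * a) - z (f a)) + (z (f a) - R * (1 + 2 * η * b))| := by ring_nf
        _ ≤ _ := abs_add_le _ _
        _ < _ := by linarith
    rw [show R * (1 + 2 * η * a) - R * (1 + 2 * η * b) = (2 * (η * R)) * ((a : ℝ) - b) by ring,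
      abs_mul, abs_of_pos (by positivity : 0 < 2 * (η * R)),
      mul_lt_iff_lt_one_right (by positivity)] at h3
    have h4 : |((a : ℕ) : ℤ) - ((b : ℕ) : ℤ)| < 1 := by exact_mod_cast h3
    rw [Int.abs_lt_one_iff] at h4
    exact Fin.ext (by omega)
  have := hcard R hR (Finset.univ.image f) (by
    intro j hj
    obtain ⟨i, -, rfl⟩ := Finset.mem_image.1 hj
    have h1 := abs_lt.1 (hf i)
    have h2 : (i : ℝ) ≤ G + 1 := by exact_mod_cast i.2.le
    have h3 : 2 * η * i ≤ 1 := by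
      rw [hη]
      rw [show 2 * (1 / (2 * ((G : ℝ) + 1))) * i = i / (G + 1) by field_simp]
      exact (div_le_one (by positivity)).2 h2
    have h4 : 0 ≤ 2 * η * i := by positivity
    constructor <;> nlinarith)
  rw [Finset.card_image_of_injective _ hinj, Finset.card_univ, Fintype.card_fin] at this
  omega

theorem mul_max_le_abs_sub {u z δ : ℝ} (hδ : 0 < δ) (h : δ * u ≤ |u - z|) :
    δ / (1 + δ) * max u z ≤ |u - z| := by
  have h1 : max u z ≤ u + |u - z| := by
    rw [max_le_iff]
    constructor
    · linarith [abs_nonneg (u - z)]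
    · linarith [neg_abs_le (u - z)]
  rw [div_mul_eq_mul_div, div_le_iff₀ (by positivity)]
  nlinarith [mul_le_mul_of_nonneg_left h1 hδ.le]

theorem GeometricGrowth.exists_gap_points {z : ℕ → ℝ} (hz : GeometricGrowth z)
    (hmono : StrictMono z) :
    ∃ (u : ℕ → ℝ) (C η : ℝ), 0 < C ∧ 0 < η ∧ StrictMono u ∧ GeometricGrowth u ∧
      (∀ k, u (k + 1) ≤ C * u k) ∧ u 0 < z 0 ∧ z 0 < u 1 ∧ u 1 < z 1 ∧
      ∀ k j, η * max (u k) (z j) ≤ |u k - z j| := by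
  obtain ⟨η, hη, hgap⟩ := hz.exists_gap
  have h0 := hz.1 0
  have h1 := hz.1 1
  have h01 : z 0 < z 1 := hmono zero_lt_one
  choose! g hg1 hg2 hg3 using hgap
  have hR : ∀ k : ℕ, 0 < z 1 * 4 ^ k := fun k => by positivity
  -- The first two points are chosen by hand so that (u 0, u 1) contains z 0 and no other term; this
  -- will produce the factor t^{λ_0} in the tail bound. The others are gap points at the scales z 1
  -- * 4^k, whose intervals [R, 2R] are disjoint, so that u increases.
  set u : ℕ → ℝ := fun k => match k with
    | 0 => z 0 / 2
    | 1 => (z 0 + z 1) / 2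
    | k + 2 => g (z 1 * 4 ^ k)
  have hu2 : ∀ k, u (k + 2) = g (z 1 * 4 ^ k) := fun k => rfl
  have hu0 : u 0 = z 0 / 2 := rfl
  have hu1 : u 1 = (z 0 + z 1) / 2 := rfl
  have hupper : ∀ k, u k ≤ 2 * z 1 * 4 ^ k := by
    intro k
    match k with
    | 0 => rw [hu0]; linarith
    | 1 => rw [hu1]; linarith
    | k + 2 =>
      rw [hu2]
      refine (hg2 _ (hR k)).trans ?_
      rw [← mul_assoc]
      gcongr
      · norm_num
      · omega
  have hlower : ∀ k, z 0 / 16 * 4 ^ k ≤ u k := by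
    intro k
    match k with
    | 0 => rw [hu0]; linarith
    | 1 => rw [hu1]; linarith
    | k + 2 =>
      rw [hu2]
      refine le_trans ?_ (hg1 _ (hR k))
      rw [pow_add]
      have : (0 : ℝ) < 4 ^ k := by positivity
      nlinarith
  have hupos : ∀ k, 0 < u k := fun k => lt_of_lt_of_le (by positivity) (hlower k)
  have hdist : ∀ k j, min (min 1 (η / 2)) ((z 1 - z 0) / (z 0 + z 1)) * u k ≤ |u k - z j| := by
    intro k j
    have hjz : z 0 ≤ z j := hmono.monotone (Nat.zero_le j)
    match k with
    | 0 =>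
      calc _ ≤ 1 * u 0 := by
            exact mul_le_mul_of_nonneg_right ((min_le_left _ _).trans (min_le_left _ _))
              (hupos 0).le
        _ ≤ _ := by rw [hu0, abs_sub_comm, abs_of_nonneg] <;> linarith
    | 1 =>
      calc _ ≤ (z 1 - z 0) / (z 0 + z 1) * u 1 := by
            exact mul_le_mul_of_nonneg_right (min_le_right _ _) (hupos 1).le
        _ = (z 1 - z 0) / 2 := by rw [hu1]; field_simp
        _ ≤ _ := by
          rw [hu1]
          rcases Nat.eq_zero_or_pos j with rfl | hj
          · rw [abs_of_nonneg] <;> linarith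
          · have : z 1 ≤ z j := hmono.monotone hj
            rw [abs_sub_comm, abs_of_nonneg] <;> linarith
    | k + 2 =>
      calc _ ≤ η / 2 * u (k + 2) := by
            exact mul_le_mul_of_nonneg_right ((min_le_left _ _).trans (min_le_right _ _))
              (hupos (k + 2)).le
        _ ≤ η * (z 1 * 4 ^ k) := by
            rw [hu2]
            nlinarith [hg2 _ (hR k)]
        _ ≤ _ := hg3 _ (hR k) j
  set δ := min (min 1 (η / 2)) ((z 1 - z 0) / (z 0 + z 1)) with hδ
  have hδ0 : 0 < δ := by
    have : 0 < z 1 - z 0 := by linarith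
    positivity
  have h4 : GeometricGrowth fun k : ℕ => (4 : ℝ) ^ k :=
    ⟨fun k => by positivity, 1, 4, one_pos, by norm_num, fun i j => by simp only [pow_add]; linarith⟩
  refine ⟨u, 128 * z 1 / z 0, δ / (1 + δ), by positivity, by positivity, ?_,
    h4.of_comparable (C := max (2 * z 1) (16 / z 0)) (by positivity) (fun k => ?_) (fun k => ?_),
    fun k => ?_, by rw [hu0]; linarith, by rw [hu1]; linarith, by rw [hu1]; linarith, fun k j =>
    mul_max_le_abs_sub hδ0 (hdist k j)⟩
  · refine strictMono_nat_of_lt_succ fun k => ?_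
    match k with
    | 0 => rw [hu0, hu1]; linarith
    | 1 =>
      have h5 : z 1 ≤ u (1 + 1) := by
        calc z 1 = z 1 * 4 ^ 0 := by rw [pow_zero, mul_one]
          _ ≤ g (z 1 * 4 ^ 0) := hg1 _ (hR 0)
          _ = u (1 + 1) := rfl
      rw [hu1]
      linarith
    | k + 2 =>
      rw [hu2, show k + 2 + 1 = (k + 1) + 2 by ring, hu2]
      refine lt_of_le_of_lt (hg2 _ (hR k)) (lt_of_lt_of_le ?_ (hg1 _ (hR (k + 1))))
      rw [pow_succ]
      have := hR k
      linarith
  · calc (4 : ℝ) ^ k = 16 / z 0 * (z 0 / 16 * 4 ^ k) := by field_simp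
      _ ≤ max (2 * z 1) (16 / z 0) * u k := by
        gcongr
        · exact le_max_right _ _
        · exact hlower k
  · refine (hupper k).trans ?_
    gcongr
    exact le_max_left _ _
  · refine (hupper _).trans ?_
    calc 2 * z 1 * 4 ^ (k + 1) = 128 * z 1 / z 0 * (z 0 / 16 * 4 ^ k) := by
          rw [pow_succ]; field_simp; ring
      _ ≤ _ := by gcongr; exact hlower k

/-! ### Uniform bounds for the interpolation coefficients -/

/-- For cx ≤ 1/2, X/V ≤ 1/(1 - cx) ≤ exp(2cx). For cx ≥ 1/2 the crude bound 1/δ suffices, as 2cx ≥ 1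
absorbs log(1/δ). -/
theorem div_le_exp_of_one_sub_mul_le {X V x c δ : ℝ} (hV : 0 < V) (hX : 0 < X)
    (hx : 0 ≤ x) (hc : 0 < c) (hδ : 0 < δ) (h1 : δ * X ≤ V) (h2 : (1 - c * x) * X ≤ V) :
    X / V ≤ Real.exp (2 * c * (1 + |Real.log δ|) * x) := by
  rw [div_le_iff₀ hV]
  rcases le_total (c * x) (1 / 2) with h | h
  · have h3 : 1 ≤ Real.exp (2 * (c * x)) * (1 - c * x) := by
      have := Real.add_one_le_exp (2 * (c * x))
      have h4 : 0 ≤ c * x := by positivity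
      nlinarith
    calc X = 1 * X := (one_mul X).symm
      _ ≤ Real.exp (2 * (c * x)) * (1 - c * x) * X := by gcongr
      _ = Real.exp (2 * (c * x)) * ((1 - c * x) * X) := by ring
      _ ≤ Real.exp (2 * c * (1 + |Real.log δ|) * x) * V := by
        refine mul_le_mul (Real.exp_le_exp.2 ?_) h2 (mul_nonneg (by linarith) hX.le)
          (Real.exp_pos _).le
        nlinarith [mul_nonneg (mul_nonneg hc.le hx) (abs_nonneg (Real.log δ))]
  · have h3 : 1 ≤ Real.exp (2 * c * (1 + |Real.log δ|) * x) * δ := by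
      nth_rewrite 2 [← Real.exp_log hδ]
      rw [← Real.exp_add, Real.one_le_exp_iff]
      have := neg_abs_le (Real.log δ)
      nlinarith [abs_nonneg (Real.log δ)]
    calc X = 1 * X := (one_mul X).symm
      _ ≤ Real.exp (2 * c * (1 + |Real.log δ|) * x) * δ * X := by gcongr
      _ = Real.exp (2 * c * (1 + |Real.log δ|) * x) * (δ * X) := by ring
      _ ≤ _ := by gcongr

theorem one_add_div_le_exp {X Y x c : ℝ} (hX : 0 < X) (h : Y ≤ c * x * X) :
    (Y + X) / X ≤ Real.exp (c * x) := by
  rw [div_le_iff₀ hX]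
  nlinarith [Real.add_one_le_exp (c * x)]

section

variable {z W C a b ρ η : ℝ}

/-- The quotient is close to 1 when z ≪ a and close to z/W when z ≫ a. The deviation is governed by
min(z/a, a/z), which is summable along the sequence; log(z/W) is not, so it is kept apart, to be
handled through its bounded partial sums. -/
theorem add_div_abs_sub_le_exp (hz : 0 < z) (hW : 0 < W) (ha : 0 < a) (hC : 0 < C)
    (h1 : z ≤ C * W) (h2 : W ≤ C * z) (hρ : 0 < ρ) (hsep : ρ * max W a ≤ |W - a|) :
    (a + z) / |W - a| ≤ Real.exp ((1 + 2 * C * (1 + |Real.log ρ|)) * min (z / a) (a / z) +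
      if a ≤ z then Real.log (z / W) else 0) := by
  have hV : 0 < |W - a| := lt_of_lt_of_le (by positivity) hsep
  split_ifs with h
  · have hmin : min (z / a) (a / z) = a / z :=
      min_eq_right (((div_le_one hz).2 h).trans ((one_le_div ha).2 h))
    rw [hmin]
    have e1 := one_add_div_le_exp (X := z) (Y := a) (x := a / z) (c := 1) hz
      (by rw [one_mul, div_mul_cancel₀ _ hz.ne'])
    have e2 := div_le_exp_of_one_sub_mul_le (X := W) (x := a / z) hV hW (by positivity) hC hρ
      (le_trans (by gcongr; exact le_max_left _ _) hsep) (by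
        have : a ≤ C * (a / z) * W := by
          rw [mul_div_assoc', div_mul_eq_mul_div, le_div_iff₀ hz]
          nlinarith
        nlinarith [le_abs_self (W - a)])
    calc (a + z) / |W - a| = (a + z) / z * (W / |W - a|) * (z / W) := by field_simp
      _ ≤ Real.exp (1 * (a / z)) * Real.exp (2 * C * (1 + |Real.log ρ|) * (a / z)) *
          Real.exp (Real.log (z / W)) := by
          rw [Real.exp_log (by positivity)]
          gcongr
      _ = _ := by rw [← Real.exp_add, ← Real.exp_add]; ring_nf
  · have h := not_le.1 h
    have hmin : min (z / a) (a / z) = z / a :=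
      min_eq_left (((div_le_one ha).2 h.le).trans ((one_le_div hz).2 h.le))
    rw [hmin]
    have e1 := one_add_div_le_exp (X := a) (Y := z) (x := z / a) (c := 1) ha
      (by rw [one_mul, div_mul_cancel₀ _ ha.ne'])
    have e2 := div_le_exp_of_one_sub_mul_le (X := a) (x := z / a) hV ha (by positivity) hC hρ
      (le_trans (by gcongr; exact le_max_right _ _) hsep) (by
        have : C * (z / a) * a = C * z := by field_simp
        nlinarith [neg_abs_le (W - a)])
    calc (a + z) / |W - a| = (z + a) / a * (a / |W - a|) := by
          rw [add_comm a z]; field_simp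
      _ ≤ Real.exp (1 * (z / a)) * Real.exp (2 * C * (1 + |Real.log ρ|) * (z / a)) := by gcongr
      _ = _ := by rw [← Real.exp_add]; ring_nf

/-- Companion of `add_div_abs_sub_le_exp` for the variable point, where log(z/W) enters with the
opposite sign. -/
theorem add_div_le_exp {v : ℝ} (hz : 0 < z) (hW : 0 < W) (hb : 0 < b)
    (h1 : z ≤ C * W) (h2 : W ≤ C * z) (hη : 0 < η) (hv : η * max b z ≤ v) (hbz : |b - z| ≤ v) :
    (b + W) / v ≤ Real.exp ((C + 2 * (1 + |Real.log η|)) * min (z / b) (b / z) -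
      if b ≤ z then Real.log (z / W) else 0) := by
  have hV : 0 < v := lt_of_lt_of_le (by positivity) hv
  split_ifs with h
  · have hmin : min (z / b) (b / z) = b / z :=
      min_eq_right (((div_le_one hz).2 h).trans ((one_le_div hb).2 h))
    rw [hmin]
    have e1 := one_add_div_le_exp (X := W) (Y := b) (x := b / z) (c := C) hW
      (by rw [mul_div_assoc', div_mul_eq_mul_div, le_div_iff₀ hz]; nlinarith)
    have e2 := div_le_exp_of_one_sub_mul_le (X := z) (x := b / z) hV hz (by positivity) one_pos hη
      (le_trans (by gcongr; exact le_max_right _ _) hv) (by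
        have : 1 * (b / z) * z = b := by field_simp
        nlinarith [neg_abs_le (b - z)])
    calc (b + W) / v = (b + W) / W * (z / v) * (W / z) := by field_simp
      _ ≤ Real.exp (C * (b / z)) * Real.exp (2 * 1 * (1 + |Real.log η|) * (b / z)) *
          Real.exp (-Real.log (z / W)) := by
          rw [← Real.log_inv, inv_div, Real.exp_log (by positivity)]
          gcongr
      _ = _ := by rw [← Real.exp_add, ← Real.exp_add]; ring_nf
  · have h := not_le.1 h
    have hmin : min (z / b) (b / z) = z / b :=
      min_eq_left (((div_le_one hb).2 h.le).trans ((one_le_div hz).2 h.le))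
    rw [hmin]
    have e1 := one_add_div_le_exp (X := b) (Y := W) (x := z / b) (c := C) hb
      (by rw [mul_assoc, div_mul_cancel₀ _ hb.ne']; exact h2)
    have e2 := div_le_exp_of_one_sub_mul_le (X := b) (x := z / b) hV hb (by positivity) one_pos hη
      (le_trans (by gcongr; exact le_max_left _ _) hv) (by
        have : 1 * (z / b) * b = z := by field_simp
        nlinarith [le_abs_self (b - z)])
    calc (b + W) / v = (W + b) / b * (b / v) := by
          rw [add_comm b W]; field_simp
      _ ≤ Real.exp (C * (z / b)) * Real.exp (2 * 1 * (1 + |Real.log η|) * (z / b)) := by gcongr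
      _ = _ := by rw [← Real.exp_add, sub_zero]; ring_nf

end

/-- By monotonicity the condition selects a final segment of indices, so the sum is zero or a
difference of two partial sums. -/
theorem abs_sum_ite_le_of_partial_sums {z l : ℕ → ℝ} {B : ℝ} (hmono : Monotone z)
    (hB : ∀ n, |∑ j ∈ Finset.range n, l j| ≤ B) (a : ℝ) (n : ℕ) :
    |∑ j ∈ Finset.range n, if a ≤ z j then l j else 0| ≤ 2 * B := by
  have hB0 : 0 ≤ B := by simpa using hB 0
  induction n with
  | zero => simpa using hB0
  | succ n ih =>
    by_cases h : a ≤ z 0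
    · have : ∀ j ∈ Finset.range (n + 1), (if a ≤ z j then l j else 0) = l j := fun j _ =>
        if_pos (h.trans (hmono (Nat.zero_le j)))
      rw [Finset.sum_congr rfl this]
      linarith [hB (n + 1)]
    by_cases h' : a ≤ z n
    · classical
      have hex : ∃ k, a ≤ z k := ⟨n, h'⟩
      set N := Nat.find hex
      have hN : N ≤ n + 1 := (Nat.find_min' hex h').trans (Nat.le_succ n)
      have hiff : ∀ j, a ≤ z j ↔ ¬ j < N := fun j =>
        ⟨fun hj hlt => Nat.find_min hex hlt hj, fun hj =>
          (Nat.find_spec hex).trans (hmono (not_lt.1 hj))⟩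
      have hsplit : ∑ j ∈ Finset.range (n + 1), (if a ≤ z j then l j else 0) =
          ∑ j ∈ Finset.range (n + 1), l j - ∑ j ∈ Finset.range N, l j := by
        rw [← Finset.sum_range_add_sum_Ico _ hN, ← Finset.sum_range_add_sum_Ico l hN,
          add_sub_cancel_left]
        rw [Finset.sum_eq_zero, zero_add]
        · refine Finset.sum_congr rfl fun j hj => if_pos ((hiff j).2 ?_)
          exact not_lt.2 (Finset.mem_Ico.1 hj).1
        · intro j hj
          exact if_neg fun h2 => (hiff j).1 h2 (Finset.mem_range.1 hj)
      rw [hsplit]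
      refine (abs_sub _ _).trans ?_
      linarith [hB (n + 1), hB N]
    · rw [Finset.sum_range_succ, if_neg h', add_zero]
      exact ih

/-- The coefficient of the value at `-W i` in the interpolation formula for rational functions with
simple poles at `z 0, …, z (n - 1)` that vanish at infinity. -/
noncomputable def interpolationFactor (z W : ℕ → ℝ) (n i : ℕ) (w : ℂ) : ℂ :=
  (∏ j ∈ Finset.range n, (-(W i : ℂ) - z j) / (w - z j)) *
    ∏ j ∈ (Finset.range n).erase i, (w + W j) / ((W j : ℂ) - W i)

/-- Pair the factors with the same j. For j ≠ i the pair is (W i + z j)/|W j - W i| · |w + W j|/|w -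
z j|. Its logarithm is at most a constant times min(z j / W i, W i / z j) + min(z j / ‖w‖, ‖w‖ / z
j), summable uniformly in W i and ‖w‖, plus log(z j / W j) terms that the balancing of W controls.
The unpaired factor (W i + z i)/|w - z i| supplies the decay W i / max ‖w‖ (W i). -/
theorem norm_interpolationFactor_le {z W : ℕ → ℝ} {C ρ η : ℝ} (hz : GeometricGrowth z)
    (hmono : Monotone z) (hC : 0 < C) (hρ : 0 < ρ) (hη : 0 < η) (h1 : ∀ k, z k ≤ C * W k)
    (h2 : ∀ k, W k ≤ C * z k) (hsep : ∀ i j, i ≠ j → ρ * max (W i) (W j) ≤ |W i - W j|)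
    (hlog : ∀ n, |∑ j ∈ Finset.range n, Real.log (z j / W j)| ≤ C) :
    ∃ K : ℝ, 0 < K ∧ ∀ (n i : ℕ) (w : ℂ), i < n → w ≠ 0 →
      (∀ j, η * max ‖w‖ (z j) ≤ ‖w - z j‖) →
      ‖interpolationFactor z W n i w‖ ≤ K * (W i / max ‖w‖ (W i)) := by
  obtain ⟨C₁, hC₁, hsum⟩ := hz.sum_min_rpow_le zero_lt_one
  simp only [Real.rpow_one] at hsum
  have hW : ∀ k, 0 < W k := fun k => pos_of_mul_pos_right ((hz.1 k).trans_le (h1 k)) hC.le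
  set K₁ := 1 + 2 * C * (1 + |Real.log ρ|)
  set K₂ := C + 2 * (1 + |Real.log η|)
  have hK₁ : 0 ≤ K₁ := by positivity
  have hK₂ : 0 ≤ K₂ := by positivity
  refine ⟨(1 + C) * ((1 + C) / η) * Real.exp (K₁ * C₁ + K₂ * C₁ + 8 * C), by positivity,
    fun n i w hi hw hdist => ?_⟩
  have hb : 0 < ‖w‖ := norm_pos_iff.2 hw
  have ha : 0 < W i := hW i
  have hnorm : ‖interpolationFactor z W n i w‖ = (W i + z i) / ‖w - z i‖ *
      ∏ j ∈ (Finset.range n).erase i,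
        ((W i + z j) / |W j - W i| * (‖w + W j‖ / ‖w - z j‖)) := by
    rw [interpolationFactor, ← Finset.mul_prod_erase _ _ (Finset.mem_range.2 hi), mul_assoc,
      ← Finset.prod_mul_distrib, norm_mul, norm_prod]
    have hnz : ∀ j, ‖-(W i : ℂ) - z j‖ = W i + z j := fun j => by
      rw [← neg_add', norm_neg, ← Complex.ofReal_add, Complex.norm_real, Real.norm_eq_abs,
        abs_of_pos (add_pos ha (hz.1 j))]
    congr 1
    · rw [norm_div, hnz]
    · refine Finset.prod_congr rfl fun j _ => ?_
      rw [norm_mul, norm_div, norm_div, hnz, ← Complex.ofReal_sub, Complex.norm_real,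
        Real.norm_eq_abs]
      ring
  have hfirst : (W i + z i) / ‖w - z i‖ ≤ (1 + C) * ((1 + C) / η) * (W i / max ‖w‖ (W i)) := by
    have hm : max ‖w‖ (W i) ≤ (1 + C) * max ‖w‖ (z i) := by
      rw [max_le_iff]
      constructor
      · nlinarith [le_max_left ‖w‖ (z i)]
      · nlinarith [le_max_right ‖w‖ (z i), h2 i, hz.1 i]
    have hpos : 0 < ‖w - z i‖ := lt_of_lt_of_le (by positivity) (hdist i)
    rw [div_le_iff₀ hpos]
    calc W i + z i ≤ (1 + C) * W i := by linarith [h1 i]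
      _ = (1 + C) * ((1 + C) / η) * (W i / max ‖w‖ (W i)) *
          (η / (1 + C) * max ‖w‖ (W i)) := by
          have : max ‖w‖ (W i) ≠ 0 := by positivity
          field_simp
      _ ≤ _ := by
          gcongr
          refine le_trans ?_ (hdist i)
          rw [div_mul_eq_mul_div, div_le_iff₀ (by positivity)]
          nlinarith
  set E : ℕ → ℝ := fun j => (K₁ * min (z j / W i) (W i / z j) +
      if W i ≤ z j then Real.log (z j / W j) else 0) + (K₂ * min (z j / ‖w‖) (‖w‖ / z j) -
      if ‖w‖ ≤ z j then Real.log (z j / W j) else 0) with hE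
  have hprod : ∏ j ∈ (Finset.range n).erase i,
      ((W i + z j) / |W j - W i| * (‖w + W j‖ / ‖w - z j‖)) ≤
      ∏ j ∈ (Finset.range n).erase i, Real.exp (E j) := by
    refine Finset.prod_le_prod (fun j _ => ?_) fun j hj => ?_
    · have := hz.1 j
      positivity
    · have hij : j ≠ i := Finset.ne_of_mem_erase hj
      have e1 := add_div_abs_sub_le_exp (hz.1 j) (hW j) ha hC (h1 j) (h2 j) hρ (hsep j i hij)
      have e2 := add_div_le_exp (v := ‖w - z j‖) (hz.1 j) (hW j) hb (h1 j) (h2 j) hη (hdist j) (by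
        have := abs_norm_sub_norm_le w (z j : ℂ)
        rwa [Complex.norm_real, Real.norm_of_nonneg (hz.1 j).le] at this)
      have e3 : ‖w + W j‖ / ‖w - z j‖ ≤ (‖w‖ + W j) / ‖w - z j‖ := by
        gcongr
        refine (norm_add_le _ _).trans ?_
        rw [Complex.norm_real, Real.norm_of_nonneg (hW j).le]
      rw [hE, Real.exp_add]
      have := hz.1 j
      exact mul_le_mul e1 (e3.trans e2) (by positivity) (Real.exp_pos _).le
  have hEsum : ∑ j ∈ (Finset.range n).erase i, E j ≤ K₁ * C₁ + K₂ * C₁ + 8 * C := by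
    have hfull : ∑ j ∈ Finset.range n, ((if W i ≤ z j then Real.log (z j / W j) else 0) -
        if ‖w‖ ≤ z j then Real.log (z j / W j) else 0) ≤ 4 * C := by
      rw [Finset.sum_sub_distrib]
      have e1 := abs_le.1 (abs_sum_ite_le_of_partial_sums hmono hlog (W i) n)
      have e2 := abs_le.1 (abs_sum_ite_le_of_partial_sums hmono hlog ‖w‖ n)
      linarith [e1.2, e2.1]
    -- A single logarithm is a difference of two partial sums. Leaving out j = i costs at most 4C on
    -- top of the 4C for the complete sum, which gives the 8C.
    have hone : |Real.log (z i / W i)| ≤ 2 * C := by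
      have e1 := abs_le.1 (hlog (i + 1))
      have e2 := abs_le.1 (hlog i)
      rw [Finset.sum_range_succ] at e1
      rw [abs_le]
      constructor <;> linarith [e1.1, e1.2, e2.1, e2.2]
    rw [← Finset.add_sum_erase _ _ (Finset.mem_range.2 hi)] at hfull
    have e3 := abs_le.1 hone
    have hi2 : -(4 * C) ≤ (if W i ≤ z i then Real.log (z i / W i) else 0) -
        if ‖w‖ ≤ z i then Real.log (z i / W i) else 0 := by
      split_ifs <;> linarith [e3.1, e3.2]
    have hsplit : ∑ j ∈ (Finset.range n).erase i, E j =
        K₁ * ∑ j ∈ (Finset.range n).erase i, min (z j / W i) (W i / z j) +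
        K₂ * ∑ j ∈ (Finset.range n).erase i, min (z j / ‖w‖) (‖w‖ / z j) +
        ∑ j ∈ (Finset.range n).erase i, ((if W i ≤ z j then Real.log (z j / W j) else 0) -
        if ‖w‖ ≤ z j then Real.log (z j / W j) else 0) := by
      rw [Finset.mul_sum, Finset.mul_sum, ← Finset.sum_add_distrib, ← Finset.sum_add_distrib]
      refine Finset.sum_congr rfl fun j _ => ?_
      rw [hE]
      ring
    rw [hsplit]
    have e4 := mul_le_mul_of_nonneg_left (hsum (W i) ha ((Finset.range n).erase i)) hK₁
    have e5 := mul_le_mul_of_nonneg_left (hsum ‖w‖ hb ((Finset.range n).erase i)) hK₂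
    linarith
  rw [hnorm]
  calc _ ≤ (1 + C) * ((1 + C) / η) * (W i / max ‖w‖ (W i)) *
        Real.exp (K₁ * C₁ + K₂ * C₁ + 8 * C) := by
        refine mul_le_mul hfirst (hprod.trans ?_) (Finset.prod_nonneg fun j _ => ?_) ?_
        · rw [← Real.exp_sum]
          exact Real.exp_le_exp.2 hEsum
        · have := hz.1 j
          positivity
        · positivity
    _ = _ := by ring

/-! ### Rational interpolation and contour integrals -/

open Polynomial in
-- Multiplied by ∏ (w - z j), the left side becomes a polynomial of degree less than n, hence equals
-- its Lagrange interpolant at the n distinct nodes -W i.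
theorem sum_div_sub_eq_sum_interpolationFactor {z W : ℕ → ℝ} (hz : ∀ k, 0 < z k)
    (hW : ∀ k, 0 < W k) (hinj : Function.Injective W) (b : ℕ → ℂ) (n : ℕ) {w : ℂ}
    (hw : ∀ j, w ≠ z j) :
    ∑ j ∈ Finset.range n, b j / (w - z j) =
      ∑ i ∈ Finset.range n, (∑ j ∈ Finset.range n, b j / (-(W i : ℂ) - z j)) *
        interpolationFactor z W n i w := by
  classical
  set P : ℂ[X] := ∑ j ∈ Finset.range n, C (b j) * ∏ l ∈ (Finset.range n).erase j, (X - C (z l : ℂ))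
    with hP
  have hdeg : P.degree < (Finset.range n).card := by
    rw [hP, Finset.card_range]
    refine mem_degreeLT.1 (Submodule.sum_mem _ fun j hj => ?_)
    rw [← smul_eq_C_mul]
    refine Submodule.smul_mem _ _ (mem_degreeLT.2 ?_)
    rw [degree_prod_of_monic _ _ fun l _ => monic_X_sub_C _]
    simp only [degree_X_sub_C, Finset.sum_const, Finset.card_erase_of_mem hj, Finset.card_range,
      nsmul_eq_mul, mul_one]
    have : 0 < n := (Nat.zero_le j).trans_lt (Finset.mem_range.1 hj)
    exact_mod_cast Nat.sub_lt this one_pos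
  have heval : ∀ x : ℂ, (∀ j, x ≠ z j) → P.eval x =
      (∏ j ∈ Finset.range n, (x - z j)) * ∑ j ∈ Finset.range n, b j / (x - z j) := by
    intro x hx
    rw [hP, eval_finsetSum, Finset.mul_sum]
    refine Finset.sum_congr rfl fun j hj => ?_
    rw [eval_mul, eval_C, eval_prod, ← Finset.mul_prod_erase _ _ hj]
    simp only [eval_sub, eval_X, eval_C]
    have := sub_ne_zero.2 (hx j)
    field_simp
  have hneg : ∀ i j, -(W i : ℂ) ≠ z j := by
    intro i j h
    have h1 : -(W i) = z j := by exact_mod_cast h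
    linarith [hW i, hz j]
  have hvinj : Set.InjOn (fun i => -(W i : ℂ)) (Finset.range n : Set ℕ) := by
    intro i _ j _ h
    simp only [neg_inj, Complex.ofReal_inj] at h
    exact hinj h
  have hint := congrArg (eval w) (Lagrange.eq_interpolate (f := P) hvinj hdeg)
  rw [heval w hw, Lagrange.interpolate_apply, eval_finsetSum] at hint
  have hne : ∏ j ∈ Finset.range n, (w - z j) ≠ 0 :=
    Finset.prod_ne_zero_iff.2 fun j _ => sub_ne_zero.2 (hw j)
  rw [← mul_right_inj' hne, hint, Finset.mul_sum]
  refine Finset.sum_congr rfl fun i _ => ?_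
  rw [eval_mul, eval_C, heval _ (hneg i), Lagrange.basis, eval_prod, interpolationFactor,
    Finset.prod_div_distrib]
  have : ∀ j ∈ (Finset.range n).erase i, eval w (Lagrange.basisDivisor (-(W i : ℂ)) (-(W j : ℂ))) =
      (w + W j) / ((W j : ℂ) - W i) := by
    intro j _
    rw [Lagrange.basisDivisor, eval_mul, eval_C, eval_sub, eval_X, eval_C, sub_neg_eq_add,
      sub_neg_eq_add, neg_add_eq_sub, div_eq_inv_mul]
  rw [Finset.prod_congr rfl this]
  field_simp

/-- Reverse triangle inequality: for a circle centred on the real axis, the point of the circle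
nearest to a real x is one of its two real points. The gap condition thus needs checking only at the
ends of a diameter. -/
theorem min_abs_sub_le_norm_sub {c r : ℝ} {w : ℂ} (hw : ‖w - c‖ = r) (x : ℝ) :
    min |c - r - x| |c + r - x| ≤ ‖w - x‖ := by
  have h1 : |r - (|x - c|)| ≤ ‖w - x‖ := by
    have := abs_norm_sub_norm_le (w - c) ((x : ℂ) - c)
    rwa [hw, ← Complex.ofReal_sub, Complex.norm_real, Real.norm_eq_abs, Complex.ofReal_sub,
      sub_sub_sub_cancel_right] at this
  refine le_trans ?_ h1
  rcases le_total c x with h | h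
  · rw [abs_of_nonneg (sub_nonneg.2 h)]
    refine (min_le_right _ _).trans (le_of_eq ?_)
    congr 1; ring
  · rw [abs_of_nonpos (sub_nonpos.2 h)]
    refine (min_le_left _ _).trans (le_of_eq ?_)
    rw [← abs_neg]
    congr 1; ring

/-- The part of a sum of exponentials with exponents in `(u, v)` as a contour integral. -/
theorem sum_filter_eq_circleIntegral {z : ℕ → ℝ} {u v : ℝ} (huv : u < v) (hu : ∀ j, z j ≠ u)
    (hv : ∀ j, z j ≠ v) (b : ℕ → ℂ) (n : ℕ) {E : ℂ → ℂ} (hE : Differentiable ℂ E) :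
    ∑ j ∈ (Finset.range n).filter (fun j => u < z j ∧ z j < v), b j * E (z j) =
      (2 * Real.pi * Complex.I : ℂ)⁻¹ • ∮ w in C(((u + v) / 2 : ℝ), (v - u) / 2),
        (∑ j ∈ Finset.range n, b j / (w - z j)) * E w := by
  have hr : 0 < (v - u) / 2 := by linarith
  set c : ℝ := (u + v) / 2 with hc
  set r : ℝ := (v - u) / 2 with hrdef
  have hnorm : ∀ x : ℝ, ‖(x : ℂ) - c‖ = |x - c| := fun x => by
    rw [← Complex.ofReal_sub, Complex.norm_real, Real.norm_eq_abs]
  have hsph : ∀ j, ∀ w ∈ Metric.sphere (c : ℂ) r, w - z j ≠ 0 := by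
    intro j w hw h0
    rw [sub_eq_zero] at h0
    rw [mem_sphere_iff_norm, h0, hnorm, abs_eq hr.le] at hw
    rcases hw with h | h
    · exact hv j (by linarith)
    · exact hu j (by linarith)
  have hcont : ∀ j, ContinuousOn (fun w => b j / (w - z j) * E w) (Metric.sphere (c : ℂ) r) :=
    fun j => (continuousOn_const.div (by fun_prop) (hsph j)).mul hE.continuous.continuousOn
  simp only [Finset.sum_mul]
  rw [circleIntegral.integral_fun_sum fun j _ => (hcont j).circleIntegrable hr.le, Finset.smul_sum,
    Finset.sum_filter]
  refine Finset.sum_congr rfl fun j _ => ?_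
  have hmul : (fun w => b j / (w - z j) * E w) = fun w : ℂ => b j * ((w - z j)⁻¹ • E w) := by
    ext w
    rw [smul_eq_mul]
    ring
  rw [hmul, circleIntegral.integral_const_mul]
  split_ifs with h
  · have hball : (z j : ℂ) ∈ Metric.ball (c : ℂ) r := by
      rw [mem_ball_iff_norm, hnorm, abs_lt]
      constructor <;> linarith [h.1, h.2]
    rw [DiffContOnCl.circleIntegral_sub_inv_smul hE.diffContOnCl hball, smul_eq_mul, smul_eq_mul]
    have : (2 * Real.pi * Complex.I : ℂ) ≠ 0 := Complex.two_pi_I_ne_zero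
    field_simp
  · have hout : r < |z j - c| := by
      rw [lt_abs]
      rw [not_and_or, not_lt, not_lt] at h
      rcases h with h | h
      · right
        have := lt_of_le_of_ne h (hu j)
        linarith
      · left
        have := lt_of_le_of_ne h (hv j).symm
        linarith
    have hne : ∀ w ∈ Metric.closedBall (c : ℂ) r, w - z j ≠ 0 := by
      intro w hw h0
      rw [sub_eq_zero] at h0
      rw [mem_closedBall_iff_norm, h0, hnorm] at hw
      linarith
    rw [Complex.circleIntegral_eq_zero_of_differentiable_on_off_countable hr.le
      Set.countable_empty]
    · simp
    · exact (ContinuousOn.inv₀ (by fun_prop) hne).smul hE.continuous.continuousOn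
    · intro w hw
      have := hne w (Metric.ball_subset_closedBall hw.1)
      exact DifferentiableAt.fun_smul (DifferentiableAt.fun_inv (by fun_prop) this) (hE w)

/-- On the circle with diameter [u k, u (k + 1)] the real part of w is at least u k, which gives the
exponential; ‖w‖ is comparable to u k, so the interpolation coefficient is at most a multiple of min
(W i) (u k) / u k; and the radius, at most C u k, cancels the denominator. -/
theorem norm_sum_filter_exp_le {z u W : ℕ → ℝ} {C η K : ℝ} (hzpos : ∀ k, 0 < z k)
    (hW : ∀ k, 0 < W k) (hinj : Function.Injective W) (hupos : ∀ k, 0 < u k) (hu : StrictMono u)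
    (hC : 1 ≤ C) (hη : 0 < η) (hK : 0 < K) (huC : ∀ k, u (k + 1) ≤ C * u k)
    (hgap : ∀ k j, η * max (u k) (z j) ≤ |u k - z j|)
    (hfac : ∀ (n i : ℕ) (w : ℂ), i < n → w ≠ 0 → (∀ j, η / C * max ‖w‖ (z j) ≤ ‖w - z j‖) →
      ‖interpolationFactor z W n i w‖ ≤ K * (W i / max ‖w‖ (W i)))
    (b : ℕ → ℂ) (n k : ℕ) {y : ℝ} (hy : 0 ≤ y) :
    ‖∑ j ∈ (Finset.range n).filter (fun j => u k < z j ∧ z j < u (k + 1)),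
        b j * Complex.exp (-(z j * y : ℝ))‖ ≤
      C * K * Real.exp (-(u k * y)) * ∑ i ∈ Finset.range n,
        min (W i) (u k) * ‖∑ j ∈ Finset.range n, b j / ((W i : ℂ) + z j)‖ := by
  have hlt : u k < u (k + 1) := hu (Nat.lt_succ_self k)
  have hne : ∀ k j, z j ≠ u k := by
    intro k j h
    have h1 := hgap k j
    rw [h, sub_self, abs_zero, max_self] at h1
    have := mul_pos hη (hupos k)
    linarith
  have hdiff : Differentiable ℂ fun w : ℂ => Complex.exp (-(w * y)) := by fun_prop
  have hform := sum_filter_eq_circleIntegral hlt (hne k) (hne (k + 1)) b n hdiff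
  have hcast : ∀ j, Complex.exp (-(z j * y : ℝ)) = Complex.exp (-((z j : ℂ) * y)) := fun j => by
    push_cast; rfl
  simp only [hcast]
  rw [hform]
  set S := ∑ i ∈ Finset.range n, min (W i) (u k) *
    ‖∑ j ∈ Finset.range n, b j / ((W i : ℂ) + z j)‖ with hS
  have hr : 0 ≤ (u (k + 1) - u k) / 2 := by linarith
  have hbound : ∀ w ∈ Metric.sphere (((u k + u (k + 1)) / 2 : ℝ) : ℂ) ((u (k + 1) - u k) / 2),
      ‖(∑ j ∈ Finset.range n, b j / (w - z j)) * Complex.exp (-(w * y))‖ ≤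
        K * (u k)⁻¹ * S * Real.exp (-(u k * y)) := by
    intro w hw
    rw [mem_sphere_iff_norm] at hw
    have hre : u k ≤ w.re := by
      have h1 := Complex.abs_re_le_norm (w - ((u k + u (k + 1)) / 2 : ℝ))
      rw [hw, Complex.sub_re, Complex.ofReal_re] at h1
      linarith [(abs_le.1 h1).1]
    have hnl : u k ≤ ‖w‖ := hre.trans (Complex.re_le_norm w)
    have hnu : ‖w‖ ≤ u (k + 1) := by
      have h1 := norm_sub_norm_le w (((u k + u (k + 1)) / 2 : ℝ) : ℂ)
      rw [hw, Complex.norm_real, Real.norm_of_nonneg (by linarith [hupos k])] at h1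
      linarith
    have hwpos : 0 < ‖w‖ := (hupos k).trans_le hnl
    have hdist : ∀ j, η / C * max ‖w‖ (z j) ≤ ‖w - z j‖ := by
      intro j
      have h1 : η * max (u k) (z j) ≤ ‖w - z j‖ := by
        refine le_trans (le_min ?_ ?_) (min_abs_sub_le_norm_sub hw (z j))
        · rw [show (u k + u (k + 1)) / 2 - (u (k + 1) - u k) / 2 = u k by ring]
          exact hgap k j
        · refine le_trans (b := η * max (u (k + 1)) (z j)) (by gcongr) ?_
          rw [show (u k + u (k + 1)) / 2 + (u (k + 1) - u k) / 2 = u (k + 1) by ring]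
          exact hgap (k + 1) j
      refine le_trans ?_ h1
      have h2 : max ‖w‖ (z j) ≤ C * max (u k) (z j) := by
        refine max_le ((hnu.trans (huC k)).trans ?_) ?_
        · gcongr; exact le_max_left _ _
        · have := le_max_right (u k) (z j)
          nlinarith [hzpos j]
      calc η / C * max ‖w‖ (z j) ≤ η / C * (C * max (u k) (z j)) := by gcongr
        _ = _ := by field_simp
    have hwz : ∀ j, w ≠ z j := by
      intro j h
      have h1 := hdist j
      rw [h, sub_self, norm_zero, Complex.norm_real, Real.norm_of_nonneg (hzpos j).le,
        max_self] at h1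
      have : 0 < η / C * z j := mul_pos (by positivity) (hzpos j)
      linarith
    rw [norm_mul, sum_div_sub_eq_sum_interpolationFactor hzpos hW hinj b n hwz]
    have hexp : ‖Complex.exp (-(w * y))‖ ≤ Real.exp (-(u k * y)) := by
      rw [Complex.norm_exp]
      apply Real.exp_le_exp.2
      simp only [Complex.neg_re, Complex.mul_re, Complex.ofReal_re, Complex.ofReal_im, mul_zero,
        sub_zero]
      nlinarith
    refine mul_le_mul ?_ hexp (norm_nonneg _) ?_
    · rw [hS, Finset.mul_sum]
      refine (norm_sum_le _ _).trans (Finset.sum_le_sum fun i hi => ?_)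
      rw [norm_mul]
      have h1 := hfac n i w (Finset.mem_range.1 hi) (norm_pos_iff.1 hwpos) hdist
      have h2 : W i / max ‖w‖ (W i) ≤ (u k)⁻¹ * min (W i) (u k) := by
        have hWi := hW i
        have huk := hupos k
        rw [div_le_iff₀ (by positivity), mul_assoc, ← div_eq_inv_mul, le_div_iff₀ huk]
        rcases le_total (W i) (u k) with h | h
        · rw [min_eq_left h]
          gcongr
          exact hnl.trans (le_max_left _ _)
        · rw [min_eq_right h, mul_comm]
          gcongr
          exact le_max_right _ _
      have h3 : ‖∑ j ∈ Finset.range n, b j / (-(W i : ℂ) - z j)‖ =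
          ‖∑ j ∈ Finset.range n, b j / ((W i : ℂ) + z j)‖ := by
        rw [← norm_neg, ← Finset.sum_neg_distrib]
        congr 1
        refine Finset.sum_congr rfl fun j _ => ?_
        rw [← neg_add', div_neg, neg_neg]
      rw [h3]
      calc _ ≤ ‖∑ j ∈ Finset.range n, b j / ((W i : ℂ) + z j)‖ *
            (K * ((u k)⁻¹ * min (W i) (u k))) := by
            gcongr
            exact h1.trans (by gcongr)
        _ = _ := by ring
    · have : 0 ≤ S := Finset.sum_nonneg fun i _ =>
        mul_nonneg (le_min (hW i).le (hupos k).le) (norm_nonneg _)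
      have := hupos k
      positivity
  refine (circleIntegral.norm_two_pi_i_inv_smul_integral_le_of_norm_le_const hr hbound).trans ?_
  have hS0 : 0 ≤ S := Finset.sum_nonneg fun i _ =>
    mul_nonneg (le_min (hW i).le (hupos k).le) (norm_nonneg _)
  have huk := hupos k
  calc (u (k + 1) - u k) / 2 * (K * (u k)⁻¹ * S * Real.exp (-(u k * y)))
      ≤ (C * u k) * (K * (u k)⁻¹ * S * Real.exp (-(u k * y))) := by
        gcongr
        linarith [huC k]
    _ = _ := by field_simp

/-- For a geometrically growing sequence, the partial sums of a sum of exponentials over suitable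
blocks of exponents are controlled by finitely many values of its Laplace transform. -/
theorem GeometricGrowth.exists_block_bound {z : ℕ → ℝ} (hz : GeometricGrowth z)
    (hmono : StrictMono z) {Q : ℝ} (hQ : ∀ k, z (k + 1) ≤ Q * z k) :
    ∃ (u W : ℕ → ℝ) (C : ℝ), GeometricGrowth u ∧ GeometricGrowth W ∧ StrictMono u ∧ 0 < C ∧
      u 0 < z 0 ∧ z 0 < u 1 ∧ (∀ k j, z j ≠ u k) ∧
      ∀ (b : ℕ → ℂ) (n k : ℕ) (y : ℝ), 0 ≤ y →
        ‖∑ j ∈ (Finset.range n).filter (fun j => u k < z j ∧ z j < u (k + 1)),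
          b j * Complex.exp (-(z j * y : ℝ))‖ ≤
        C * Real.exp (-(max (u k) (z 0) * y)) * ∑ i ∈ Finset.range n,
          min (W i) (u k) * ‖∑ j ∈ Finset.range n, b j / ((W i : ℂ) + z j)‖ := by
  obtain ⟨W, C₁, ρ, hC₁, hρ, hW1, hW2, hsep, hlog⟩ := hz.exists_separated hQ
  obtain ⟨u, C₂, η, hC₂, hη, humono, hugeo, huC, hu0, hu1, hu2, hgap⟩ := hz.exists_gap_points hmono
  have hWgeo : GeometricGrowth W := hz.of_comparable hC₁ hW1 hW2
  set C₃ := max C₂ 1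
  have hC₃ : 1 ≤ C₃ := le_max_right _ _
  obtain ⟨K, hK, hfac⟩ := norm_interpolationFactor_le (η := η / C₃) hz hmono.monotone hC₁ hρ
    (by positivity) hW1 hW2 hsep hlog
  have hinj : Function.Injective W := by
    intro i j hij
    by_contra hne
    have := hsep i j hne
    rw [hij, max_self, sub_self, abs_zero] at this
    have := mul_pos hρ (hWgeo.1 j)
    linarith
  have huC' : ∀ k, u (k + 1) ≤ C₃ * u k := fun k => (huC k).trans
    (mul_le_mul_of_nonneg_right (le_max_left _ _) (hugeo.1 k).le)
  have hne : ∀ k j, z j ≠ u k := by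
    intro k j h
    have h1 := hgap k j
    rw [h, sub_self, abs_zero, max_self] at h1
    have := mul_pos hη (hugeo.1 k)
    linarith
  refine ⟨u, W, C₃ * K, hugeo, hWgeo, humono, by positivity, hu0, hu1, hne, fun b n k y hy => ?_⟩
  have main : ∀ y : ℝ, 0 ≤ y → _ := fun y hy => norm_sum_filter_exp_le hz.1 hWgeo.1 hinj hugeo.1 humono
    hC₃ hη hK huC' hgap hfac b n k (y := y) hy
  -- In the block k = 0 the only possible exponent is z 0, so the bound at y = 0 multiplied by
  -- exp(-z 0 y) improves u 0 to z 0. For k ≥ 1 the maximum is already u k.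
  rcases Nat.eq_zero_or_pos k with rfl | hk
  · have h0 := main 0 le_rfl
    rw [max_eq_right hu0.le]
    have hsub : ∀ j ∈ (Finset.range n).filter (fun j => u 0 < z j ∧ z j < u (0 + 1)), z j = z 0 := by
      intro j hj
      have h2 := (Finset.mem_filter.1 hj).2.2
      have : j < 1 := hmono.lt_iff_lt.1 (h2.trans hu2)
      rw [Nat.lt_one_iff.1 this]
    have heq : ∑ j ∈ (Finset.range n).filter (fun j => u 0 < z j ∧ z j < u (0 + 1)),
          b j * Complex.exp (-(z j * y : ℝ)) =
        (∑ j ∈ (Finset.range n).filter (fun j => u 0 < z j ∧ z j < u (0 + 1)),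
          b j * Complex.exp (-(z j * 0 : ℝ))) * (Real.exp (-(z 0 * y)) : ℂ) := by
      rw [Finset.sum_mul]
      refine Finset.sum_congr rfl fun j hj => ?_
      rw [hsub j hj]
      push_cast
      simp
    rw [heq, norm_mul, Complex.norm_real, Real.norm_of_nonneg (Real.exp_pos _).le]
    rw [mul_zero, neg_zero, Real.exp_zero, mul_one] at h0
    calc _ ≤ _ := mul_le_mul_of_nonneg_right h0 (Real.exp_pos (-(z 0 * y))).le
      _ = _ := by ring
  · rw [max_eq_left (hu1.le.trans (humono.monotone hk))]
    exact main y hy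

/-! ### Pointwise bounds for tails of Müntz polynomials -/

/-- The Müntz polynomial `∑_{j < n} a_j t ^ λ_j`. -/
noncomputable def muntzSum (lam : ℕ → ℝ) (a : ℕ → ℂ) (n : ℕ) (t : ℝ) : ℂ :=
  ∑ j ∈ Finset.range n, a j * ((t ^ lam j : ℝ) : ℂ)

theorem continuous_muntzSum {lam : ℕ → ℝ} (hlam : ∀ k, 0 < lam k) (a : ℕ → ℂ) (n : ℕ) :
    Continuous (muntzSum lam a n) := by
  unfold muntzSum
  refine continuous_finsetSum _ fun j _ => continuous_const.mul ?_
  exact Complex.continuous_ofReal.comp (Real.continuous_rpow_const (hlam j).le)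

/-- The integral of y^{λ_j} (y/τ)^v over [0, τ] is τ^{λ_j + 1}/(v + λ_j + 1). The rational function
at -v is thus, up to sign, a moment of the polynomial; this is the origin of the shift from λ_j to
λ_j + 1. -/
theorem norm_sum_div_le_integral {lam : ℕ → ℝ} (hlam : ∀ k, 0 < lam k) (a : ℕ → ℂ) (n : ℕ)
    {τ v : ℝ} (hτ : 0 < τ) (hv : 0 < v) :
    ‖∑ j ∈ Finset.range n, (a j * ((τ ^ (lam j + 1) : ℝ) : ℂ)) / ((v : ℂ) + (lam j + 1 : ℝ))‖ ≤
      ∫ y in (0 : ℝ)..τ, ‖muntzSum lam a n y‖ * (y / τ) ^ v := by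
  have hcr : ∀ e : ℝ, 0 < e → Continuous fun y : ℝ => ((y ^ e : ℝ) : ℂ) := fun e he =>
    Complex.continuous_ofReal.comp (Real.continuous_rpow_const he.le)
  have hcv : Continuous fun y : ℝ => (((y / τ) ^ v : ℝ) : ℂ) :=
    (hcr v hv).comp (continuous_id.div_const τ)
  have hterm : ∀ j, (a j * ((τ ^ (lam j + 1) : ℝ) : ℂ)) / ((v : ℂ) + (lam j + 1 : ℝ)) =
      ∫ y in (0 : ℝ)..τ, a j * ((y ^ lam j : ℝ) : ℂ) * (((y / τ) ^ v : ℝ) : ℂ) := by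
    intro j
    have h1 : ∀ y ∈ Set.uIcc 0 τ, a j * ((y ^ lam j : ℝ) : ℂ) * (((y / τ) ^ v : ℝ) : ℂ) =
        a j * (τ ^ v : ℝ)⁻¹ * ((y ^ (lam j + v) : ℝ) : ℂ) := by
      intro y hy
      rw [Set.uIcc_of_le hτ.le] at hy
      rw [Real.div_rpow hy.1 hτ.le, Real.rpow_add_of_nonneg hy.1 (hlam j).le hv.le]
      push_cast
      ring
    have hl := hlam j
    rw [intervalIntegral.integral_congr h1, intervalIntegral.integral_const_mul,
      intervalIntegral.integral_ofReal, integral_rpow (Or.inl (by linarith)),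
      Real.zero_rpow (by linarith), sub_zero, ← Complex.ofReal_add, mul_div_assoc, mul_assoc]
    congr 1
    rw [← Complex.ofReal_mul, ← Complex.ofReal_div]
    congr 1
    rw [show lam j + v + 1 = v + (lam j + 1) by ring, Real.rpow_add hτ v]
    have : τ ^ v ≠ 0 := (Real.rpow_pos_of_pos hτ v).ne'
    field_simp
  have hswap : ∫ y in (0 : ℝ)..τ, ∑ j ∈ Finset.range n,
      a j * ((y ^ lam j : ℝ) : ℂ) * (((y / τ) ^ v : ℝ) : ℂ) = ∑ j ∈ Finset.range n,
      ∫ y in (0 : ℝ)..τ, a j * ((y ^ lam j : ℝ) : ℂ) * (((y / τ) ^ v : ℝ) : ℂ) :=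
    intervalIntegral.integral_finsetSum fun j _ => Continuous.intervalIntegrable
      ((continuous_const.mul (hcr _ (hlam j))).mul hcv) _ _
  rw [Finset.sum_congr rfl fun j _ => hterm j, ← hswap]
  refine (intervalIntegral.norm_integral_le_integral_norm hτ.le).trans (le_of_eq ?_)
  refine intervalIntegral.integral_congr fun y hy => ?_
  rw [Set.uIcc_of_le hτ.le] at hy
  rw [← Finset.sum_mul, norm_mul, Complex.norm_real,
    Real.norm_of_nonneg (Real.rpow_nonneg (div_nonneg hy.1 hτ.le) v)]
  rfl

theorem sum_Ico_ite_between {u : ℕ → ℝ} (hu : StrictMono u) {x : ℝ} (hx : ∀ k, x ≠ u k) (g : ℂ)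
    {m M : ℕ} (hmM : m ≤ M) :
    ∑ k ∈ Finset.Ico m M, (if u k < x ∧ x < u (k + 1) then g else 0) =
      if u m < x ∧ x < u M then g else 0 := by
  induction M, hmM using Nat.le_induction with
  | base =>
    rw [Finset.Ico_self, Finset.sum_empty, if_neg]
    exact fun h => lt_asymm h.1 h.2
  | succ M hM ih =>
    rw [Finset.sum_Ico_succ_top hM, ih]
    have hlt := hu (Nat.lt_succ_self M)
    have hle := hu.monotone hM
    rcases lt_or_gt_of_ne (hx M) with h | h
    · rw [if_neg (fun h' => lt_asymm h h'.1 : ¬ (u M < x ∧ x < u (M + 1))), add_zero]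
      simp only [h, h.trans hlt, and_true]
    · rw [if_neg (fun h' => lt_asymm h h'.2 : ¬ (u m < x ∧ x < u M)), zero_add]
      simp only [h, hle.trans_lt h, true_and]

theorem GeometricGrowth.add_one {lam : ℕ → ℝ} (h : GeometricGrowth lam) (hmono : StrictMono lam) :
    GeometricGrowth fun k => lam k + 1 := by
  have h0 := h.1 0
  refine h.of_comparable (C := 1 + 1 / lam 0) (by positivity) (fun k => ?_) fun k => ?_
  · have := h.1 k
    have h2 : 0 ≤ 1 / lam 0 * (lam k + 1) := by positivity
    linarith
  · have h1 : lam 0 ≤ lam k := hmono.monotone (Nat.zero_le k)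
    have h2 : 1 ≤ 1 / lam 0 * lam k := by
      rw [one_div, ← div_eq_inv_mul, le_div_iff₀ h0]
      linarith
    linarith

/-- The part z₀ of the exponent pays for t^{z₀}, since t/τ ≤ 2t for τ = (1 + t)/2. The rest, at
least (1 - z₀ / u 1) u k when k ≥ 1, pays for the exponential, since log(τ/t) ≥ (1 - t)/2. For k = 0
nothing may be left, and exp(u 0 / 2) compensates. -/
theorem exp_neg_mul_log_div_le {u : ℕ → ℝ} {z₀ : ℝ} (hz₀ : 0 < z₀) (hu : StrictMono u)
    (hupos : 0 < u 0) (hu1 : z₀ < u 1) {t : ℝ} (ht0 : 0 < t) (ht1 : t < 1) (k : ℕ) :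
    Real.exp (-(max (u k) z₀ * Real.log ((1 + t) / 2 / t))) ≤
      2 ^ z₀ * Real.exp (u 0 / 2) * (t ^ z₀ *
        Real.exp (-((1 - z₀ / u 1) / 2 * u k * (1 - t)))) := by
  have hτ : 0 < (1 + t) / 2 := by linarith
  set l := Real.log ((1 + t) / 2 / t) with hl
  have hl1 : (1 - t) / 2 ≤ l := by
    refine le_trans ?_ (Real.one_sub_inv_le_log_of_pos (div_pos hτ ht0))
    rw [inv_div, div_div_eq_mul_div, le_sub_iff_add_le, ← le_sub_iff_add_le', div_le_iff₀ (by linarith)]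
    nlinarith
  have hu1pos : 0 < u 1 := hz₀.trans hu1
  have hfrac : z₀ / u 1 < 1 := (div_lt_one hu1pos).2 hu1
  have hfrac0 : 0 < z₀ / u 1 := div_pos hz₀ hu1pos
  have hv : (1 - z₀ / u 1) / 2 * u k * (1 - t) - u 0 / 2 ≤ (max (u k) z₀ - z₀) * l := by
    refine le_trans ?_ (mul_le_mul_of_nonneg_left hl1 (sub_nonneg.2 (le_max_right _ _)))
    rcases Nat.eq_zero_or_pos k with rfl | hk
    · have h1 : 0 ≤ (max (u 0) z₀ - z₀) * ((1 - t) / 2) :=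
        mul_nonneg (sub_nonneg.2 (le_max_right _ _)) (by linarith)
      have h2 : (1 - z₀ / u 1) / 2 * u 0 * (1 - t) ≤ u 0 / 2 := by
        calc (1 - z₀ / u 1) / 2 * u 0 * (1 - t) ≤ 1 / 2 * u 0 * 1 := by
              gcongr <;> linarith
          _ = u 0 / 2 := by ring
      linarith
    · have h1 : u 1 ≤ u k := hu.monotone hk
      have h2 : z₀ ≤ z₀ / u 1 * u k := by
        rw [div_mul_eq_mul_div, le_div_iff₀ hu1pos]
        gcongr
      have h3 : (1 - z₀ / u 1) * u k ≤ max (u k) z₀ - z₀ := by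
        linarith [le_max_left (u k) z₀]
      nlinarith [mul_le_mul_of_nonneg_right h3 (by linarith : 0 ≤ (1 - t) / 2)]
  have h1 : Real.exp (-(z₀ * l)) ≤ 2 ^ z₀ * t ^ z₀ := by
    rw [← Real.mul_rpow two_pos.le ht0.le, hl, mul_comm, ← neg_mul, ← Real.log_inv, inv_div,
      Real.exp_mul, Real.exp_log (div_pos ht0 hτ)]
    refine Real.rpow_le_rpow (div_pos ht0 hτ).le ?_ hz₀.le
    rw [div_le_iff₀ hτ]
    nlinarith
  calc Real.exp (-(max (u k) z₀ * l))
      = Real.exp (-(z₀ * l)) * Real.exp (-((max (u k) z₀ - z₀) * l)) := by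
        rw [← Real.exp_add]; ring_nf
    _ ≤ (2 ^ z₀ * t ^ z₀) *
        Real.exp (u 0 / 2 + -((1 - z₀ / u 1) / 2 * u k * (1 - t))) := by
        gcongr
        linarith
    _ = _ := by rw [Real.exp_add]; ring

/-- The inequality min(W, u) ≤ W^{1-ε} u^ε separates the double sum: the sum over k yields (1 -
t)^{-ε} and the sum over i yields (τ - y)^{ε-1}. Half of each exponential is set aside for the decay
in u m. -/
theorem tail_kernel_le {u W : ℕ → ℝ} (hu : GeometricGrowth u) (humono : StrictMono u)
    (hW : GeometricGrowth W) {c : ℝ} (hc : 0 < c) {ε : ℝ} (hε0 : 0 < ε) (hε1 : ε < 1) :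
    ∃ C : ℝ, 0 < C ∧ ∀ (n m M : ℕ) (t y : ℝ), 0 < t → t < 1 → 0 ≤ y → y < (1 + t) / 2 →
      ∑ i ∈ Finset.range n, (∑ k ∈ Finset.Ico m M, Real.exp (-(c * u k * (1 - t))) *
        min (W i) (u k)) * (y / ((1 + t) / 2)) ^ W i ≤
      C * Real.exp (-(c / 2 * u m * (1 - t))) *
        ((1 - t) ^ (-ε) * ((1 + t) / 2 - y) ^ (ε - 1)) := by
  obtain ⟨C₁, hC₁, h₁⟩ := hu.sum_rpow_mul_exp_le hε0
  obtain ⟨C₂, hC₂, h₂⟩ := hW.sum_rpow_mul_exp_le (sub_pos.2 hε1)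
  have hc2 : 0 < c / 2 := half_pos hc
  refine ⟨C₁ * (c / 2) ^ (-ε) * C₂, by positivity, fun n m M t y ht0 ht1 hy0 hy1 => ?_⟩
  have hD : 0 < 1 - t := by linarith
  have hτ : 0 < (1 + t) / 2 := by linarith
  set τ := (1 + t) / 2 with hτdef
  have hE : 0 < τ - y := by linarith
  have hinner : ∀ i, ∑ k ∈ Finset.Ico m M, Real.exp (-(c * u k * (1 - t))) * min (W i) (u k) ≤
      C₁ * (c / 2) ^ (-ε) * Real.exp (-(c / 2 * u m * (1 - t))) * (1 - t) ^ (-ε) *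
        W i ^ (1 - ε) := by
    intro i
    have hWi := hW.1 i
    calc _ ≤ ∑ k ∈ Finset.Ico m M, (Real.exp (-(c / 2 * u m * (1 - t))) * W i ^ (1 - ε)) *
          (u k ^ ε * Real.exp (-(u k * (c / 2 * (1 - t))))) := by
          refine Finset.sum_le_sum fun k hk => ?_
          have huk := hu.1 k
          have hmk : u m ≤ u k := humono.monotone (Finset.mem_Ico.1 hk).1
          have h3 : min (W i) (u k) ≤ W i ^ (1 - ε) * u k ^ ε := by
            have hpos : 0 < min (W i) (u k) := lt_min hWi huk
            calc min (W i) (u k) = min (W i) (u k) ^ (1 - ε) * min (W i) (u k) ^ ε := by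
                  rw [← Real.rpow_add hpos, sub_add_cancel, Real.rpow_one]
              _ ≤ _ := by
                  have hε := sub_pos.2 hε1
                  gcongr
                  · exact min_le_left _ _
                  · exact min_le_right _ _
          have h4 : Real.exp (-(c * u k * (1 - t))) ≤ Real.exp (-(c / 2 * u m * (1 - t))) *
              Real.exp (-(u k * (c / 2 * (1 - t)))) := by
            rw [← Real.exp_add]
            apply Real.exp_le_exp.2
            have : c / 2 * u m * (1 - t) ≤ c / 2 * u k * (1 - t) := by gcongr
            linarith
          calc _ ≤ (Real.exp (-(c / 2 * u m * (1 - t))) * Real.exp (-(u k * (c / 2 * (1 - t))))) *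
                (W i ^ (1 - ε) * u k ^ ε) := by gcongr
            _ = _ := by ring
      _ ≤ (Real.exp (-(c / 2 * u m * (1 - t))) * W i ^ (1 - ε)) *
          (C₁ * (c / 2 * (1 - t)) ^ (-ε)) := by
          rw [← Finset.mul_sum]
          gcongr
          exact h₁ _ (by positivity) _
      _ = _ := by
          rw [Real.mul_rpow hc2.le hD.le]
          ring
  have hyτ : 0 ≤ y / τ := div_nonneg hy0 hτ.le
  calc _ ≤ ∑ i ∈ Finset.range n, (C₁ * (c / 2) ^ (-ε) * Real.exp (-(c / 2 * u m * (1 - t))) *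
        (1 - t) ^ (-ε)) * (W i ^ (1 - ε) * Real.exp (-(W i * (τ - y)))) := by
        refine Finset.sum_le_sum fun i _ => ?_
        have hWi := hW.1 i
        have h5 : (y / τ) ^ W i ≤ Real.exp (-(W i * (τ - y))) := by
          refine (rpow_le_exp_neg_mul_one_sub hyτ hWi).trans (Real.exp_le_exp.2 ?_)
          have : τ - y ≤ 1 - y / τ := by
            rw [one_sub_div hτ.ne', le_div_iff₀ hτ]
            nlinarith
          nlinarith
        calc _ ≤ (C₁ * (c / 2) ^ (-ε) * Real.exp (-(c / 2 * u m * (1 - t))) * (1 - t) ^ (-ε) *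
              W i ^ (1 - ε)) * Real.exp (-(W i * (τ - y))) := by
              gcongr
              exact hinner i
          _ = _ := by ring
    _ ≤ (C₁ * (c / 2) ^ (-ε) * Real.exp (-(c / 2 * u m * (1 - t))) * (1 - t) ^ (-ε)) *
        (C₂ * (τ - y) ^ (-(1 - ε))) := by
        rw [← Finset.mul_sum]
        gcongr
        exact h₂ _ hE _
    _ = _ := by rw [neg_sub]; ring

/-- The tail, multiplied by t, is a sum of blocks, each bounded by moments of the polynomial on [0,
τ]; interchanging sum and integral leaves the kernel of `tail_kernel_le`. Taking τ midway between t
and 1 gives decay of (t/τ)^{u k} while keeping 1 - y ≥ (1 - t)/2. Two exponents are admitted because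
no single one need be integrable to the required power both near y = τ and far from it. -/
theorem exists_tail_bound {lam : ℕ → ℝ} (hlam : GeometricGrowth lam) (hmono : StrictMono lam)
    {Q : ℝ} (hQ : ∀ k, lam (k + 1) ≤ Q * lam k) {ε₁ ε₂ : ℝ} (h1 : 0 < ε₁) (h1' : ε₁ < 1)
    (h2 : 0 < ε₂) (h2' : ε₂ < 1) :
    ∃ (u : ℕ → ℝ) (C c : ℝ), GeometricGrowth u ∧ 0 < C ∧ 0 < c ∧ u 0 < lam 0 + 1 ∧
      ∀ (a : ℕ → ℂ) (n m : ℕ) (t : ℝ), 0 < t → t < 1 →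
        ENNReal.ofReal ‖∑ j ∈ (Finset.range n).filter (fun j => u m < lam j + 1),
          a j * ((t ^ lam j : ℝ) : ℂ)‖ ≤
        ENNReal.ofReal (C * Real.exp (-(c * u m * (1 - t))) * t ^ lam 0) *
          ∫⁻ y in Set.Ioo 0 ((1 + t) / 2), ENNReal.ofReal (‖muntzSum lam a n y‖ *
            min ((1 - t) ^ (-ε₁) * ((1 + t) / 2 - y) ^ (ε₁ - 1))
              ((1 - t) ^ (-ε₂) * ((1 + t) / 2 - y) ^ (ε₂ - 1))) := by
  obtain ⟨u, W, C₀, hu, hW, humono, hC₀, hu0, hu1, hne, hblock⟩ :=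
    (hlam.add_one hmono).exists_block_bound (fun i j hij => add_lt_add_left (hmono hij) 1)
      (Q := max Q 1) (fun k => by
        have := hQ k
        have h3 : Q * lam k ≤ max Q 1 * lam k :=
          mul_le_mul_of_nonneg_right (le_max_left _ _) (hlam.1 k).le
        have h4 := le_max_right Q 1
        linarith)
  have hz₀ : 0 < lam 0 + 1 := by linarith [hlam.1 0]
  set c₀ := (1 - (lam 0 + 1) / u 1) / 2 with hc₀
  have hc₀pos : 0 < c₀ := half_pos (sub_pos.2 ((div_lt_one (hz₀.trans hu1)).2 hu1))
  obtain ⟨C₁, hC₁, hk₁⟩ := tail_kernel_le hu humono hW hc₀pos h1 h1'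
  obtain ⟨C₂, hC₂, hk₂⟩ := tail_kernel_le hu humono hW hc₀pos h2 h2'
  set B := C₀ * (2 ^ (lam 0 + 1) * Real.exp (u 0 / 2)) with hB
  have hBpos : 0 < B := by positivity
  refine ⟨u, B * max C₁ C₂, c₀ / 2, hu, by positivity, half_pos hc₀pos, hu0,
    fun a n m t ht0 ht1 => ?_⟩
  have hτ : 0 < (1 + t) / 2 := by linarith
  set τ := (1 + t) / 2 with hτdef
  have hlog : 0 ≤ Real.log (τ / t) := Real.log_nonneg ((one_le_div ht0).2 (by linarith))
  have htz : ∀ x : ℝ, τ ^ x * Real.exp (-(x * Real.log (τ / t))) = t ^ x := by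
    intro x
    rw [mul_comm x, ← neg_mul, ← Real.log_inv, inv_div, Real.exp_mul,
      Real.exp_log (div_pos ht0 hτ), Real.div_rpow ht0.le hτ.le,
      mul_div_cancel₀ _ (Real.rpow_pos_of_pos hτ x).ne']
  set A : ℕ → ℝ := fun i => ∫ y in (0 : ℝ)..τ, ‖muntzSum lam a n y‖ * (y / τ) ^ W i with hA
  have hb : ∀ k, ‖∑ j ∈ (Finset.range n).filter
      (fun j => u k < lam j + 1 ∧ lam j + 1 < u (k + 1)), a j * ((t ^ (lam j + 1) : ℝ) : ℂ)‖ ≤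
      B * t ^ (lam 0 + 1) * (Real.exp (-(c₀ * u k * (1 - t))) *
        ∑ i ∈ Finset.range n, min (W i) (u k) * A i) := by
    intro k
    have h3 := hblock (fun j => a j * ((τ ^ (lam j + 1) : ℝ) : ℂ)) n k (Real.log (τ / t)) hlog
    have h4 : ∀ j, a j * ((τ ^ (lam j + 1) : ℝ) : ℂ) *
        Complex.exp (-((lam j + 1) * Real.log (τ / t) : ℝ)) =
        a j * ((t ^ (lam j + 1) : ℝ) : ℂ) := by
      intro j
      rw [← htz, mul_assoc]
      push_cast
      rfl
    simp only [h4] at h3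
    refine h3.trans ?_
    have h5 := exp_neg_mul_log_div_le hz₀ humono (hu.1 0) hu1 ht0 ht1 k
    have h6 : ∑ i ∈ Finset.range n, min (W i) (u k) * ‖∑ j ∈ Finset.range n,
        a j * ((τ ^ (lam j + 1) : ℝ) : ℂ) / ((W i : ℂ) + (lam j + 1 : ℝ))‖ ≤
        ∑ i ∈ Finset.range n, min (W i) (u k) * A i := by
      refine Finset.sum_le_sum fun i _ => ?_
      exact mul_le_mul_of_nonneg_left (norm_sum_div_le_integral hlam.1 a n hτ (hW.1 i))
        (le_min (hW.1 i).le (hu.1 k).le)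
    calc _ ≤ C₀ * (2 ^ (lam 0 + 1) * Real.exp (u 0 / 2) * (t ^ (lam 0 + 1) *
          Real.exp (-(c₀ * u k * (1 - t))))) * ∑ i ∈ Finset.range n, min (W i) (u k) * A i := by
          refine mul_le_mul (mul_le_mul_of_nonneg_left h5 hC₀.le) h6
            (Finset.sum_nonneg fun i _ => mul_nonneg (le_min (hW.1 i).le (hu.1 k).le)
              (norm_nonneg _)) (by positivity)
      _ = _ := by rw [hB]; ring
  obtain ⟨M, hM⟩ : ∃ M, m ≤ M ∧ ∀ j ∈ Finset.range n, lam j + 1 < u M := by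
    have h3 : ∀ᶠ M in atTop, ∀ j ∈ Finset.range n, lam j + 1 < u M :=
      (Finset.eventually_all _).2 fun j _ => hu.tendsto_atTop.eventually_gt_atTop _
    obtain ⟨M, hM⟩ := ((eventually_ge_atTop m).and h3).exists
    exact ⟨M, hM⟩
  have hdecomp : ((t : ℝ) : ℂ) * ∑ j ∈ (Finset.range n).filter (fun j => u m < lam j + 1),
      a j * ((t ^ lam j : ℝ) : ℂ) = ∑ k ∈ Finset.Ico m M, ∑ j ∈ (Finset.range n).filter
      (fun j => u k < lam j + 1 ∧ lam j + 1 < u (k + 1)), a j * ((t ^ (lam j + 1) : ℝ) : ℂ) := by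
    simp only [Finset.sum_filter]
    rw [Finset.sum_comm, Finset.mul_sum]
    refine Finset.sum_congr rfl fun j hj => ?_
    rw [sum_Ico_ite_between humono (fun k => hne k j) _ hM.1]
    simp only [hM.2 j hj, and_true]
    split_ifs
    · rw [Real.rpow_add_one ht0.ne']
      push_cast
      ring
    · rw [mul_zero]
  have hcontA : ∀ i, Continuous fun y : ℝ => ‖muntzSum lam a n y‖ * (y / τ) ^ W i := fun i =>
    (continuous_muntzSum hlam.1 a n).norm.mul
      ((Real.continuous_rpow_const (hW.1 i).le).comp (continuous_id.div_const τ))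
  set G : ℝ → ℝ := fun y => ∑ i ∈ Finset.range n, (∑ k ∈ Finset.Ico m M,
    Real.exp (-(c₀ * u k * (1 - t))) * min (W i) (u k)) * (y / τ) ^ W i with hG
  have hGcont : Continuous fun y => ‖muntzSum lam a n y‖ * G y := by
    refine (continuous_muntzSum hlam.1 a n).norm.mul (continuous_finsetSum _ fun i _ => ?_)
    exact continuous_const.mul
      ((Real.continuous_rpow_const (hW.1 i).le).comp (continuous_id.div_const τ))
  have hnorm : ‖∑ j ∈ (Finset.range n).filter (fun j => u m < lam j + 1),
      a j * ((t ^ lam j : ℝ) : ℂ)‖ ≤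
      B * t ^ lam 0 * ∫ y in (0 : ℝ)..τ, ‖muntzSum lam a n y‖ * G y := by
    have h3 : t * ‖∑ j ∈ (Finset.range n).filter (fun j => u m < lam j + 1),
        a j * ((t ^ lam j : ℝ) : ℂ)‖ ≤ ∑ k ∈ Finset.Ico m M, B * t ^ (lam 0 + 1) *
        (Real.exp (-(c₀ * u k * (1 - t))) * ∑ i ∈ Finset.range n, min (W i) (u k) * A i) := by
      rw [← Real.norm_of_nonneg ht0.le, ← Complex.norm_real, ← norm_mul, Complex.norm_real,
        Real.norm_of_nonneg ht0.le, hdecomp]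
      exact (norm_sum_le _ _).trans (Finset.sum_le_sum fun k _ => hb k)
    have h4 : ∑ k ∈ Finset.Ico m M, B * t ^ (lam 0 + 1) *
        (Real.exp (-(c₀ * u k * (1 - t))) * ∑ i ∈ Finset.range n, min (W i) (u k) * A i) =
        t * (B * t ^ lam 0 * ∫ y in (0 : ℝ)..τ, ‖muntzSum lam a n y‖ * G y) := by
      have h5 : ∫ y in (0 : ℝ)..τ, ‖muntzSum lam a n y‖ * G y = ∑ i ∈ Finset.range n,
          (∑ k ∈ Finset.Ico m M, Real.exp (-(c₀ * u k * (1 - t))) * min (W i) (u k)) * A i := by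
        rw [hA]
        simp only [← intervalIntegral.integral_const_mul]
        refine Eq.trans ?_ (intervalIntegral.integral_finsetSum fun i _ =>
          Continuous.intervalIntegrable (continuous_const.mul (hcontA i)) _ _)
        refine intervalIntegral.integral_congr fun y _ => ?_
        simp only [hG, Finset.mul_sum]
        exact Finset.sum_congr rfl fun i _ => by ring
      rw [h5, ← Finset.mul_sum, Real.rpow_add_one ht0.ne']
      simp only [Finset.mul_sum, Finset.sum_mul]
      rw [Finset.sum_comm]
      refine Finset.sum_congr rfl fun i _ => Finset.sum_congr rfl fun k _ => by ring
    rw [h4] at h3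
    exact le_of_mul_le_mul_left h3 ht0
  have hGnn : ∀ y, 0 ≤ y → 0 ≤ G y := fun y hy => Finset.sum_nonneg fun i _ =>
    mul_nonneg (Finset.sum_nonneg fun k _ => mul_nonneg (Real.exp_pos _).le
      (le_min (hW.1 i).le (hu.1 k).le)) (Real.rpow_nonneg (div_nonneg hy hτ.le) _)
  refine (ENNReal.ofReal_le_ofReal hnorm).trans ?_
  rw [ENNReal.ofReal_mul (by positivity), intervalIntegral.integral_of_le hτ.le,
    integral_Ioc_eq_integral_Ioo,
    ofReal_integral_eq_lintegral_ofReal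
      ((hGcont.integrableOn_Icc (a := 0) (b := τ)).mono_set Set.Ioo_subset_Icc_self)
      ((ae_restrict_iff' measurableSet_Ioo).2 (Eventually.of_forall fun y hy =>
        mul_nonneg (norm_nonneg _) (hGnn y hy.1.le))),
    ← lintegral_const_mul' _ _ ENNReal.ofReal_ne_top,
    ← lintegral_const_mul' _ _ ENNReal.ofReal_ne_top]
  refine setLIntegral_mono' measurableSet_Ioo fun y hy => ?_
  have hDpos : 0 < 1 - t := by linarith
  have hEpos : 0 < τ - y := by linarith [hy.2]
  rw [← ENNReal.ofReal_mul (by positivity), ← ENNReal.ofReal_mul (by positivity)]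
  apply ENNReal.ofReal_le_ofReal
  have hG1 := hk₁ n m M t y ht0 ht1 hy.1.le hy.2
  have hG2 := hk₂ n m M t y ht0 ht1 hy.1.le hy.2
  have hG3 : G y ≤ max C₁ C₂ * Real.exp (-(c₀ / 2 * u m * (1 - t))) *
      min ((1 - t) ^ (-ε₁) * (τ - y) ^ (ε₁ - 1)) ((1 - t) ^ (-ε₂) * (τ - y) ^ (ε₂ - 1)) := by
    rw [mul_min_of_nonneg _ _ (by positivity), le_min_iff]
    constructor
    · refine hG1.trans ?_
      gcongr
      exact le_max_left _ _
    · refine hG2.trans ?_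
      gcongr
      exact le_max_right _ _
  calc B * t ^ lam 0 * (‖muntzSum lam a n y‖ * G y) ≤ B * t ^ lam 0 * (‖muntzSum lam a n y‖ *
        (max C₁ C₂ * Real.exp (-(c₀ / 2 * u m * (1 - t))) *
      min ((1 - t) ^ (-ε₁) * (τ - y) ^ (ε₁ - 1)) ((1 - t) ^ (-ε₂) * (τ - y) ^ (ε₂ - 1)))) := by
        gcongr
    _ = _ := by ring

/-! ### Hölder's inequality against the kernel -/

theorem lintegral_Ioc_rpow {r D : ℝ} (hr : -1 < r) (hD : 0 < D) :
    ∫⁻ v in Set.Ioc 0 D, ENNReal.ofReal (v ^ r) = ENNReal.ofReal (D ^ (r + 1) / (r + 1)) := by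
  have hint := intervalIntegral.intervalIntegrable_rpow' (a := 0) (b := D) hr
  rw [← ofReal_integral_eq_lintegral_ofReal
    ((intervalIntegrable_iff_integrableOn_Ioc_of_le hD.le).1 hint)
    ((ae_restrict_iff' measurableSet_Ioc).2
      (Eventually.of_forall fun y hy => Real.rpow_nonneg hy.1.le r)),
    ← intervalIntegral.integral_of_le hD.le, integral_rpow (Or.inl hr),
    Real.zero_rpow (by linarith), sub_zero]

theorem lintegral_Ioi_rpow {r D : ℝ} (hr : r < -1) (hD : 0 < D) :
    ∫⁻ v in Set.Ioi D, ENNReal.ofReal (v ^ r) = ENNReal.ofReal (-D ^ (r + 1) / (r + 1)) := by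
  rw [← ofReal_integral_eq_lintegral_ofReal (integrableOn_Ioi_rpow_of_lt hr hD)
    ((ae_restrict_iff' measurableSet_Ioi).2
      (Eventually.of_forall fun y hy => Real.rpow_nonneg (hD.trans hy).le r)),
    integral_Ioi_rpow_of_lt hr hD]

theorem rpow_le_two_rpow_abs_mul {x y e : ℝ} (hx : 0 < x) (hy : 0 < y) (h1 : x ≤ 2 * y)
    (h2 : y ≤ 2 * x) : x ^ e ≤ 2 ^ |e| * y ^ e := by
  rw [← div_le_iff₀ (by positivity), ← Real.div_rpow hx.le hy.le]
  rcases le_total 0 e with h | h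
  · rw [abs_of_nonneg h]
    exact Real.rpow_le_rpow (by positivity) ((div_le_iff₀ hy).2 h1) h
  · rw [abs_of_nonpos h, ← inv_div, Real.inv_rpow (by positivity), ← Real.rpow_neg (by positivity)]
    exact Real.rpow_le_rpow (by positivity) ((div_le_iff₀ hx).2 h2) (by linarith)

/-- Hölder's inequality against a kernel with different homogeneity near and far from the
diagonal. -/
theorem lintegral_kernel_rpow_le {e ε₁ ε₂ k r : ℝ} (hr : 0 < r) (h1 : (ε₁ - 1 + e) * r < -1)
    (h2 : -1 < (ε₂ - 1) * r) :
    ∃ C : ℝ, 0 < C ∧ ∀ t : ℝ, 0 < t → t < 1 →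
      ∫⁻ y in Set.Ioo 0 ((1 + t) / 2), ENNReal.ofReal
        (min ((1 - t) ^ (-ε₁) * ((1 + t) / 2 - y) ^ (ε₁ - 1))
          ((1 - t) ^ (-ε₂) * ((1 + t) / 2 - y) ^ (ε₂ - 1)) * (1 - y) ^ e * (1 - t) ^ k) ^ r ≤
      ENNReal.ofReal (C * (1 - t) ^ ((e + k - 1) * r + 1)) := by
  set r₁ := (ε₁ - 1 + e) * r with hr₁
  set r₂ := (ε₂ - 1) * r with hr₂
  have hr₁' : 0 < -(r₁ + 1) := by linarith
  have hr₂' : 0 < r₂ + 1 := by linarith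
  refine ⟨(2 ^ |e|) ^ r * (1 / (r₂ + 1) + 1 / -(r₁ + 1)), by positivity, fun t ht0 ht1 => ?_⟩
  have hD : 0 < 1 - t := by linarith
  set D := 1 - t with hDdef
  set τ := (1 + t) / 2 with hτ
  have hone : ∀ y, 1 - y = (τ - y) + D / 2 := fun y => by rw [hτ, hDdef]; ring
  set A₁ := (2 ^ |e| * D ^ (k - ε₁)) ^ r with hA₁
  set A₂ := (2 ^ |e| * D ^ (k - ε₂ + e)) ^ r with hA₂
  have hA₁0 : 0 ≤ A₁ := by positivity
  have hA₂0 : 0 ≤ A₂ := by positivity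
  -- With v = τ - y one has 1 - y = v + D/2. For v ≤ D this is comparable to D and the ε₂ kernel is
  -- used; for v > D it is comparable to v and the ε₁ kernel is used.
  set Φ : ℝ → ℝ≥0∞ := fun v => (Set.Ioc 0 D).indicator (fun v => ENNReal.ofReal (A₂ * v ^ r₂)) v +
    (Set.Ioi D).indicator (fun v => ENNReal.ofReal (A₁ * v ^ r₁)) v with hΦ
  have hpt : ∀ y ∈ Set.Ioo 0 τ, ENNReal.ofReal
        (min (D ^ (-ε₁) * (τ - y) ^ (ε₁ - 1)) (D ^ (-ε₂) * (τ - y) ^ (ε₂ - 1)) *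
          (1 - y) ^ e * D ^ k) ^ r ≤ Φ (τ - y) := by
    intro y hy
    have hv : 0 < τ - y := by linarith [hy.2]
    have h1y : 0 < 1 - y := by rw [hone]; positivity
    rw [ENNReal.ofReal_rpow_of_nonneg (by positivity) hr.le]
    rcases le_or_gt (τ - y) D with h | h
    · refine le_trans ?_ (le_add_right (le_of_eq (Set.indicator_of_mem (Set.mem_Ioc.2 ⟨hv, h⟩) _).symm))
      apply ENNReal.ofReal_le_ofReal
      have h3 : (1 - y) ^ e ≤ 2 ^ |e| * D ^ e :=
        rpow_le_two_rpow_abs_mul h1y hD (by linarith [hone y]) (by linarith [hone y])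
      calc _ ≤ (D ^ (-ε₂) * (τ - y) ^ (ε₂ - 1) * (2 ^ |e| * D ^ e) * D ^ k) ^ r := by
            gcongr
            exact min_le_right _ _
        _ = (2 ^ |e| * D ^ (k - ε₂ + e) * (τ - y) ^ (ε₂ - 1)) ^ r := by
            rw [show k - ε₂ + e = -ε₂ + e + k by ring, Real.rpow_add hD, Real.rpow_add hD]
            ring_nf
        _ = _ := by
            rw [Real.mul_rpow (by positivity) (by positivity), ← Real.rpow_mul hv.le]
    · refine le_trans ?_ (le_add_left (le_of_eq (Set.indicator_of_mem (Set.mem_Ioi.2 h) _).symm))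
      apply ENNReal.ofReal_le_ofReal
      have h3 : (1 - y) ^ e ≤ 2 ^ |e| * (τ - y) ^ e :=
        rpow_le_two_rpow_abs_mul h1y hv (by linarith [hone y]) (by linarith [hone y])
      calc _ ≤ (D ^ (-ε₁) * (τ - y) ^ (ε₁ - 1) * (2 ^ |e| * (τ - y) ^ e) * D ^ k) ^ r := by
            gcongr
            exact min_le_left _ _
        _ = (2 ^ |e| * D ^ (k - ε₁) * (τ - y) ^ (ε₁ - 1 + e)) ^ r := by
            rw [show k - ε₁ = -ε₁ + k by ring, Real.rpow_add hD, Real.rpow_add hv]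
            ring_nf
        _ = _ := by
            rw [Real.mul_rpow (by positivity) (by positivity), ← Real.rpow_mul hv.le]
  have hm₁ : Measurable fun v : ℝ => ENNReal.ofReal (A₁ * v ^ r₁) := by fun_prop
  have hm₂ : Measurable fun v : ℝ => ENNReal.ofReal (A₂ * v ^ r₂) := by fun_prop
  calc _ ≤ ∫⁻ y in Set.Ioo 0 τ, Φ (τ - y) := setLIntegral_mono' measurableSet_Ioo hpt
    _ ≤ ∫⁻ y, Φ (τ - y) := setLIntegral_le_lintegral _ _
    _ = ∫⁻ v, Φ v := lintegral_sub_left_eq_self Φ τ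
    _ = ENNReal.ofReal A₂ * ENNReal.ofReal (D ^ (r₂ + 1) / (r₂ + 1)) +
        ENNReal.ofReal A₁ * ENNReal.ofReal (-D ^ (r₁ + 1) / (r₁ + 1)) := by
        rw [hΦ, lintegral_add_left (hm₂.indicator measurableSet_Ioc),
          lintegral_indicator measurableSet_Ioc, lintegral_indicator measurableSet_Ioi]
        simp only [ENNReal.ofReal_mul hA₁0, ENNReal.ofReal_mul hA₂0]
        rw [lintegral_const_mul' _ _ ENNReal.ofReal_ne_top,
          lintegral_const_mul' _ _ ENNReal.ofReal_ne_top, lintegral_Ioc_rpow h2 hD,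
          lintegral_Ioi_rpow h1 hD]
    _ = _ := by
        have e1 : -D ^ (r₁ + 1) / (r₁ + 1) = D ^ (r₁ + 1) / -(r₁ + 1) := by
          rw [div_neg, neg_div]
        rw [e1, ← ENNReal.ofReal_mul hA₂0, ← ENNReal.ofReal_mul hA₁0,
          ← ENNReal.ofReal_add (by positivity) (by positivity)]
        congr 1
        have e2 : A₂ * D ^ (r₂ + 1) = (2 ^ |e|) ^ r * D ^ ((e + k - 1) * r + 1) := by
          rw [hA₂, Real.mul_rpow (by positivity) (by positivity), ← Real.rpow_mul hD.le, mul_assoc,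
            ← Real.rpow_add hD]
          congr 2
          rw [hr₂]; ring
        have e3 : A₁ * D ^ (r₁ + 1) = (2 ^ |e|) ^ r * D ^ ((e + k - 1) * r + 1) := by
          rw [hA₁, Real.mul_rpow (by positivity) (by positivity), ← Real.rpow_mul hD.le, mul_assoc,
            ← Real.rpow_add hD]
          congr 2
          rw [hr₁]; ring
        rw [mul_div_assoc', mul_div_assoc', e2, e3]
        ring

/-- The point is the extra weight ((1 - t)/(1 - y))^{α/2} left under the integral: plain Hölder
would lose it, and it is what makes the later sum over annuli converge. -/
theorem exists_holder_kernel {s α : ℝ} (hs : 1 < s) (hα : 0 < α) :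
    ∃ ε₁ ε₂ C : ℝ, 0 < ε₁ ∧ ε₁ < 1 ∧ 0 < ε₂ ∧ ε₂ < 1 ∧ 0 < C ∧
      ∀ (t : ℝ) (g : ℝ → ℝ), 0 < t → t < 1 → Measurable g → (∀ y, 0 ≤ g y) →
        ∫⁻ y in Set.Ioo 0 ((1 + t) / 2), ENNReal.ofReal (g y *
            min ((1 - t) ^ (-ε₁) * ((1 + t) / 2 - y) ^ (ε₁ - 1))
              ((1 - t) ^ (-ε₂) * ((1 + t) / 2 - y) ^ (ε₂ - 1))) ≤
        ENNReal.ofReal (C * (1 - t) ^ (-(α / s))) * (∫⁻ y in Set.Ioo 0 ((1 + t) / 2),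
          ENNReal.ofReal (g y) ^ s * ENNReal.ofReal ((1 - y) ^ (α - 1)) *
            ENNReal.ofReal (((1 - t) / (1 - y)) ^ (α / 2))) ^ (1 / s) := by
  have hs0 : 0 < s := by linarith
  have hconj := Real.HolderConjugate.conjExponent hs
  set r := s.conjExponent with hr
  have hr0 : 0 < r := hconj.symm.pos
  have hrs : r⁻¹ = 1 - s⁻¹ := by linarith [hconj.inv_add_inv_eq_one]
  have hsinv : s⁻¹ < 1 := inv_lt_one_of_one_lt₀ hs
  have hsinv0 : 0 < s⁻¹ := by positivity
  -- The exponents e and k make the s-th power of (1 - y)^{-e} (1 - t)^{-k} equal to (1 - y)^{α-1}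
  -- ((1 - t)/(1 - y))^{α/2}.
  set e := -((α - 1 - α / 2) / s) with he
  set k := -(α / 2 / s) with hk
  -- Convergence far from y = τ requires ε₁ < α/(2s); integrability near y = τ requires ε₂ > 1/s.
  set ε₁ := min (α / (4 * s)) (1 / 2) with hε₁
  set ε₂ := (1 + s⁻¹) / 2 with hε₂
  have hc1 : (ε₁ - 1 + e) * r < -1 := by
    rw [← lt_div_iff₀ hr0, neg_div, one_div, hrs]
    have h1 : ε₁ ≤ α / (4 * s) := min_le_left _ _
    have h2 : α / (4 * s) = α * s⁻¹ / 4 := by field_simp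
    have h3 : e = -(α * s⁻¹ / 2 - s⁻¹) := by rw [he]; field_simp; ring
    have h4 : 0 < α * s⁻¹ := by positivity
    rw [h3]
    linarith
  have hc2 : -1 < (ε₂ - 1) * r := by
    rw [← div_lt_iff₀ hr0, neg_div, one_div, hrs, hε₂]
    linarith
  obtain ⟨C, hC, hbound⟩ := lintegral_kernel_rpow_le (k := k) hr0 hc1 hc2
  refine ⟨ε₁, ε₂, C ^ (1 / r), by positivity, (min_le_right _ _).trans_lt (by norm_num),
    by positivity, by rw [hε₂]; linarith, by positivity, fun t g ht0 ht1 hg hg0 => ?_⟩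
  have hD : 0 < 1 - t := by linarith
  set K : ℝ → ℝ := fun y => min ((1 - t) ^ (-ε₁) * ((1 + t) / 2 - y) ^ (ε₁ - 1))
    ((1 - t) ^ (-ε₂) * ((1 + t) / 2 - y) ^ (ε₂ - 1)) with hK
  have hKm : Measurable K := by rw [hK]; fun_prop
  set F : ℝ → ℝ≥0∞ := fun y => ENNReal.ofReal (g y * ((1 - y) ^ (-e) * (1 - t) ^ (-k))) with hF
  set H : ℝ → ℝ≥0∞ := fun y => ENNReal.ofReal (K y * (1 - y) ^ e * (1 - t) ^ k) with hH
  have hFm : Measurable F := by rw [hF]; fun_prop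
  have hHm : Measurable H := by rw [hH]; fun_prop
  have hpos : ∀ y ∈ Set.Ioo 0 ((1 + t) / 2), 0 < 1 - y := fun y hy => by linarith [hy.2]
  calc _ = ∫⁻ y in Set.Ioo 0 ((1 + t) / 2), (F * H) y := by
        refine setLIntegral_congr_fun measurableSet_Ioo fun y hy => ?_
        have h1y := hpos y hy
        change ENNReal.ofReal (g y * K y) = F y * H y
        simp only [hF, hH]
        rw [← ENNReal.ofReal_mul (mul_nonneg (hg0 y) (by positivity))]
        congr 1
        generalize K y = κ
        rw [Real.rpow_neg h1y.le, Real.rpow_neg hD.le]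
        have e1 := (Real.rpow_pos_of_pos h1y e).ne'
        have e2 := (Real.rpow_pos_of_pos hD k).ne'
        field_simp
    _ ≤ (∫⁻ y in Set.Ioo 0 ((1 + t) / 2), F y ^ s) ^ (1 / s) *
        (∫⁻ y in Set.Ioo 0 ((1 + t) / 2), H y ^ r) ^ (1 / r) :=
        ENNReal.lintegral_mul_le_Lp_mul_Lq _ hconj hFm.aemeasurable hHm.aemeasurable
    _ ≤ (∫⁻ y in Set.Ioo 0 ((1 + t) / 2),
          ENNReal.ofReal (g y) ^ s * ENNReal.ofReal ((1 - y) ^ (α - 1)) *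
            ENNReal.ofReal (((1 - t) / (1 - y)) ^ (α / 2))) ^ (1 / s) *
        ENNReal.ofReal (C * (1 - t) ^ ((e + k - 1) * r + 1)) ^ (1 / r) := by
        gcongr ?_ ^ (1 / s) * ?_ ^ (1 / r)
        · refine le_of_eq (setLIntegral_congr_fun measurableSet_Ioo fun y hy => ?_)
          have h1y := hpos y hy
          simp only [hF]
          rw [mul_assoc, ← ENNReal.ofReal_mul (by positivity), ENNReal.ofReal_mul (hg0 y), ENNReal.mul_rpow_of_nonneg _ _ hs0.le,
            ENNReal.ofReal_rpow_of_nonneg (by positivity : 0 ≤ (1 - y) ^ (-e) * (1 - t) ^ (-k)) hs0.le]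
          congr 2
          rw [Real.mul_rpow (by positivity) (by positivity), ← Real.rpow_mul h1y.le,
            ← Real.rpow_mul hD.le, Real.div_rpow hD.le h1y.le,
            show -e * s = α - 1 - α / 2 by rw [he]; field_simp,
            show -k * s = α / 2 by rw [hk]; field_simp, Real.rpow_sub h1y]
          ring
        · exact hbound t ht0 ht1
    _ = _ := by
        rw [mul_comm, ENNReal.ofReal_rpow_of_nonneg (by positivity) (by positivity),
          Real.mul_rpow hC.le (by positivity), ← Real.rpow_mul hD.le]
        congr 4
        have h2 : ((e + k - 1) * r + 1) * (1 / r) = e + k - 1 + r⁻¹ := by field_simp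
        rw [h2, hrs, he, hk]
        field_simp
        ring

theorem exists_tail_bound_rpow {lam : ℕ → ℝ} (hlam : GeometricGrowth lam) (hmono : StrictMono lam)
    {Q : ℝ} (hQ : ∀ k, lam (k + 1) ≤ Q * lam k) {s α : ℝ} (hs : 1 < s) (hα : 0 < α) :
    ∃ (u : ℕ → ℝ) (C c : ℝ), GeometricGrowth u ∧ 0 < C ∧ 0 < c ∧ u 0 < lam 0 + 1 ∧
      ∀ (a : ℕ → ℂ) (n m : ℕ) (t : ℝ), 0 < t → t < 1 →
        ENNReal.ofReal ‖∑ j ∈ (Finset.range n).filter (fun j => u m < lam j + 1),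
          a j * ((t ^ lam j : ℝ) : ℂ)‖ ≤
        ENNReal.ofReal (C * Real.exp (-(c * u m * (1 - t))) * t ^ lam 0 * (1 - t) ^ (-(α / s))) *
          (∫⁻ y in Set.Ioo 0 ((1 + t) / 2), ENNReal.ofReal ‖muntzSum lam a n y‖ ^ s *
            ENNReal.ofReal ((1 - y) ^ (α - 1)) *
            ENNReal.ofReal (((1 - t) / (1 - y)) ^ (α / 2))) ^ (1 / s) := by
  obtain ⟨ε₁, ε₂, C₁, h1, h1', h2, h2', hC₁, hk⟩ := exists_holder_kernel hs hα
  obtain ⟨u, C, c, hu, hC, hc, hu0, hbound⟩ := exists_tail_bound hlam hmono hQ h1 h1' h2 h2'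
  refine ⟨u, C * C₁, c, hu, by positivity, hc, hu0, fun a n m t ht0 ht1 => ?_⟩
  have hD : 0 < 1 - t := by linarith
  refine (hbound a n m t ht0 ht1).trans ?_
  have h3 := hk t (fun y => ‖muntzSum lam a n y‖) ht0 ht1
    (continuous_muntzSum hlam.1 a n).norm.measurable fun y => norm_nonneg _
  calc _ ≤ _ := mul_le_mul_right h3 _
    _ = _ := by
      rw [← mul_assoc, ← ENNReal.ofReal_mul (by positivity)]
      congr 2
      ring

/-! ### Summation over annuli -/

theorem tsum_rpow_mul_rpow_le (A Y : ℕ → ℝ≥0∞) {β : ℝ} (h0 : 0 ≤ β) (h1 : β ≤ 1) :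
    ∑' k, A k ^ (1 - β) * Y k ^ β ≤ (∑' k, A k) ^ (1 - β) * (∑' k, Y k) ^ β := by
  have h := ENNReal.lintegral_mul_norm_pow_le (μ := Measure.count) (f := A) (g := Y)
    (measurable_of_countable A).aemeasurable (measurable_of_countable Y).aemeasurable
    (sub_nonneg.2 h1) h0 (sub_add_cancel 1 β)
  simpa only [lintegral_count] using h

/-- The `k`-th annulus `δ / L_{k+1} < 1 - t ≤ δ / L_k` (without the upper bound if `k = 0`). -/
def annulus (L : ℕ → ℝ) (δ : ℝ) (k : ℕ) : Set I :=
  {t | (0 < (t : ℝ) ∧ (t : ℝ) < 1) ∧ δ / L (k + 1) < 1 - (t : ℝ) ∧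
    (k = 0 ∨ 1 - (t : ℝ) ≤ δ / L k)}

theorem measurableSet_annulus (L : ℕ → ℝ) (δ : ℝ) (k : ℕ) : MeasurableSet (annulus L δ k) := by
  unfold annulus
  have h : Measurable fun t : I => (t : ℝ) := measurable_subtype_coe
  have h' : Measurable fun t : I => 1 - (t : ℝ) := measurable_const.sub h
  exact ((measurableSet_lt measurable_const h).inter (measurableSet_lt h measurable_const)).inter
    ((measurableSet_lt measurable_const h').inter
      ((MeasurableSet.const _).union (measurableSet_le h' measurable_const)))

theorem exists_mem_annulus {L : ℕ → ℝ} (hL : GeometricGrowth L) (δ : ℝ) {t : I}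
    (h0 : 0 < (t : ℝ)) (h1 : (t : ℝ) < 1) : ∃ k, t ∈ annulus L δ k := by
  classical
  have hD : 0 < 1 - (t : ℝ) := by linarith
  have hex : ∃ k, δ / L (k + 1) < 1 - (t : ℝ) := by
    obtain ⟨k, hk⟩ := ((tendsto_add_atTop_iff_nat 1).2 hL.tendsto_atTop |>.eventually_gt_atTop
      (δ / (1 - (t : ℝ)))).exists
    refine ⟨k, ?_⟩
    rw [div_lt_iff₀ (hL.1 _)]
    rwa [div_lt_iff₀ hD, mul_comm] at hk
  refine ⟨Nat.find hex, ⟨h0, h1⟩, Nat.find_spec hex, ?_⟩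
  rcases Nat.eq_zero_or_pos (Nat.find hex) with h | h
  · exact Or.inl h
  · right
    have := Nat.find_min hex (Nat.sub_lt h one_pos)
    rwa [show Nat.find hex - 1 + 1 = Nat.find hex by omega, not_lt] at this

theorem lintegral_le_tsum_annulus {L : ℕ → ℝ} (hL : GeometricGrowth L) (δ : ℝ) (μ : Measure I)
    (hμ : μ {1} = 0) (G : I → ℝ≥0∞) (hG : G 0 = 0) :
    ∫⁻ t, G t ∂μ ≤ ∑' k, ∫⁻ t in annulus L δ k, G t ∂μ := by
  have hcover : (Set.univ : Set I) ⊆ (⋃ k, annulus L δ k) ∪ ({0} ∪ {1}) := by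
    intro t _
    by_cases h0 : t = 0
    · exact Or.inr (Or.inl h0)
    by_cases h1 : t = 1
    · exact Or.inr (Or.inr h1)
    left
    refine Set.mem_iUnion.2 (exists_mem_annulus hL δ ?_ ?_)
    · exact unitInterval.pos_iff_ne_zero.2 h0
    · exact unitInterval.lt_one_iff_ne_one.2 h1
  calc ∫⁻ t, G t ∂μ = ∫⁻ t in Set.univ, G t ∂μ := by rw [Measure.restrict_univ]
    _ ≤ ∫⁻ t in (⋃ k, annulus L δ k) ∪ ({0} ∪ {1}), G t ∂μ := lintegral_mono_set hcover
    _ ≤ ∫⁻ t in ⋃ k, annulus L δ k, G t ∂μ + (∫⁻ t in {0}, G t ∂μ + ∫⁻ t in {1}, G t ∂μ) :=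
        (lintegral_union_le _ _ _).trans (add_le_add_right (lintegral_union_le _ _ _) _)
    _ = ∫⁻ t in ⋃ k, annulus L δ k, G t ∂μ := by
        rw [lintegral_singleton, hG, zero_mul, setLIntegral_measure_zero _ _ hμ, add_zero, add_zero]
    _ ≤ _ := lintegral_iUnion_le _ _

/-- The general term of the series that characterises the embedding. -/
noncomputable def weightedMoment (L : ℕ → ℝ) (α β p : ℝ) (μ : Measure I) (k : ℕ) : ℝ≥0∞ :=
  ENNReal.ofReal (L k) ^ (α * β / (1 - β)) *
    (∫⁻ t : I, ENNReal.ofReal ((t : ℝ) ^ (p * L k)) ∂μ) ^ (1 / (1 - β))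

/-- All monomials equal 1 at t = 1, so an atom there would bound the terms of the series below by a
positive constant. -/
theorem measure_singleton_one_eq_zero {L : ℕ → ℝ} (hpos : ∀ k, 0 < L k) (hmono : StrictMono L)
    {α β p : ℝ} (hα : 0 < α) (hβ0 : 0 < β) (hβ1 : β < 1) {μ : Measure I}
    (h : ∑' k, weightedMoment L α β p μ k < ∞) : μ {1} = 0 := by
  by_contra hne
  have hb : 0 < 1 - β := by linarith
  have hge : ∀ k, ENNReal.ofReal (L 0) ^ (α * β / (1 - β)) * μ {1} ^ (1 / (1 - β)) ≤
      weightedMoment L α β p μ k := by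
    intro k
    unfold weightedMoment
    gcongr
    · exact hmono.monotone (Nat.zero_le k)
    · calc μ {1} = ∫⁻ t in ({1} : Set I), ENNReal.ofReal ((t : ℝ) ^ (p * L k)) ∂μ := by
            rw [lintegral_singleton]
            simp
        _ ≤ _ := setLIntegral_le_lintegral _ _
  have hne' : ENNReal.ofReal (L 0) ^ (α * β / (1 - β)) * μ {1} ^ (1 / (1 - β)) ≠ 0 := by
    refine mul_ne_zero ?_ ?_
    · rw [Ne, ENNReal.rpow_eq_zero_iff_of_pos (by positivity)]
      simpa using hpos 0
    · rwa [Ne, ENNReal.rpow_eq_zero_iff_of_pos (by positivity)]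
  have := ENNReal.tsum_le_tsum hge
  rw [ENNReal.tsum_const_eq_top_of_ne_zero hne', top_le_iff] at this
  exact h.ne this

/-- Bounds the total weight that a fixed point y, with x = 1 - y, receives from all annuli: only L k
≥ η/x occur, and there the terms decay geometrically. -/
theorem tsum_weight_le {L : ℕ → ℝ} (hL : GeometricGrowth L) {η M κ : ℝ} (hη : 0 < η) (hM : 0 < M)
    (hκ : 0 < κ) :
    ∃ C : ℝ, 0 < C ∧ ∀ x : ℝ, 0 < x →
      ∑' k, (if η / L k ≤ x then ENNReal.ofReal ((M / (L k * x)) ^ κ) else 0) ≤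
        ENNReal.ofReal C := by
  obtain ⟨C, hC, hsum⟩ := hL.sum_min_rpow_le hκ
  refine ⟨(M / η) ^ κ * C, by positivity, fun x hx => ?_⟩
  rw [ENNReal.tsum_eq_iSup_sum]
  refine iSup_le fun S => ?_
  calc _ ≤ ∑ k ∈ S, ENNReal.ofReal ((M / η) ^ κ * min (L k / (η / x)) (η / x / L k) ^ κ) := by
        refine Finset.sum_le_sum fun k _ => ?_
        have hLk := hL.1 k
        split_ifs with h
        · have h1 : η / x ≤ L k := by
            rw [div_le_iff₀ hLk] at h
            rw [div_le_iff₀ hx]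
            linarith
          have hx' : 0 < η / x := by positivity
          rw [min_eq_right (((div_le_one hLk).2 h1).trans ((one_le_div hx').2 h1)),
            ← Real.mul_rpow (by positivity) (by positivity)]
          apply le_of_eq
          congr 2
          field_simp
        · exact zero_le
    _ = ENNReal.ofReal ((M / η) ^ κ * ∑ k ∈ S, min (L k / (η / x)) (η / x / L k) ^ κ) := by
        rw [Finset.mul_sum, ENNReal.ofReal_sum_of_nonneg]
        intro k _
        have := hL.1 k
        positivity
    _ ≤ _ := by
        apply ENNReal.ofReal_le_ofReal
        gcongr
        exact hsum _ (by positivity) S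

/-- For k ≥ 1, L k (1 - t) ≤ 1/2 and 1 - t ≤ 1/2 on the annulus, so t ≥ exp(-2(1 - t)) gives t^{L k}
≥ exp(-1). The minimum with L 0 in the width ensures 1 - t ≤ 1/2. -/
theorem rpow_le_exp_mul_rpow_of_mem_annulus {L : ℕ → ℝ} (hpos : ∀ k, 0 < L k)
    (hmono : StrictMono L) {k : ℕ} {t : I} (ht : t ∈ annulus L (min 1 (L 0) / 2) k) :
    (t : ℝ) ^ L 0 ≤ Real.exp 1 * (t : ℝ) ^ L k := by
  obtain ⟨⟨h0, h1⟩, -, h3⟩ := ht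
  rcases h3 with rfl | h3
  · have := Real.one_le_exp zero_le_one
    have h4 : 0 ≤ (t : ℝ) ^ L 0 := by positivity
    nlinarith
  · have hLk := hpos k
    have hle : L 0 ≤ L k := hmono.monotone (Nat.zero_le k)
    rw [le_div_iff₀ hLk] at h3
    have hm1 := min_le_left 1 (L 0)
    have hm2 := min_le_right 1 (L 0)
    have hD : 1 - (t : ℝ) ≤ 1 / 2 := by
      by_contra hcon
      push Not at hcon
      nlinarith
    have hexp : Real.exp (-(2 * (1 - (t : ℝ)))) ≤ t := by
      rw [Real.exp_neg]
      have h5 := Real.add_one_le_exp (2 * (1 - (t : ℝ)))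
      rw [inv_le_iff_one_le_mul₀ (Real.exp_pos _)]
      nlinarith
    calc (t : ℝ) ^ L 0 ≤ 1 := Real.rpow_le_one h0.le h1.le (hpos 0).le
      _ = Real.exp 1 * Real.exp (-1) := by rw [← Real.exp_add]; simp
      _ ≤ Real.exp 1 * (Real.exp (-(2 * (1 - (t : ℝ))))) ^ L k := by
          rw [← Real.exp_mul]
          gcongr
          nlinarith
      _ ≤ _ := by gcongr

/-- On the k-th annulus 1 - t is comparable to 1/L k, so the p-th power of the pointwise bound
becomes L_k^{αβ} t^{p L_k} Y_k^β times an exponential, where Y_k is a weighted integral of |f|^s.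
Integration in μ gives the (1 - β)-th power of the weighted moment times Y_k^β; Hölder for series
and `tsum_weight_le`, applied to ∑ Y_k, conclude. -/
theorem exists_tail_lintegral_bound {lam L : ℕ → ℝ} (hlam : GeometricGrowth lam)
    (hmono : StrictMono lam) {Q : ℝ} (hQ : ∀ k, lam (k + 1) ≤ Q * lam k)
    (hL : GeometricGrowth L) (hLmono : StrictMono L) (hL0 : L 0 = lam 0) {Q' : ℝ}
    (hQ' : ∀ k, L (k + 1) ≤ Q' * L k) {α β p : ℝ} (hα : 0 < α) (hβ0 : 0 < β) (hβ1 : β < 1)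
    (hp : 1 ≤ p) {μ : Measure I} (hμ : μ {1} = 0) :
    ∃ (u : ℕ → ℝ) (C c : ℝ), GeometricGrowth u ∧ 0 < C ∧ 0 < c ∧ u 0 < lam 0 + 1 ∧
      ∀ (a : ℕ → ℂ) (n m : ℕ),
        ∫⁻ t : I, ENNReal.ofReal ‖∑ j ∈ (Finset.range n).filter (fun j => u m < lam j + 1),
          a j * (((t : ℝ) ^ lam j : ℝ) : ℂ)‖ ^ p ∂μ ≤
        ENNReal.ofReal C * (∑' k, ENNReal.ofReal (Real.exp (-(c * u m / L k))) *
          weightedMoment L α β p μ k) ^ (1 - β) *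
          (∫⁻ y in Set.Ioo (0 : ℝ) 1, ENNReal.ofReal ‖muntzSum lam a n y‖ ^ (p / β) *
            ENNReal.ofReal ((1 - y) ^ (α - 1))) ^ β := by
  have hb : 0 < 1 - β := by linarith
  have hp0 : 0 < p := by linarith
  have hs : 1 < p / β := by rw [lt_div_iff₀ hβ0]; linarith
  set s := p / β with hsdef
  have hs0 : 0 < s := by linarith
  obtain ⟨u, C, c, hu, hC, hc, hu0, hbound⟩ := exists_tail_bound_rpow hlam hmono hQ hs hα
  have hL0pos := hL.1 0
  have hQ'0 : 0 < Q' := pos_of_mul_pos_left ((hL.1 1).trans_le (hQ' 0)) hL0pos.le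
  set δ := min 1 (L 0) / 2 with hδ
  have hδ0 : 0 < δ := by positivity
  have hδ1 : δ ≤ 1 / 2 := by rw [hδ]; linarith [min_le_left 1 (L 0)]
  -- The annulus k = 0 has only the trivial upper bound 1 - t ≤ 1, which is at most M / L 0.
  set M := max 1 (L 0) with hM
  have hM0 : 0 < M := by positivity
  -- For y < τ, 1 - y > (1 - t)/2 ≥ η / L k, where the annulus gives 1 - t ≥ δ/(Q' L k).
  set η := δ / (2 * Q') with hη
  have hη0 : 0 < η := by positivity
  obtain ⟨C₅, hC₅, hw⟩ := tsum_weight_le hL hη0 hM0 (half_pos hα)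
  set C₄ := C * Real.exp 1 * (δ / Q') ^ (-(α / s)) with hC₄
  have hC₄0 : 0 < C₄ := by positivity
  -- The rate is divided by 1 - β because the exponential ends up inside a (1 - β)-th power.
  refine ⟨u, C₄ ^ p * C₅ ^ β, p * (c * (δ / Q')) / (1 - β), hu, by positivity, by positivity, hu0,
    fun a n m => ?_⟩
  set g : ℝ → ℝ≥0∞ := fun y => ENNReal.ofReal ‖muntzSum lam a n y‖ ^ s *
    ENNReal.ofReal ((1 - y) ^ (α - 1)) with hg
  have hgm : Measurable g := by
    have := (continuous_muntzSum hlam.1 a n).norm.measurable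
    rw [hg]; fun_prop
  set w : ℕ → ℝ → ℝ≥0∞ := fun k y => if η / L k ≤ 1 - y then
    ENNReal.ofReal ((M / (L k * (1 - y))) ^ (α / 2)) else 0 with hwdef
  have hwm : ∀ k, Measurable (w k) := fun k => by
    rw [hwdef]
    refine Measurable.ite (measurableSet_le measurable_const (by fun_prop)) (by fun_prop)
      measurable_const
  set Y : ℕ → ℝ≥0∞ := fun k => ∫⁻ y in Set.Ioo (0 : ℝ) 1, g y * w k y with hY
  have hYsum : ∑' k, Y k ≤ ENNReal.ofReal C₅ * ∫⁻ y in Set.Ioo (0 : ℝ) 1, g y := by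
    have hswap : ∑' k, Y k = ∫⁻ y in Set.Ioo (0 : ℝ) 1, ∑' k, g y * w k y :=
      (lintegral_tsum fun k => (hgm.mul (hwm k)).aemeasurable).symm
    rw [hswap, ← lintegral_const_mul' _ _ ENNReal.ofReal_ne_top]
    refine setLIntegral_mono' measurableSet_Ioo fun y hy => ?_
    rw [ENNReal.tsum_mul_left, mul_comm]
    gcongr
    exact hw _ (by linarith [hy.2])
  have hpiece : ∀ k, ∀ t ∈ annulus L δ k,
      ENNReal.ofReal ‖∑ j ∈ (Finset.range n).filter (fun j => u m < lam j + 1),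
          a j * (((t : ℝ) ^ lam j : ℝ) : ℂ)‖ ^ p ≤
      ENNReal.ofReal (C₄ * Real.exp (-(c * (δ / Q') * u m / L k)) * L k ^ (α / s)) ^ p *
        Y k ^ β * ENNReal.ofReal ((t : ℝ) ^ (p * L k)) := by
    intro k t ht
    have htc := rpow_le_exp_mul_rpow_of_mem_annulus hL.1 hLmono ht
    obtain ⟨⟨ht0, ht1⟩, hlow, hup⟩ := ht
    have hLk := hL.1 k
    have hum := hu.1 m
    have hD : 0 < 1 - (t : ℝ) := by linarith
    have hlow' : δ / Q' / L k ≤ 1 - (t : ℝ) := by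
      refine le_trans ?_ hlow.le
      rw [div_div]
      have := hL.1 (k + 1)
      gcongr
      exact hQ' k
    have hup' : 1 - (t : ℝ) ≤ M / L k := by
      rcases hup with rfl | hup
      · refine le_trans (by linarith : 1 - (t : ℝ) ≤ 1) ((one_le_div hLk).2 (le_max_right _ _))
      · refine hup.trans ?_
        gcongr
        linarith [le_max_left 1 (L 0)]
    have hZ : ∫⁻ y in Set.Ioo 0 ((1 + (t : ℝ)) / 2), ENNReal.ofReal ‖muntzSum lam a n y‖ ^ s *
            ENNReal.ofReal ((1 - y) ^ (α - 1)) *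
            ENNReal.ofReal (((1 - (t : ℝ)) / (1 - y)) ^ (α / 2)) ≤ Y k := by
      calc _ ≤ ∫⁻ y in Set.Ioo 0 ((1 + (t : ℝ)) / 2), g y * w k y := by
            refine setLIntegral_mono' measurableSet_Ioo fun y hy => ?_
            have h1y : (1 - (t : ℝ)) / 2 < 1 - y := by linarith [hy.2]
            have h1y' : 0 < 1 - y := by linarith
            refine mul_le_mul_right ?_ _
            simp only [hwdef]
            rw [if_pos]
            · apply ENNReal.ofReal_le_ofReal
              rw [← div_div]
              gcongr
            · have : η / L k = δ / Q' / L k / 2 := by rw [hη]; field_simp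
              rw [this]
              linarith
        _ ≤ _ := lintegral_mono_set (Set.Ioo_subset_Ioo_right (by linarith))
    have hreal : C * Real.exp (-(c * u m * (1 - (t : ℝ)))) * (t : ℝ) ^ lam 0 *
        (1 - (t : ℝ)) ^ (-(α / s)) ≤
        C₄ * Real.exp (-(c * (δ / Q') * u m / L k)) * L k ^ (α / s) * (t : ℝ) ^ L k := by
      have e1 : Real.exp (-(c * u m * (1 - (t : ℝ)))) ≤
          Real.exp (-(c * (δ / Q') * u m / L k)) := by
        apply Real.exp_le_exp.2
        have := mul_le_mul_of_nonneg_left hlow' (by positivity : 0 ≤ c * u m)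
        have e : c * u m * (δ / Q' / L k) = c * (δ / Q') * u m / L k := by field_simp
        linarith
      have e2 : (1 - (t : ℝ)) ^ (-(α / s)) ≤ (δ / Q') ^ (-(α / s)) * L k ^ (α / s) := by
        calc (1 - (t : ℝ)) ^ (-(α / s)) ≤ (δ / Q' / L k) ^ (-(α / s)) :=
              Real.rpow_le_rpow_of_nonpos (by positivity) hlow' (by
                have : 0 < α / s := by positivity
                linarith)
          _ = _ := by
              rw [Real.div_rpow (by positivity) hLk.le, Real.rpow_neg hLk.le, div_inv_eq_mul]
      rw [hL0] at htc
      calc _ ≤ C * Real.exp (-(c * (δ / Q') * u m / L k)) * (Real.exp 1 * (t : ℝ) ^ L k) *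
            ((δ / Q') ^ (-(α / s)) * L k ^ (α / s)) := by gcongr
        _ = _ := by rw [hC₄]; ring
    calc _ ≤ (ENNReal.ofReal (C₄ * Real.exp (-(c * (δ / Q') * u m / L k)) * L k ^ (α / s) *
          (t : ℝ) ^ L k) * Y k ^ (1 / s)) ^ p := by
          gcongr
          refine (hbound a n m t ht0 ht1).trans ?_
          gcongr
      _ = _ := by
          rw [ENNReal.ofReal_mul (by positivity), ENNReal.mul_rpow_of_nonneg _ _ hp0.le,
            ENNReal.mul_rpow_of_nonneg _ _ hp0.le, ← ENNReal.rpow_mul,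
            ENNReal.ofReal_rpow_of_nonneg (by positivity : 0 ≤ (t : ℝ) ^ L k) hp0.le,
            ← Real.rpow_mul ht0.le, mul_comm (L k) p,
            show 1 / s * p = β by rw [hsdef]; field_simp]
          ring
  have hterm : ∀ k, ∫⁻ t in annulus L δ k,
      ENNReal.ofReal ‖∑ j ∈ (Finset.range n).filter (fun j => u m < lam j + 1),
          a j * (((t : ℝ) ^ lam j : ℝ) : ℂ)‖ ^ p ∂μ ≤
      ENNReal.ofReal (C₄ ^ p) * ((ENNReal.ofReal (Real.exp
        (-(p * (c * (δ / Q')) / (1 - β) * u m / L k))) * weightedMoment L α β p μ k) ^ (1 - β) *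
        Y k ^ β) := by
    intro k
    have hLk := hL.1 k
    calc _ ≤ ∫⁻ t in annulus L δ k,
          ENNReal.ofReal (C₄ * Real.exp (-(c * (δ / Q') * u m / L k)) * L k ^ (α / s)) ^ p *
          Y k ^ β * ENNReal.ofReal ((t : ℝ) ^ (p * L k)) ∂μ :=
          setLIntegral_mono' (measurableSet_annulus L δ k) (hpiece k)
      _ ≤ ∫⁻ t : I,
          ENNReal.ofReal (C₄ * Real.exp (-(c * (δ / Q') * u m / L k)) * L k ^ (α / s)) ^ p *
          Y k ^ β * ENNReal.ofReal ((t : ℝ) ^ (p * L k)) ∂μ := setLIntegral_le_lintegral _ _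
      _ = ENNReal.ofReal (C₄ * Real.exp (-(c * (δ / Q') * u m / L k)) * L k ^ (α / s)) ^ p *
          Y k ^ β * ∫⁻ t : I, ENNReal.ofReal ((t : ℝ) ^ (p * L k)) ∂μ := by
          rw [lintegral_const_mul]
          have : Measurable fun t : I => (t : ℝ) := measurable_subtype_coe
          fun_prop
      _ = _ := by
          unfold weightedMoment
          rw [ENNReal.mul_rpow_of_nonneg _ _ hb.le, ENNReal.mul_rpow_of_nonneg _ _ hb.le,
            ← ENNReal.rpow_mul, ← ENNReal.rpow_mul, one_div_mul_cancel hb.ne', ENNReal.rpow_one,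
            div_mul_cancel₀ _ hb.ne',
            ENNReal.ofReal_rpow_of_nonneg (Real.exp_pos _).le hb.le, ← Real.exp_mul,
            ENNReal.ofReal_rpow_of_nonneg (by positivity) hp0.le,
            Real.mul_rpow (by positivity) (by positivity), Real.mul_rpow hC₄0.le (by positivity),
            ← Real.exp_mul, ← Real.rpow_mul hLk.le, ENNReal.ofReal_mul (by positivity),
            ENNReal.ofReal_mul (by positivity), ENNReal.ofReal_rpow_of_pos hLk,
            show α / s * p = α * β by rw [hsdef]; field_simp,
            show -(c * (δ / Q') * u m / L k) * p =
              -(p * (c * (δ / Q')) / (1 - β) * u m / L k) * (1 - β) by field_simp]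
          ring
  calc _ ≤ ∑' k, ∫⁻ t in annulus L δ k,
      ENNReal.ofReal ‖∑ j ∈ (Finset.range n).filter (fun j => u m < lam j + 1),
          a j * (((t : ℝ) ^ lam j : ℝ) : ℂ)‖ ^ p ∂μ := by
        refine lintegral_le_tsum_annulus hL δ μ hμ _ ?_
        rw [Finset.sum_eq_zero, norm_zero, ENNReal.ofReal_zero, ENNReal.zero_rpow_of_pos hp0]
        intro j _
        simp [Real.zero_rpow (hlam.1 j).ne']
    _ ≤ ∑' k, ENNReal.ofReal (C₄ ^ p) * ((ENNReal.ofReal (Real.exp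
        (-(p * (c * (δ / Q')) / (1 - β) * u m / L k))) * weightedMoment L α β p μ k) ^ (1 - β) *
        Y k ^ β) := ENNReal.tsum_le_tsum hterm
    _ ≤ ENNReal.ofReal (C₄ ^ p) * ((∑' k, ENNReal.ofReal (Real.exp
        (-(p * (c * (δ / Q')) / (1 - β) * u m / L k))) * weightedMoment L α β p μ k) ^ (1 - β) *
        (ENNReal.ofReal C₅ * ∫⁻ y in Set.Ioo (0 : ℝ) 1, g y) ^ β) := by
        rw [ENNReal.tsum_mul_left]
        gcongr
        refine (tsum_rpow_mul_rpow_le _ _ hβ0.le hβ1.le).trans ?_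
        gcongr
    _ = _ := by
        rw [ENNReal.mul_rpow_of_nonneg _ _ hβ0.le, ENNReal.ofReal_rpow_of_pos hC₅,
          ENNReal.ofReal_mul (by positivity)]
        ring

/-! ### Growth of quasi-lacunary sequences -/

/-- With γ = q^{1/N}, every N steps gain the factor γ^N = q; the initial indices and the remainder
modulo N are absorbed in the constant γ^{k₀ + N}. -/
theorem geometricGrowth_of_eventually {z : ℕ → ℝ} (hpos : ∀ k, 0 < z k) (hmono : Monotone z)
    {q : ℝ} (hq : 1 < q) {N : ℕ} (hN : 0 < N) (h : ∀ᶠ i in atTop, q * z i ≤ z (i + N)) :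
    GeometricGrowth z := by
  obtain ⟨k₀, hk₀⟩ := eventually_atTop.1 h
  have hq0 : 0 < q := by linarith
  set γ : ℝ := q ^ ((N : ℝ)⁻¹) with hγdef
  have hγ : 1 < γ := Real.one_lt_rpow hq (by positivity)
  have hγ0 : 0 < γ := by linarith
  have hγN : γ ^ N = q := Real.rpow_inv_natCast_pow hq0.le hN.ne'
  have key : ∀ j i, γ ^ j * z i ≤ γ ^ (k₀ + N) * z (i + j) := by
    intro j
    induction j using Nat.strong_induction_on with
    | _ j ih =>
      intro i
      have hz := (hpos i).le
      by_cases hj : j ≤ k₀ + N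
      · gcongr
        · exact hγ.le
        · exact hmono (Nat.le_add_right i j)
      · obtain ⟨l, rfl⟩ : ∃ l, j = l + N := ⟨j - N, by omega⟩
        calc γ ^ (l + N) * z i = q * (γ ^ l * z i) := by rw [pow_add, hγN]; ring
          _ ≤ q * (γ ^ (k₀ + N) * z (i + l)) := by
              exact mul_le_mul_of_nonneg_left (ih l (by omega) i) hq0.le
          _ = γ ^ (k₀ + N) * (q * z (i + l)) := by ring
          _ ≤ γ ^ (k₀ + N) * z (i + (l + N)) := by
              rw [← add_assoc]
              exact mul_le_mul_of_nonneg_left (hk₀ (i + l) (by omega)) (by positivity)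
  refine ⟨hpos, (γ ^ (k₀ + N))⁻¹, γ, by positivity, hγ, fun i j => ?_⟩
  rw [mul_assoc, inv_mul_le_iff₀ (by positivity)]
  exact key j i

theorem exists_index_block {n : ℕ → ℕ} (h0 : n 0 = 0) (hn : StrictMono n) (i : ℕ) :
    ∃ k, n k ≤ i ∧ i < n (k + 1) := by
  obtain ⟨k, h1, h2⟩ := hn.exists_between_of_tendsto_atTop hn.tendsto_atTop
    (x := i + 1) (by omega)
  exact ⟨k, by omega, by omega⟩

variable {lam : ℕ → ℝ} {n : ℕ → ℕ}

theorem IsQuasiLacunary.geometricGrowth_comp (h : IsQuasiLacunary lam n) :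
    GeometricGrowth fun k => lam (n k) := by
  obtain ⟨q, hq, hr⟩ := h.ratio_gt
  refine geometricGrowth_of_eventually (fun k => h.pos _)
    (h.strictMono.comp h.index_strictMono).monotone hq one_pos ?_
  filter_upwards [hr] with k hk
  exact ((lt_div_iff₀ (h.pos _)).1 hk).le

theorem IsQuasiLacunary.exists_index_sub_le (h : IsQuasiLacunary lam n) :
    ∃ N : ℕ, 1 ≤ N ∧ ∀ k, n (k + 1) ≤ n k + N := by
  obtain ⟨N, hN, hcard⟩ := h.card_block_le
  refine ⟨N, hN, fun k => ?_⟩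
  have := hcard k
  rw [block, Finset.card_image_of_injective _ h.strictMono.injective, Nat.card_Ioc] at this
  omega

theorem IsQuasiLacunary.geometricGrowth (h : IsQuasiLacunary lam n) : GeometricGrowth lam := by
  obtain ⟨q, hq, hr⟩ := h.ratio_gt
  obtain ⟨N, hN, hindex⟩ := h.exists_index_sub_le
  -- An index inside a block may have to reach the end of that block and then cross the next one
  -- before gaining q, hence 2N steps.
  refine geometricGrowth_of_eventually h.pos h.strictMono.monotone hq (N := 2 * N) (by omega) ?_
  obtain ⟨k₀, hk₀⟩ := eventually_atTop.1 hr
  filter_upwards [eventually_ge_atTop (n k₀)] with i hi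
  obtain ⟨k, h1, h2⟩ := exists_index_block h.index_zero h.index_strictMono i
  have hk : k₀ < k + 1 := h.index_strictMono.lt_iff_lt.1 (hi.trans_lt h2)
  have h3 := hk₀ (k + 1) hk.le
  rw [lt_div_iff₀ (h.pos _)] at h3
  have h4 := hindex k
  have h5 := hindex (k + 1)
  calc q * lam i ≤ q * lam (n (k + 1)) := by
        gcongr
        exact h.strictMono.monotone h2.le
    _ ≤ lam (n (k + 1 + 1)) := h3.le
    _ ≤ _ := h.strictMono.monotone (by omega)

theorem IsQuasiLacunary.exists_ratio_le (h : IsQuasiLacunary lam n) (hs : IsSubgeometric lam n) :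
    ∃ Q : ℝ, ∀ k, lam (n (k + 1)) ≤ Q * lam (n k) := by
  obtain ⟨q', -, hr⟩ := hs
  have hb : IsBoundedUnder (· ≤ ·) atTop fun k => lam (n (k + 1)) / lam (n k) := ⟨q', hr⟩
  obtain ⟨Q, hQ⟩ := hb.bddAbove_range
  exact ⟨Q, fun k => (div_le_iff₀ (h.pos _)).1 (hQ (Set.mem_range_self k))⟩

theorem IsQuasiLacunary.succ_le_mul (h : IsQuasiLacunary lam n) {Q : ℝ}
    (hQ : ∀ k, lam (n (k + 1)) ≤ Q * lam (n k)) (i : ℕ) : lam (i + 1) ≤ Q * lam i := by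
  obtain ⟨k, h1, h2⟩ := exists_index_block h.index_zero h.index_strictMono i
  have hQ0 : 0 < Q := pos_of_mul_pos_left ((h.pos _).trans_le (hQ 0)) (h.pos _).le
  calc lam (i + 1) ≤ lam (n (k + 1)) := h.strictMono.monotone h2
    _ ≤ Q * lam (n k) := hQ k
    _ ≤ _ := by
        gcongr
        exact h.strictMono.monotone h1

/-! ### Necessity: testing on positive combinations -/

theorem lintegral_rpow_mul_one_sub_rpow_le {u a : ℝ} (hu : 0 < u) (ha : 0 < a) :
    ∫⁻ y in Set.Ioo (0 : ℝ) 1, ENNReal.ofReal (y ^ u * (1 - y) ^ (a - 1)) ≤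
      ENNReal.ofReal (Real.Gamma a * u ^ (-a)) := by
  have hval := Real.integral_rpow_mul_exp_neg_mul_Ioi ha hu
  have hΓ := Real.Gamma_pos_of_pos ha
  have hint : IntegrableOn (fun v : ℝ => v ^ (a - 1) * Real.exp (-(u * v))) (Set.Ioi 0) := by
    refine Integrable.of_integral_ne_zero ?_
    rw [hval]
    positivity
  set F : ℝ → ℝ≥0∞ := (Set.Ioi (0 : ℝ)).indicator
    fun v => ENNReal.ofReal (v ^ (a - 1) * Real.exp (-(u * v))) with hF
  calc _ ≤ ∫⁻ y in Set.Ioo (0 : ℝ) 1, F (1 - y) := by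
        refine setLIntegral_mono' measurableSet_Ioo fun y hy => ?_
        rw [hF, Set.indicator_of_mem (by simpa using hy.2)]
        apply ENNReal.ofReal_le_ofReal
        rw [mul_comm]
        gcongr
        · exact Real.rpow_nonneg (by linarith [hy.2]) _
        · exact rpow_le_exp_neg_mul_one_sub hy.1.le hu
    _ ≤ ∫⁻ y, F (1 - y) := setLIntegral_le_lintegral _ _
    _ = ∫⁻ v in Set.Ioi 0, ENNReal.ofReal (v ^ (a - 1) * Real.exp (-(u * v))) := by
        rw [lintegral_sub_left_eq_self F 1, hF, lintegral_indicator measurableSet_Ioi]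
    _ = _ := by
        rw [← ofReal_integral_eq_lintegral_ofReal hint
          ((ae_restrict_iff' measurableSet_Ioi).2 (Eventually.of_forall fun v hv =>
            mul_nonneg (Real.rpow_nonneg (le_of_lt hv) _) (Real.exp_pos _).le)), hval,
          one_div, Real.inv_rpow hu.le, Real.rpow_neg hu.le, mul_comm]

/-- Convexity of x ↦ x^s with weights L_k^θ y^{L_k}, whose total mass is at most C (1 - y)^{-θ} by
geometric growth. -/
theorem exists_sum_rpow_le {L : ℕ → ℝ} (hL : GeometricGrowth L) {s θ : ℝ} (hs : 1 < s)
    (hθ : 0 < θ) :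
    ∃ C : ℝ, 0 < C ∧ ∀ (S : Finset ℕ) (c : ℕ → ℝ), (∀ k, 0 ≤ c k) → ∀ y : ℝ, 0 < y → y < 1 →
      (∑ k ∈ S, c k * y ^ L k) ^ s ≤
        C * (1 - y) ^ (-(θ * (s - 1))) * ∑ k ∈ S, c k ^ s * L k ^ (-(θ * (s - 1))) * y ^ L k := by
  obtain ⟨C, hC, hsum⟩ := hL.sum_rpow_mul_exp_le hθ
  have hs0 : 0 < s := by linarith
  refine ⟨C ^ (s - 1), by positivity, fun S c hc y hy0 hy1 => ?_⟩
  have hD : 0 < 1 - y := by linarith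
  have hpos := hL.1
  set w : ℕ → ℝ := fun k => L k ^ θ * y ^ L k with hw
  have hw0 : ∀ k, 0 ≤ w k := fun k => by have := hpos k; positivity
  have hA0 : 0 ≤ ∑ k ∈ S, w k := Finset.sum_nonneg fun k _ => hw0 k
  have h := Real.inner_le_weight_mul_Lp_of_nonneg S hs.le w (fun k => c k * L k ^ (-θ)) hw0
    fun k => mul_nonneg (hc k) (Real.rpow_nonneg (hpos k).le _)
  have hA : ∑ k ∈ S, w k ≤ C * (1 - y) ^ (-θ) := by
    refine le_trans (Finset.sum_le_sum fun k _ => ?_) (hsum (1 - y) hD S)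
    have := hpos k
    simp only [hw]
    gcongr
    exact rpow_le_exp_neg_mul_one_sub hy0.le this
  have e1 : ∑ k ∈ S, w k * (c k * L k ^ (-θ)) = ∑ k ∈ S, c k * y ^ L k := by
    refine Finset.sum_congr rfl fun k _ => ?_
    have := (Real.rpow_pos_of_pos (hpos k) θ).ne'
    simp only [hw]
    rw [Real.rpow_neg (hpos k).le]
    field_simp
  have e2 : ∑ k ∈ S, w k * (c k * L k ^ (-θ)) ^ s =
      ∑ k ∈ S, c k ^ s * L k ^ (-(θ * (s - 1))) * y ^ L k := by
    refine Finset.sum_congr rfl fun k _ => ?_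
    have hk := hpos k
    simp only [hw]
    rw [Real.mul_rpow (hc k) (by positivity), ← Real.rpow_mul hk.le,
      show -(θ * (s - 1)) = θ + -θ * s by ring, Real.rpow_add hk]
    ring
  rw [e1, e2] at h
  set B := ∑ k ∈ S, c k ^ s * L k ^ (-(θ * (s - 1))) * y ^ L k with hB
  have hB0 : 0 ≤ B := Finset.sum_nonneg fun k _ => by
    have := hpos k
    have := hc k
    positivity
  calc _ ≤ ((∑ k ∈ S, w k) ^ (1 - s⁻¹) * B ^ s⁻¹) ^ s := by
        refine Real.rpow_le_rpow (Finset.sum_nonneg fun k _ => ?_) h hs0.le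
        exact mul_nonneg (hc k) (by positivity)
    _ = (∑ k ∈ S, w k) ^ (s - 1) * B := by
        rw [Real.mul_rpow (by positivity) (by positivity), ← Real.rpow_mul hA0,
          ← Real.rpow_mul hB0, inv_mul_cancel₀ hs0.ne', Real.rpow_one, sub_mul, one_mul,
          inv_mul_cancel₀ hs0.ne']
    _ ≤ (C * (1 - y) ^ (-θ)) ^ (s - 1) * B := by
        gcongr
    _ = _ := by
        rw [Real.mul_rpow hC.le (by positivity), ← Real.rpow_mul hD.le, neg_mul]

/-- With θ(s - 1) = α/2, convexity produces L_k^{-α/2} and the remaining integral of y^{L_k} (1 -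
y)^{α/2 - 1} produces another L_k^{-α/2}. -/
theorem exists_lintegral_sum_rpow_le {L : ℕ → ℝ} (hL : GeometricGrowth L) {s α : ℝ} (hs : 1 < s)
    (hα : 0 < α) :
    ∃ C : ℝ, 0 < C ∧ ∀ (S : Finset ℕ) (c : ℕ → ℝ), (∀ k, 0 ≤ c k) →
      ∫⁻ y in Set.Ioo (0 : ℝ) 1, ENNReal.ofReal (∑ k ∈ S, c k * y ^ L k) ^ s *
        ENNReal.ofReal ((1 - y) ^ (α - 1)) ≤
      ENNReal.ofReal C * ∑ k ∈ S, ENNReal.ofReal (c k ^ s * L k ^ (-α)) := by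
  have hs0 : 0 < s := by linarith
  have hs1 : 0 < s - 1 := by linarith
  obtain ⟨C, hC, hsum⟩ := exists_sum_rpow_le hL hs
    (θ := α / 2 / (s - 1)) (by positivity)
  rw [div_mul_cancel₀ _ hs1.ne'] at hsum
  have hΓ := Real.Gamma_pos_of_pos (half_pos hα)
  refine ⟨C * Real.Gamma (α / 2), by positivity, fun S c hc => ?_⟩
  have hpos := hL.1
  calc _ ≤ ∫⁻ y in Set.Ioo (0 : ℝ) 1, ∑ k ∈ S, ENNReal.ofReal (C * (c k ^ s * L k ^ (-(α / 2)))) *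
        ENNReal.ofReal (y ^ L k * (1 - y) ^ (α / 2 - 1)) := by
        refine setLIntegral_mono' measurableSet_Ioo fun y hy => ?_
        have hD : 0 < 1 - y := by linarith [hy.2]
        have hy0 := hy.1
        have hterm : ∀ k, 0 ≤ c k ^ s * L k ^ (-(α / 2)) := fun k => by
          have := hpos k
          have := hc k
          positivity
        have hsum0 : 0 ≤ ∑ k ∈ S, c k * y ^ L k :=
          Finset.sum_nonneg fun k _ => mul_nonneg (hc k) (by positivity)
        calc _ ≤ ENNReal.ofReal ((C * (1 - y) ^ (-(α / 2)) *
              ∑ k ∈ S, c k ^ s * L k ^ (-(α / 2)) * y ^ L k) * (1 - y) ^ (α - 1)) := by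
              rw [ENNReal.ofReal_rpow_of_nonneg hsum0 hs0.le,
                ← ENNReal.ofReal_mul (by positivity)]
              apply ENNReal.ofReal_le_ofReal
              gcongr
              exact hsum S c hc y hy.1 hy.2
          _ = ENNReal.ofReal (∑ k ∈ S, C * (c k ^ s * L k ^ (-(α / 2))) *
              (y ^ L k * (1 - y) ^ (α / 2 - 1))) := by
              rw [Finset.mul_sum, Finset.sum_mul]
              congr 1
              refine Finset.sum_congr rfl fun k _ => ?_
              rw [show α / 2 - 1 = -(α / 2) + (α - 1) by ring, Real.rpow_add hD]
              ring
          _ = _ := by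
              rw [ENNReal.ofReal_sum_of_nonneg]
              · refine Finset.sum_congr rfl fun k _ => ?_
                rw [ENNReal.ofReal_mul (mul_nonneg hC.le (hterm k))]
              · intro k _
                exact mul_nonneg (mul_nonneg hC.le (hterm k)) (by positivity)
    _ = ∑ k ∈ S, ENNReal.ofReal (C * (c k ^ s * L k ^ (-(α / 2)))) *
        ∫⁻ y in Set.Ioo (0 : ℝ) 1, ENNReal.ofReal (y ^ L k * (1 - y) ^ (α / 2 - 1)) := by
        rw [lintegral_finsetSum]
        · refine Finset.sum_congr rfl fun k _ => ?_
          rw [lintegral_const_mul' _ _ ENNReal.ofReal_ne_top]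
        · intro k _
          fun_prop
    _ ≤ ∑ k ∈ S, ENNReal.ofReal (C * (c k ^ s * L k ^ (-(α / 2)))) *
        ENNReal.ofReal (Real.Gamma (α / 2) * L k ^ (-(α / 2))) := by
        gcongr with k _
        exact lintegral_rpow_mul_one_sub_rpow_le (hpos k) (half_pos hα)
    _ = _ := by
        rw [Finset.mul_sum]
        refine Finset.sum_congr rfl fun k _ => ?_
        have hk := hpos k
        have hck := hc k
        rw [← ENNReal.ofReal_mul (by positivity), ← ENNReal.ofReal_mul (by positivity),
          show -α = -(α / 2) + -(α / 2) by ring, Real.rpow_add hk]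
        ring_nf

theorem sum_rpow_le_rpow_sum {ι : Type*} (S : Finset ι) (f : ι → ℝ≥0∞) {p : ℝ} (hp : 1 ≤ p) :
    ∑ k ∈ S, f k ^ p ≤ (∑ k ∈ S, f k) ^ p := by
  classical
  induction S using Finset.induction_on with
  | empty => simp
  | insert a S ha ih =>
    rw [Finset.sum_insert ha, Finset.sum_insert ha]
    exact (add_le_add_right ih _).trans (ENNReal.add_rpow_le_rpow_add _ _ hp)

theorem le_rpow_of_le_mul_rpow {x A : ℝ≥0∞} {β : ℝ} (hβ : β < 1) (hx : x ≠ ∞)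
    (h : x ≤ A * x ^ β) : x ≤ A ^ (1 / (1 - β)) := by
  have hb : 0 < 1 - β := by linarith
  rcases eq_or_ne x 0 with rfl | h0
  · exact zero_le
  rw [one_div, ENNReal.le_rpow_inv_iff hb, ENNReal.rpow_sub _ _ h0 hx, ENNReal.rpow_one]
  exact ENNReal.div_le_of_le_mul h

/-- The test coefficients turn the assumed inequality into X ≤ K C^β X^β for a partial sum X of the
series, so X is bounded independently of the set of indices. -/
theorem tsum_weightedMoment_lt_top {L : ℕ → ℝ} (hL : GeometricGrowth L) {α β p : ℝ} (hα : 0 < α)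
    (hβ0 : 0 < β) (hβ1 : β < 1) (hp : 1 ≤ p) {μ : Measure I} {K : ℝ≥0∞} (hK : K ≠ ∞)
    (h : ∀ (S : Finset ℕ) (c : ℕ → ℝ), (∀ k, 0 ≤ c k) →
      ∫⁻ t : I, ENNReal.ofReal (∑ k ∈ S, c k * (t : ℝ) ^ L k) ^ p ∂μ ≤
        K * (∫⁻ y in Set.Ioo (0 : ℝ) 1, ENNReal.ofReal (∑ k ∈ S, c k * y ^ L k) ^ (p / β) *
          ENNReal.ofReal ((1 - y) ^ (α - 1))) ^ β) :
    ∑' k, weightedMoment L α β p μ k < ∞ := by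
  have hb : 0 < 1 - β := by linarith
  have hp0 : 0 < p := by linarith
  have hs : 1 < p / β := by rw [lt_div_iff₀ hβ0]; linarith
  have hpos := hL.1
  obtain ⟨C, hC, hnorm⟩ := exists_lintegral_sum_rpow_le hL hs hα
  set J : ℕ → ℝ≥0∞ := fun k => ∫⁻ t : I, ENNReal.ofReal ((t : ℝ) ^ (p * L k)) ∂μ with hJ
  have hpow : ∀ (t : I) (k : ℕ), ENNReal.ofReal ((t : ℝ) ^ L k) ^ p =
      ENNReal.ofReal ((t : ℝ) ^ (p * L k)) := fun t k => by
    rw [ENNReal.ofReal_rpow_of_nonneg (Real.rpow_nonneg t.2.1 _) hp0.le,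
      ← Real.rpow_mul t.2.1, mul_comm]
  have hJtop : ∀ k, J k ≠ ∞ := fun k => by
    have h1 := h {k} (fun _ => 1) fun _ => zero_le_one
    have h2 := hnorm {k} (fun _ => 1) fun _ => zero_le_one
    simp only [Finset.sum_singleton, one_mul, hpow] at h1 h2
    refine ne_top_of_le_ne_top (ENNReal.mul_ne_top hK (ENNReal.rpow_ne_top_of_nonneg hβ0.le ?_)) h1
    exact ne_top_of_le_ne_top (ENNReal.mul_ne_top ENNReal.ofReal_ne_top ENNReal.ofReal_ne_top) h2
  set x : ℕ → ℝ := fun k => L k ^ (α * β) * (J k).toReal with hx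
  have hx0 : ∀ k, 0 ≤ x k := fun k => by have := hpos k; positivity
  have hT : ∀ k, weightedMoment L α β p μ k = ENNReal.ofReal (x k ^ (1 / (1 - β))) := fun k => by
    have hk := hpos k
    rw [hx, Real.mul_rpow (by positivity) (by positivity), ENNReal.ofReal_mul (by positivity),
      ← ENNReal.ofReal_rpow_of_nonneg (ENNReal.toReal_nonneg) (by positivity),
      ENNReal.ofReal_toReal (hJtop k), ← Real.rpow_mul hk.le, weightedMoment,
      ENNReal.ofReal_rpow_of_pos hk, mul_one_div]
  -- The solution of c_k^p J_k = c_k^{p/β} L_k^{-α} when J_k > 0: both sides equal the weighted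
  -- moment.
  set c : ℕ → ℝ := fun k => (x k ^ (β / (1 - β)) * L k ^ (α * β)) ^ (1 / p) with hc
  have hc0 : ∀ k, 0 ≤ c k := fun k => by
    have := hpos k
    have := hx0 k
    positivity
  have hβb : β / (1 - β) * (1 / β) = 1 / (1 - β) := by field_simp
  have hcs : ∀ k, c k ^ (p / β) * L k ^ (-α) = x k ^ (1 / (1 - β)) := fun k => by
    have hk := hpos k
    have hxk := hx0 k
    rw [hc, ← Real.rpow_mul (by positivity), show 1 / p * (p / β) = 1 / β by field_simp,
      Real.mul_rpow (by positivity) (by positivity), ← Real.rpow_mul hxk, ← Real.rpow_mul hk.le,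
      hβb, show α * β * (1 / β) = α by field_simp, mul_assoc, ← Real.rpow_add hk, add_neg_cancel,
      Real.rpow_zero, mul_one]
  have hcp : ∀ k, ENNReal.ofReal (c k) ^ p * J k = ENNReal.ofReal (x k ^ (1 / (1 - β))) :=
    fun k => by
    have hk := hpos k
    have hxk := hx0 k
    rw [ENNReal.ofReal_rpow_of_nonneg (hc0 k) hp0.le, ← ENNReal.ofReal_toReal (hJtop k),
      ← ENNReal.ofReal_mul (Real.rpow_nonneg (hc0 k) _), hc, ← Real.rpow_mul (by positivity),
      one_div_mul_cancel hp0.ne', Real.rpow_one, mul_assoc]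
    congr 1
    change x k ^ (β / (1 - β)) * x k = _
    rw [show 1 / (1 - β) = β / (1 - β) + 1 by field_simp; ring,
      Real.rpow_add_one' hxk (by positivity)]
  refine lt_of_le_of_lt ?_ (ENNReal.rpow_lt_top_of_nonneg (by positivity : 0 ≤ 1 / (1 - β))
    (ENNReal.mul_ne_top hK (ENNReal.rpow_ne_top_of_nonneg hβ0.le
      (ENNReal.ofReal_ne_top (r := C)))))
  rw [ENNReal.tsum_eq_iSup_sum]
  refine iSup_le fun S => ?_
  -- Dividing by X^β requires X finite; this holds because each moment J k is finite, by the test on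
  -- a single monomial.
  refine le_rpow_of_le_mul_rpow hβ1 ?_ ?_
  · rw [ENNReal.sum_ne_top]
    intro k _
    rw [hT]
    exact ENNReal.ofReal_ne_top
  calc ∑ k ∈ S, weightedMoment L α β p μ k
      = ∑ k ∈ S, ∫⁻ t : I, ENNReal.ofReal (c k) ^ p * ENNReal.ofReal ((t : ℝ) ^ L k) ^ p ∂μ := by
        refine Finset.sum_congr rfl fun k _ => ?_
        simp only [hpow]
        rw [lintegral_const_mul' _ _ (ENNReal.rpow_ne_top_of_nonneg hp0.le ENNReal.ofReal_ne_top),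
          hT, ← hcp]
    _ = ∫⁻ t : I, ∑ k ∈ S, ENNReal.ofReal (c k) ^ p * ENNReal.ofReal ((t : ℝ) ^ L k) ^ p ∂μ := by
        rw [lintegral_finsetSum]
        intro k _
        have : Measurable fun t : I => (t : ℝ) := measurable_subtype_coe
        fun_prop
    _ ≤ ∫⁻ t : I, ENNReal.ofReal (∑ k ∈ S, c k * (t : ℝ) ^ L k) ^ p ∂μ := by
        refine lintegral_mono fun t => ?_
        rw [ENNReal.ofReal_sum_of_nonneg fun k _ => mul_nonneg (hc0 k) (Real.rpow_nonneg t.2.1 _)]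
        refine le_trans (le_of_eq ?_) (sum_rpow_le_rpow_sum S _ hp)
        refine Finset.sum_congr rfl fun k _ => ?_
        rw [ENNReal.ofReal_mul (hc0 k), ENNReal.mul_rpow_of_nonneg _ _ hp0.le]
    _ ≤ K * (ENNReal.ofReal C * ∑ k ∈ S, ENNReal.ofReal (c k ^ (p / β) * L k ^ (-α))) ^ β := by
        refine (h S c hc0).trans ?_
        gcongr
        exact hnorm S c hc0
    _ = _ := by
        simp only [hcs, hT]
        rw [ENNReal.mul_rpow_of_nonneg _ _ hβ0.le, mul_assoc]

/-! ### Compactness of the extended operator -/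

theorem isCompactOperator_of_range_le {E F : Type*} [NormedAddCommGroup E] [NormedSpace ℂ E]
    [NormedAddCommGroup F] [NormedSpace ℂ F] (T : E →L[ℂ] F) (V : Submodule ℂ F)
    [FiniteDimensional ℂ V] (hT : ∀ x, T x ∈ V) : IsCompactOperator T := by
  have := FiniteDimensional.proper ℂ V
  have h := (isCompactOperator_id (E := V)).comp_clm (T.codRestrict V hT)
  exact h.clm_comp V.subtypeL

/-- T m extends the map that sends v k to w k for k in P m and to 0 otherwise; the norm bound makes
it well defined even if the v k are linearly dependent. T 0 - T m has range in the span of the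
finitely many omitted w k, and T m → 0 in norm, so T 0 is a limit of finite rank operators. -/
theorem exists_compact_extension {E F : Type*} [NormedAddCommGroup E] [NormedSpace ℂ E]
    [NormedAddCommGroup F] [NormedSpace ℂ F] [CompleteSpace F] {v : ℕ → E} (w : ℕ → F)
    (hv : Dense (Submodule.span ℂ (Set.range v) : Set E)) {κ : ℕ → ℝ}
    (hκ : Tendsto κ atTop (nhds 0)) {P : ℕ → Set ℕ} (hP0 : P 0 = Set.univ)
    (hP : ∀ m, (P m)ᶜ.Finite)
    (h : ∀ m (x : ℕ →₀ ℂ), ‖Finsupp.linearCombination ℂ ((P m).indicator w) x‖ ≤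
      κ m * ‖Finsupp.linearCombination ℂ v x‖) :
    ∃ ι : E →L[ℂ] F, (∀ k, ι (v k) = w k) ∧ IsCompactOperator ι := by
  have hd : DenseRange (Finsupp.linearCombination ℂ v) := by
    rw [DenseRange, ← LinearMap.coe_range, Finsupp.range_linearCombination]
    exact hv
  set T : ℕ → E →L[ℂ] F := fun m =>
    (Finsupp.linearCombination ℂ ((P m).indicator w)).extendOfNorm (Finsupp.linearCombination ℂ v)
    with hTdef
  have hT : ∀ m x, T m (Finsupp.linearCombination ℂ v x) =
      Finsupp.linearCombination ℂ ((P m).indicator w) x := fun m x =>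
    LinearMap.extendOfNorm_eq hd ⟨κ m, h m⟩ x
  have hTn : ∀ m, ‖T m‖ ≤ |κ m| := fun m =>
    LinearMap.opNorm_extendOfNorm_le hd (abs_nonneg _) fun x =>
      (h m x).trans (mul_le_mul_of_nonneg_right (le_abs_self _) (norm_nonneg _))
  refine ⟨T 0, fun k => ?_, ?_⟩
  · have := hT 0 (Finsupp.single k 1)
    simpa [hP0] using this
  have hT0 : Tendsto T atTop (nhds 0) := by
    rw [tendsto_zero_iff_norm_tendsto_zero]
    refine squeeze_zero (fun m => norm_nonneg _) hTn ?_
    simpa using hκ.abs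
  have hlim : Tendsto (fun m => T 0 - T m) atTop (nhds (T 0)) := by
    simpa using hT0.const_sub (T 0)
  refine isCompactOperator_of_tendsto hlim (Eventually.of_forall fun m => ?_)
  have : FiniteDimensional ℂ (Submodule.span ℂ (w '' (P m)ᶜ)) :=
    FiniteDimensional.span_of_finite ℂ ((hP m).image w)
  refine isCompactOperator_of_range_le _ (Submodule.span ℂ (w '' (P m)ᶜ)) fun x => ?_
  -- A finite-dimensional subspace is closed, so the range condition need only be checked on the
  -- dense span.
  refine hd.induction_on (p := fun x => (T 0 - T m) x ∈ Submodule.span ℂ (w '' (P m)ᶜ)) x ?_ ?_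
  · exact (Submodule.closed_of_finiteDimensional _).preimage (T 0 - T m).continuous
  intro y
  rw [sub_apply, hT, hT, hP0, Set.indicator_univ,
    Finsupp.linearCombination_apply, Finsupp.linearCombination_apply, ← Finsupp.sum_sub]
  refine Submodule.sum_mem _ fun k _ => ?_
  change y k • w k - y k • (P m).indicator w k ∈ _
  rw [← smul_sub]
  refine Submodule.smul_mem _ _ ?_
  by_cases hk : k ∈ P m
  · simp [hk]
  · rw [Set.indicator_of_notMem hk, sub_zero]
    exact Submodule.subset_span ⟨k, hk, rfl⟩

/-! ### The weighted spaces and the inclusion operator -/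

theorem lintegral_nu (α : ℝ) {G : ℝ → ℝ≥0∞} (hG : Measurable G) :
    ∫⁻ t : I, G t ∂nu α = ∫⁻ y in Set.Ioo (0 : ℝ) 1, G y * ENNReal.ofReal ((1 - y) ^ (α - 1)) := by
  have hcoe : Measurable fun t : I => (t : ℝ) := measurable_subtype_coe
  have hw : Measurable fun y : ℝ => ENNReal.ofReal ((1 - y) ^ (α - 1)) := by fun_prop
  refine (lintegral_withDensity_eq_lintegral_mul _ (hw.comp hcoe) (hG.comp hcoe)).trans ?_
  rw [setLIntegral_congr Ioo_ae_eq_Icc]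
  refine Eq.trans ?_ (unitInterval.measurePreserving_coe.lintegral_comp (hG.mul hw))
  exact lintegral_congr fun t => mul_comm _ _

theorem continuous_monomial {u : ℝ} (hu : 0 < u) :
    Continuous fun t : I => (((t : ℝ) ^ u : ℝ) : ℂ) :=
  Complex.continuous_ofReal.comp (continuous_subtype_val.rpow_const fun _ => Or.inr hu.le)

theorem eLpNorm_rpow_eq_lintegral {ν : Measure I} {s : ℝ} (hs : 1 ≤ s) (f : I → ℂ) :
    eLpNorm f (ENNReal.ofReal s) ν ^ s = ∫⁻ t, ENNReal.ofReal ‖f t‖ ^ s ∂ν := by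
  have hs0 : 0 < s := by linarith
  rw [eLpNorm_eq_lintegral_rpow_enorm_toReal (by simpa using hs0) ENNReal.ofReal_ne_top,
    ENNReal.toReal_ofReal hs0.le, ← ENNReal.rpow_mul, one_div_mul_cancel hs0.ne', ENNReal.rpow_one]
  simp only [ofReal_norm]

theorem memLp_of_lintegral_lt_top {ν : Measure I} {s : ℝ} (hs : 1 ≤ s) {f : I → ℂ}
    (hf : Continuous f) (h : ∫⁻ t, ENNReal.ofReal ‖f t‖ ^ s ∂ν < ∞) :
    MemLp f (ENNReal.ofReal s) ν := by
  refine ⟨hf.aestronglyMeasurable, ?_⟩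
  have hs0 : 0 < s := by linarith
  rw [← eLpNorm_rpow_eq_lintegral hs] at h
  exact (ENNReal.rpow_lt_top_iff_of_pos hs0).1 h

theorem memLp_monomial_nu {u s α : ℝ} (hu : 0 < u) (hs : 1 ≤ s) (hα : 0 < α) :
    MemLp (fun t : I => (((t : ℝ) ^ u : ℝ) : ℂ)) (ENNReal.ofReal s) (nu α) := by
  have hs0 : 0 < s := by linarith
  refine memLp_of_lintegral_lt_top hs (continuous_monomial hu) ?_
  rw [lintegral_nu α (G := fun y => ENNReal.ofReal ‖((y ^ u : ℝ) : ℂ)‖ ^ s) (by fun_prop)]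
  refine lt_of_le_of_lt (le_trans (le_of_eq ?_)
    (lintegral_rpow_mul_one_sub_rpow_le (u := s * u) (by positivity) hα)) ENNReal.ofReal_lt_top
  refine setLIntegral_congr_fun measurableSet_Ioo fun y hy => ?_
  have hy0 := hy.1
  rw [Complex.norm_real, Real.norm_of_nonneg (by positivity),
    ENNReal.ofReal_rpow_of_nonneg (by positivity) hs0.le, ← Real.rpow_mul hy0.le, mul_comm u,
    ENNReal.ofReal_mul (by positivity)]

theorem memLp_of_mem_polynomials {lam : ℕ → ℝ} {r : ℝ≥0∞} {ν : Measure I}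
    (h : ∀ k, MemLp (fun t : I => (((t : ℝ) ^ lam k : ℝ) : ℂ)) r ν) {f : I → ℂ}
    (hf : f ∈ polynomials lam) : MemLp f r ν := by
  induction hf using Submodule.span_induction with
  | mem f hf =>
    obtain ⟨k, rfl⟩ := hf
    exact h k
  | zero => exact MemLp.zero
  | add f g _ _ hf hg => exact hf.add hg
  | smul c f _ hf => exact hf.const_smul c

theorem exists_eq_sum_of_mem_polynomials {lam : ℕ → ℝ} {f : I → ℂ} (hf : f ∈ polynomials lam) :
    ∃ x : ℕ →₀ ℂ, f = fun t : I => ∑ j ∈ x.support, x j * (((t : ℝ) ^ lam j : ℝ) : ℂ) := by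
  obtain ⟨x, rfl⟩ := Finsupp.mem_span_range_iff_exists_finsupp.1 hf
  refine ⟨x, ?_⟩
  ext t
  simp [Finsupp.sum]

theorem coeFn_sum_smul {r : ℝ≥0∞} {ν : Measure I} {W : ℕ → Lp ℂ r ν} {φ : ℕ → I → ℂ}
    (h : ∀ j, W j =ᵐ[ν] φ j) (S : Finset ℕ) (a : ℕ → ℂ) :
    (∑ j ∈ S, a j • W j : Lp ℂ r ν) =ᵐ[ν] fun t => ∑ j ∈ S, a j * φ j t := by
  classical
  induction S using Finset.induction_on with
  | empty =>
    simp only [Finset.sum_empty]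
    exact Lp.coeFn_zero ℂ r ν
  | insert j S hj ih =>
    rw [Finset.sum_insert hj]
    filter_upwards [Lp.coeFn_add (a j • W j) (∑ j ∈ S, a j • W j), Lp.coeFn_smul (a j) (W j), ih,
      h j] with t h1 h2 h3 h4
    rw [h1, Finset.sum_insert hj, Pi.add_apply, h2, h3, Pi.smul_apply, h4, smul_eq_mul]

theorem tsum_weightedMoment_lt_top_of_isInclusion {lam L : ℕ → ℝ} (hL : GeometricGrowth L)
    (hlam : ∀ k, 0 < lam k) (hsub : ∀ k, ∃ j, L k = lam j) {α β p : ℝ} (hα : 0 < α) (hβ0 : 0 < β)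
    (hβ1 : β < 1) (hp : 1 ≤ p) {μ : Measure I} [Fact (1 ≤ ENNReal.ofReal (p / β))]
    [Fact (1 ≤ ENNReal.ofReal p)]
    {ι : space lam α (ENNReal.ofReal (p / β)) →L[ℂ] Lp ℂ (ENNReal.ofReal p) μ}
    (hι : IsInclusion lam α (ENNReal.ofReal (p / β)) (ENNReal.ofReal p) μ ι) :
    ∑' k, weightedMoment L α β p μ k < ∞ := by
  have hp0 : 0 < p := by linarith
  have hs : 1 ≤ p / β := (one_le_div hβ0).2 (hβ1.le.trans hp)
  refine tsum_weightedMoment_lt_top hL hα hβ0 hβ1 hp (K := ‖ι‖ₑ ^ p)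
    (ENNReal.rpow_ne_top_of_nonneg hp0.le enorm_ne_top) fun S c hc => ?_
  set f : I → ℂ := ∑ k ∈ S, (c k : ℂ) • fun t : I => (((t : ℝ) ^ L k : ℝ) : ℂ) with hf
  have hfp : f ∈ polynomials lam := by
    refine Submodule.sum_mem _ fun k _ => Submodule.smul_mem _ _ ?_
    obtain ⟨j, hj⟩ := hsub k
    exact Submodule.subset_span ⟨j, by simp only [hj]⟩
  have hfn : ∀ y : ℝ, 0 ≤ y → ‖((∑ k ∈ S, c k * y ^ L k : ℝ) : ℂ)‖ = ∑ k ∈ S, c k * y ^ L k :=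
    fun y hy => by
    rw [Complex.norm_real, Real.norm_of_nonneg]
    exact Finset.sum_nonneg fun k _ => mul_nonneg (hc k) (Real.rpow_nonneg hy _)
  have hft : ∀ t : I, f t = ((∑ k ∈ S, c k * (t : ℝ) ^ L k : ℝ) : ℂ) := fun t => by
    simp [hf]
  have hmem : MemLp f (ENNReal.ofReal (p / β)) (nu α) :=
    memLp_of_mem_polynomials (fun k => memLp_monomial_nu (hlam k) hs hα) hfp
  set g : space lam α (ENNReal.ofReal (p / β)) := ⟨hmem.toLp f,
    Submodule.le_topologicalClosure _ ⟨f, hfp, hmem.coeFn_toLp⟩⟩ with hg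
  have hιg : ι g =ᵐ[μ] f := hι f hfp g hmem.coeFn_toLp
  have hgn : ‖g‖ₑ ^ (p / β) = ∫⁻ y in Set.Ioo (0 : ℝ) 1,
      ENNReal.ofReal (∑ k ∈ S, c k * y ^ L k) ^ (p / β) * ENNReal.ofReal ((1 - y) ^ (α - 1)) := by
    have h1 : ‖g‖ₑ = eLpNorm f (ENNReal.ofReal (p / β)) (nu α) := by
      change ‖hmem.toLp f‖ₑ = _
      rw [Lp.enorm_def, eLpNorm_congr_ae hmem.coeFn_toLp]
    rw [h1, eLpNorm_rpow_eq_lintegral hs]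
    simp only [hft]
    rw [lintegral_nu α (G := fun y => ENNReal.ofReal ‖((∑ k ∈ S, c k * y ^ L k : ℝ) : ℂ)‖ ^ (p / β))
      (by fun_prop)]
    refine setLIntegral_congr_fun measurableSet_Ioo fun y hy => ?_
    simp only [hfn y hy.1.le]
  calc ∫⁻ t : I, ENNReal.ofReal (∑ k ∈ S, c k * (t : ℝ) ^ L k) ^ p ∂μ
      = ∫⁻ t : I, ENNReal.ofReal ‖f t‖ ^ p ∂μ := by
        refine lintegral_congr fun t => ?_
        rw [hft, hfn _ t.2.1]
    _ = ‖ι g‖ₑ ^ p := by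
        rw [← eLpNorm_rpow_eq_lintegral hp, Lp.enorm_def, eLpNorm_congr_ae hιg]
    _ ≤ (‖ι‖ₑ * ‖g‖ₑ) ^ p := by
        gcongr
        exact ι.le_opENorm g
    _ = _ := by
        rw [← hgn, ENNReal.mul_rpow_of_nonneg _ _ hp0.le, ← ENNReal.rpow_mul, div_mul_cancel₀ _ hβ0.ne']

/-- Dominated convergence for the counting measure: each exponential tends to 0 and T is a summable
majorant. -/
theorem tendsto_tsum_exp_mul {T : ℕ → ℝ≥0∞} (hT : ∑' k, T k ≠ ∞) {u L : ℕ → ℝ} {c : ℝ} (hc : 0 < c)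
    (hu : Tendsto u atTop atTop) (hu0 : ∀ m, 0 < u m) (hL : ∀ k, 0 < L k) :
    Tendsto (fun m => ∑' k, ENNReal.ofReal (Real.exp (-(c * u m / L k))) * T k) atTop
      (nhds 0) := by
  have h := tendsto_lintegral_of_dominated_convergence (μ := Measure.count)
    (F := fun m k => ENNReal.ofReal (Real.exp (-(c * u m / L k))) * T k) (f := fun _ : ℕ => 0) T
    (fun m => measurable_of_countable _) (fun m => Eventually.of_forall fun k => ?_)
    (by rwa [lintegral_count]) (Eventually.of_forall fun k => ?_)
  · simpa only [lintegral_count, tsum_zero] using h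
  · refine mul_le_of_le_one_left zero_le ?_
    rw [ENNReal.ofReal_le_one, Real.exp_le_one_iff, neg_nonpos]
    have := hL k
    have := hu0 m
    positivity
  · have h1 : Tendsto (fun m => -(c * u m / L k)) atTop atBot :=
      tendsto_neg_atTop_atBot.comp ((hu.const_mul_atTop hc).atTop_div_const (hL k))
    have h2 := ENNReal.tendsto_ofReal (Real.tendsto_exp_atBot.comp h1)
    rw [ENNReal.ofReal_zero] at h2
    simpa using ENNReal.Tendsto.mul_const h2
      (Or.inr (ENNReal.ne_top_of_tsum_ne_top hT k))

theorem dense_span_monomials {lam : ℕ → ℝ} {α : ℝ} {s : ℝ≥0∞} [Fact (1 ≤ s)]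
    {v : ℕ → space lam α s}
    (hv : ∀ k, (v k : Lp ℂ s (nu α)) =ᵐ[nu α] fun t : I => (((t : ℝ) ^ lam k : ℝ) : ℂ)) :
    Dense (Submodule.span ℂ (Set.range v) : Set (space lam α s)) := by
  refine Subtype.dense_iff.2 ?_
  refine closure_mono ?_
  rintro g ⟨f, hf, hgf⟩
  obtain ⟨x, rfl⟩ := exists_eq_sum_of_mem_polynomials hf
  refine ⟨∑ j ∈ x.support, x j • v j, Submodule.sum_mem _ fun j _ =>
    Submodule.smul_mem _ _ (Submodule.subset_span ⟨j, rfl⟩), ?_⟩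
  refine Lp.ext (EventuallyEq.trans ?_ hgf.symm)
  rw [Submodule.coe_sum]
  exact coeFn_sum_smul hv x.support x

theorem isInclusion_of_apply_monomial {lam : ℕ → ℝ} {α : ℝ} {s r : ℝ≥0∞} [Fact (1 ≤ s)]
    [Fact (1 ≤ r)] {μ : Measure I} {ι : space lam α s →L[ℂ] Lp ℂ r μ} {v : ℕ → space lam α s}
    (hv : ∀ k, (v k : Lp ℂ s (nu α)) =ᵐ[nu α] fun t : I => (((t : ℝ) ^ lam k : ℝ) : ℂ))
    (hι : ∀ k, ι (v k) =ᵐ[μ] fun t : I => (((t : ℝ) ^ lam k : ℝ) : ℂ)) :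
    IsInclusion lam α s r μ ι := by
  intro f hf g hgf
  obtain ⟨x, rfl⟩ := exists_eq_sum_of_mem_polynomials hf
  have hg : g = ∑ j ∈ x.support, x j • v j := by
    refine Subtype.ext (Lp.ext (hgf.trans ?_))
    rw [Submodule.coe_sum]
    exact (coeFn_sum_smul hv x.support x).symm
  rw [hg, map_sum]
  simp only [map_smul]
  exact coeFn_sum_smul hι x.support x

/-- The tail bound reads ‖tail_m f‖ ≤ A m ‖f‖ with A m → 0, which is the hypothesis of
`exists_compact_extension` when P m consists of the exponents beyond u m. -/
theorem exists_isInclusion_isCompactOperator {lam L : ℕ → ℝ} (hlam : GeometricGrowth lam)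
    (hmono : StrictMono lam) {Q : ℝ} (hQ : ∀ k, lam (k + 1) ≤ Q * lam k)
    (hL : GeometricGrowth L) (hLmono : StrictMono L) (hL0 : L 0 = lam 0) {Q' : ℝ}
    (hQ' : ∀ k, L (k + 1) ≤ Q' * L k) {α β p : ℝ} (hα : 0 < α) (hβ0 : 0 < β) (hβ1 : β < 1)
    (hp : 1 ≤ p) {μ : Measure I} [Fact (1 ≤ ENNReal.ofReal (p / β))]
    [Fact (1 ≤ ENNReal.ofReal p)] (h : ∑' k, weightedMoment L α β p μ k < ∞) :
    ∃ ι : space lam α (ENNReal.ofReal (p / β)) →L[ℂ] Lp ℂ (ENNReal.ofReal p) μ,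
      IsInclusion lam α (ENNReal.ofReal (p / β)) (ENNReal.ofReal p) μ ι ∧ IsCompactOperator ι := by
  have hp0 : 0 < p := by linarith
  have hb : 0 < 1 - β := by linarith
  have hs : 1 ≤ p / β := (one_le_div hβ0).2 (hβ1.le.trans hp)
  obtain ⟨u, C, c, hu, hC, hc, hu0, hbound⟩ := exists_tail_lintegral_bound hlam hmono hQ hL hLmono
    hL0 hQ' hα hβ0 hβ1 hp (measure_singleton_one_eq_zero hL.1 hLmono hα hβ0 hβ1 h)
  set Θ : ℕ → ℝ≥0∞ := fun m => ∑' k, ENNReal.ofReal (Real.exp (-(c * u m / L k))) *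
    weightedMoment L α β p μ k with hΘ
  have hΘ0 : Tendsto Θ atTop (nhds 0) :=
    tendsto_tsum_exp_mul h.ne hc hu.tendsto_atTop hu.1 hL.1
  have hΘtop : ∀ m, Θ m ≠ ∞ := fun m => by
    refine ne_top_of_le_ne_top h.ne (ENNReal.tsum_le_tsum fun k => ?_)
    refine mul_le_of_le_one_left zero_le ?_
    rw [ENNReal.ofReal_le_one, Real.exp_le_one_iff, neg_nonpos]
    have := hL.1 k
    have := hu.1 m
    positivity
  set A : ℕ → ℝ≥0∞ := fun m => (ENNReal.ofReal C * Θ m ^ (1 - β)) ^ (1 / p) with hA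
  have hAtop : ∀ m, A m ≠ ∞ := fun m =>
    ENNReal.rpow_ne_top_of_nonneg (by positivity) (ENNReal.mul_ne_top ENNReal.ofReal_ne_top
      (ENNReal.rpow_ne_top_of_nonneg hb.le (hΘtop m)))
  have hA0 : Tendsto A atTop (nhds 0) := by
    have h1 := ((ENNReal.continuous_rpow_const (y := 1 - β)).tendsto 0).comp hΘ0
    rw [ENNReal.zero_rpow_of_pos hb] at h1
    have h2 := ENNReal.Tendsto.const_mul (a := ENNReal.ofReal C) h1 (Or.inr ENNReal.ofReal_ne_top)
    rw [mul_zero] at h2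
    have h3 := ((ENNReal.continuous_rpow_const (y := 1 / p)).tendsto 0).comp h2
    rwa [ENNReal.zero_rpow_of_pos (by positivity)] at h3
  have hν : ∀ k, MemLp (fun t : I => (((t : ℝ) ^ lam k : ℝ) : ℂ)) (ENNReal.ofReal (p / β))
      (nu α) := fun k => memLp_monomial_nu (hlam.1 k) hs hα
  have hsum : ∀ (a : ℕ → ℂ) (n : ℕ), MemLp (fun t : I => muntzSum lam a n t)
      (ENNReal.ofReal (p / β)) (nu α) := fun a n => by
    unfold muntzSum
    exact memLp_finsetSum _ fun j _ => (hν j).const_mul (a j)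
  have hbound' : ∀ (a : ℕ → ℂ) (n m : ℕ),
      eLpNorm (fun t : I => ∑ j ∈ (Finset.range n).filter (fun j => u m < lam j + 1),
        a j * (((t : ℝ) ^ lam j : ℝ) : ℂ)) (ENNReal.ofReal p) μ ≤
      A m * eLpNorm (fun t : I => muntzSum lam a n t) (ENNReal.ofReal (p / β)) (nu α) := by
    intro a n m
    have hcont := (continuous_muntzSum hlam.1 a n).norm.measurable
    rw [← ENNReal.rpow_le_rpow_iff hp0, eLpNorm_rpow_eq_lintegral hp,
      ENNReal.mul_rpow_of_nonneg _ _ hp0.le, hA, ← ENNReal.rpow_mul, one_div_mul_cancel hp0.ne',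
      ENNReal.rpow_one]
    refine (hbound a n m).trans (le_of_eq ?_)
    rw [← lintegral_nu α (G := fun y => ENNReal.ofReal ‖muntzSum lam a n y‖ ^ (p / β))
      (by fun_prop), ← eLpNorm_rpow_eq_lintegral hs, ← ENNReal.rpow_mul, div_mul_cancel₀ _ hβ0.ne']
  -- The tail for m = 0 omits nothing. Its bound therefore places the monomials in L^p(μ) and makes
  -- the inclusion itself continuous.
  have hall : ∀ j, u 0 < lam j + 1 := fun j => by
    linarith [hmono.monotone (Nat.zero_le j)]
  have hμ : ∀ k, MemLp (fun t : I => (((t : ℝ) ^ lam k : ℝ) : ℂ)) (ENNReal.ofReal p) μ := by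
    intro k
    refine ⟨(continuous_monomial (hlam.1 k)).aestronglyMeasurable, ?_⟩
    have h1 := hbound' (Pi.single k 1) (k + 1) 0
    have h2 : (fun t : I => ∑ j ∈ (Finset.range (k + 1)).filter (fun j => u 0 < lam j + 1),
        (Pi.single k 1 : ℕ → ℂ) j * (((t : ℝ) ^ lam j : ℝ) : ℂ)) =
        fun t : I => (((t : ℝ) ^ lam k : ℝ) : ℂ) := by
      ext t
      rw [Finset.sum_eq_single k]
      · simp
      · intro j _ hj
        simp [hj]
      · intro hk
        simp [hall] at hk
    rw [h2] at h1
    exact h1.trans_lt (ENNReal.mul_lt_top (hAtop 0).lt_top (hsum _ _).2)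
  set v : ℕ → space lam α (ENNReal.ofReal (p / β)) := fun k => ⟨(hν k).toLp _,
    Submodule.le_topologicalClosure _
      ⟨_, Submodule.subset_span ⟨k, rfl⟩, (hν k).coeFn_toLp⟩⟩
  have hv : ∀ k, (v k : Lp ℂ (ENNReal.ofReal (p / β)) (nu α)) =ᵐ[nu α]
      fun t : I => (((t : ℝ) ^ lam k : ℝ) : ℂ) := fun k => (hν k).coeFn_toLp
  set w : ℕ → Lp ℂ (ENNReal.ofReal p) μ := fun k => (hμ k).toLp _
  have hw : ∀ k, w k =ᵐ[μ] fun t : I => (((t : ℝ) ^ lam k : ℝ) : ℂ) := fun k => (hμ k).coeFn_toLp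
  suffices hex : ∃ ι : space lam α (ENNReal.ofReal (p / β)) →L[ℂ] Lp ℂ (ENNReal.ofReal p) μ,
      (∀ k, ι (v k) = w k) ∧ IsCompactOperator ι by
    obtain ⟨ι, hι, hcomp⟩ := hex
    exact ⟨ι, isInclusion_of_apply_monomial hv fun k => (hι k).symm ▸ hw k, hcomp⟩
  refine exists_compact_extension w (dense_span_monomials hv)
    (κ := fun m => (A m).toReal) (P := fun m => {j | u m < lam j + 1}) ?_
    (Set.eq_univ_of_forall hall) (fun m => ?_) fun m x => ?_
  · exact (ENNReal.tendsto_toReal ENNReal.zero_ne_top).comp hA0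
  · obtain ⟨k, hk⟩ := (hlam.tendsto_atTop.eventually_gt_atTop (u m)).exists
    refine (Set.finite_lt_nat k).subset fun j hj => ?_
    by_contra hjk
    have := hmono.monotone (not_lt.1 hjk)
    refine hj ?_
    change u m < lam j + 1
    linarith
  · obtain ⟨n, hn⟩ := x.support.exists_nat_subset_range
    have e1 : Finsupp.linearCombination ℂ ({j | u m < lam j + 1}.indicator w) x =
        ∑ j ∈ (Finset.range n).filter (fun j => u m < lam j + 1), x j • w j := by
      rw [Finsupp.linearCombination_apply, Finsupp.sum_of_support_subset _ hn _ (by simp),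
        Finset.sum_filter]
      refine Finset.sum_congr rfl fun j _ => ?_
      by_cases hj : u m < lam j + 1
      · rw [if_pos hj, Set.indicator_of_mem (by exact hj)]
      · rw [if_neg hj, Set.indicator_of_notMem (by exact hj), smul_zero]
    have e2 : Finsupp.linearCombination ℂ v x = ∑ j ∈ Finset.range n, x j • v j := by
      rw [Finsupp.linearCombination_apply, Finsupp.sum_of_support_subset _ hn _ (by simp)]
    have n1 : ‖Finsupp.linearCombination ℂ ({j | u m < lam j + 1}.indicator w) x‖ₑ =
        eLpNorm (fun t : I => ∑ j ∈ (Finset.range n).filter (fun j => u m < lam j + 1),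
        x j * (((t : ℝ) ^ lam j : ℝ) : ℂ)) (ENNReal.ofReal p) μ := by
      rw [e1, Lp.enorm_def]
      exact eLpNorm_congr_ae (coeFn_sum_smul hw _ x)
    have n2 : ‖Finsupp.linearCombination ℂ v x‖ₑ =
        eLpNorm (fun t : I => muntzSum lam x n t) (ENNReal.ofReal (p / β)) (nu α) := by
      rw [e2]
      change ‖((∑ j ∈ Finset.range n, x j • v j : space lam α (ENNReal.ofReal (p / β))) :
        Lp ℂ (ENNReal.ofReal (p / β)) (nu α))‖ₑ = _
      rw [Lp.enorm_def, Submodule.coe_sum]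
      exact eLpNorm_congr_ae (coeFn_sum_smul hv _ x)
    have h1 := hbound' x n m
    rw [← n1, ← n2] at h1
    have h2 := ENNReal.toReal_mono (ENNReal.mul_ne_top (hAtop m) enorm_ne_top) h1
    rwa [ENNReal.toReal_mul, toReal_enorm, toReal_enorm] at h2

end Muntz

theorem mainTheorem5 (lam : ℕ → ℝ) (n : ℕ → ℕ)
    (hquasi : Muntz.IsQuasiLacunary lam n) (hsub : Muntz.IsSubgeometric lam n)
    (μ : Measure I) (α β p : ℝ) (hα : 0 < α) (hβ0 : 0 < β) (hβ1 : β < 1) (hp : 1 ≤ p) :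
    (Muntz.Embeds lam α (p / β) p ((one_le_div hβ0).2 (hβ1.le.trans hp)) hp μ ↔
      ∑' k : ℕ, ENNReal.ofReal (lam (n k)) ^ (α * β / (1 - β)) *
        (∫⁻ t : I, ENNReal.ofReal ((t : ℝ) ^ (p * lam (n k))) ∂μ) ^ (1 / (1 - β)) < ∞) ∧
    (Muntz.Embeds lam α (p / β) p ((one_le_div hβ0).2 (hβ1.le.trans hp)) hp μ →
      Muntz.EmbedsCompactly lam α (p / β) p ((one_le_div hβ0).2 (hβ1.le.trans hp)) hp μ) := by
  have hs : 1 ≤ p / β := (one_le_div hβ0).2 (hβ1.le.trans hp)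
  have _ := Muntz.fact_one_le hs
  have _ := Muntz.fact_one_le hp
  obtain ⟨Q, hQ⟩ := hquasi.exists_ratio_le hsub
  have hL := hquasi.geometricGrowth_comp
  have hnec : Muntz.Embeds lam α (p / β) p hs hp μ →
      ∑' k, Muntz.weightedMoment (fun k => lam (n k)) α β p μ k < ∞ := fun ⟨_, hι⟩ =>
    Muntz.tsum_weightedMoment_lt_top_of_isInclusion hL hquasi.pos (fun k => ⟨n k, rfl⟩) hα hβ0 hβ1
      hp hι
  have hsuff : ∑' k, Muntz.weightedMoment (fun k => lam (n k)) α β p μ k < ∞ →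
      Muntz.EmbedsCompactly lam α (p / β) p hs hp μ := fun h =>
    -- The full sequence Λ carries the tail bound and the subsequence λ_{n_k} the annuli; they share
    -- the first term because n 0 = 0.
    Muntz.exists_isInclusion_isCompactOperator hquasi.geometricGrowth hquasi.strictMono
      (hquasi.succ_le_mul hQ) hL (hquasi.strictMono.comp hquasi.index_strictMono)
      (by rw [hquasi.index_zero]) hQ hα hβ0 hβ1 hp h
  exact ⟨⟨hnec, fun h => (hsuff h).imp fun _ h => h.1⟩, fun h => hsuff (hnec h)⟩
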